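/- **Setup.** Let $q_1,q_2,q_3,q_4\in\mathbb C$ with $q_1q_2q_3q_4=1$ and $q_1,q_2,q_3$ multiplicatively independent, let $K\in\mathbb C^\times$ not be a Laurent monomial in $q_1,q_2,q_3$, and let $x\in\mathbb C^\times$. For $S\subseteq\{1,2,3,4\}$ put $P_S=\prod_{a\in S}(1-q_a)$. A *character* is a Laurent polynomial with integer coefficients in the independent variables $q_1,q_2,q_3,K,x$ (with $q_4=(q_1q_2q_3)^{-1}$); $\vee$ inverts all monomials, $[\,\cdot\,]^{(0)}$ is the constant term, and $\mathbb I[\sum_i n_ix_i]=\prod_i(1-x_i^{-1})^{n_i}$ over the distinct monomials $x_i$. A box $b\in\mathbb Z_{\ge1}^4$ has $\chi_y(b)=y\,q_1^{b_1-1}q_2^{b_2-1}q_3^{b_3-1}q_4^{b_4-1}$; boxes of plane partitions and Young diagrams have coordinate $1$ in the missing directions. Bold letters denote characters of sets of boxes: $\sum_{b}\chi_x(b)$ for $\boldsymbol\pi,\boldsymbol\rho,\boldsymbol\lambda$. *Operators.* Let $[\mathsf a_n,\mathsf a_m]=-\frac1n\prod_{a=1}^4(1-q_a^n)\,\delta_{n+m,0}$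 for $n,m\ne0$, acting on the Fock space $\mathbb C[p_1,p_2,\dots]$. For $S\subseteq\{1,2,3,4\}$ let $\mathsf V_S(y)={:}\exp\big(\sum_{n\ne0}\mathsf s^S_n y^{-n}\big){:}$ with $\mathsf a_n=\prod_{a\in S}(1-q_a^{-n})\,\mathsf s^S_n$. Write $\mathsf A,\mathsf S_a,\mathsf X_{ab},\mathsf W_{abc},\mathsf Z$ for $|S|=0,1,2,3,4$. All identities between operators are modulo zero modes. *Solid partitions.* Let $A\subset\{1,2,3,4\}$, and let $\pi$ be a finite partition in the directions complementary to $A$. Its boundary $\mathcal B$ consists of the copies of $\pi$ extended infinitely along the directions of $A$. Let $\rho$ be a finite set of boxes, disjoint from $\mathcal B$, such that $\mathcal B\sqcup\rho$ is a solid partition (closed under decreasing coordinates). For $k\ge1$ put $x_k=xq_4^{k-1}$, let $\Pi^{(k)}$ be the set of boxes of $\rho$ with $b_4=k$, projected to the directions $1,2,3$, and put $\boldsymbol\Pi^{(k)}=\sum_{b\in\Pi^{(k)}}\chi_{x_k}(b)$. *D8 $qq$-character (boundary $\pi$ along $A$).* The coefficient and the operator are $$\mathcal Z^{D8}_A[K;\rho]=\mathbb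 I\Big[-((1-K)x)^\vee\boldsymbol\rho+P_{1234}\Big(\frac{\boldsymbol\pi}{P_A}\Big)^{\vee}\boldsymbol\rho+P_{123}^\vee\boldsymbol\rho^\vee\boldsymbol\rho\Big],$$ $$\Lambda^{K}_{A,\rho}(x)={:}\frac{\mathsf Z(x)}{\mathsf Z(Kx)}\prod_{b\in\pi}\mathsf V_A(\chi_x(b))^{-1}\prod_{b\in\rho}\mathsf A(\chi_x(b))^{-1}{:}.$$ *D6 $qq$-character (directions $1,2,3$; parameter $u$; a leg $\nu$ along direction $3$; a finite set $s$ of boxes outside of it).* With $\mathbf s=\sum_{b\in s}\chi_x(b)$ and $\boldsymbol\nu=\sum_{b\in\nu}\chi_x(b)$, $$\mathcal Z^{D6}_{\nu}[u;s]=\mathbb I\Big[-P_4^\vee(1-u^{-1})x^{-1}\mathbf s+P_{1234}\Big(\frac{\boldsymbol\nu}{P_3}\Big)^\vee\mathbf s+P_{123}^\vee\mathbf s^\vee\mathbf s\Big],$$ $$\Lambda^{u}_{\nu,s}(y)={:}\frac{\mathsf W_{123}(y)}{\mathsf W_{123}(uy)}\prod_{b\in\nu}\mathsf S_3(\chi_y(b))^{-1}\prod_{b\in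 s}\mathsf A(\chi_y(b))^{-1}{:}.$$ *Meaning of $\simeq$.* For layers $k=1,2,\dots$ with data $(u_k,y_k,\nu_k,s_k)$, and vacuum data $(u_k,y_k,\nu_k,s_k^{\circ})$ (the same boundary, no boxes of $\rho$), write $\mathcal Z_k,\Lambda_k$ and $\mathcal Z_k^{\circ},\Lambda_k^{\circ}$ for the D6 coefficients and operators. Then $$\cdots\mathcal Z_2\Lambda_2\,\mathcal Z_1\Lambda_1\simeq z\,\Lambda$$ means that all $\mathcal Z_k^\circ\ne0$ and there are scalars $R_N$ such that: 1. for every $N\ge1$, all matrix elements of the ordered product $\Lambda_N\cdots\Lambda_2\Lambda_1$ (with $\Lambda_N$ leftmost), divided by the vacuum expectation value of $\Lambda^\circ_N\cdots\Lambda^\circ_1$ and continued as rational functions from the radially ordered region (consecutive spectral parameters separated by a factor $t$, then $t\to1$), are those of $R_N\,{:}\Lambda_N\cdots\Lambda_1{:}$; 2. $\prod_{k=1}^N(\mathcal Z_k/\mathcal Z_k^\circ)\cdot R_N$ is, for all large $N$, the value at $q_4^N$ of a rational function that is regular at $0$ with value $z$ there; if $|q_4|<1$, it also converges to $z$ as $N\to\infty$;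 3. for every $n\ne0$, the coefficient of $\mathsf a_n$ in the exponent of $\Lambda$ is the sum over $k$ of those of $\Lambda_k$, in the sense that the rational function with expansion $\sum_k(\cdot)_kt^{k-1}$ is regular at $t=1$ and takes that value there. **Theorem.** The infinite ordered products of D6 $qq$-character monomials reproduce the D8 $qq$-character monomials and coefficients with one leg or one surface, up to the vacuum (one-loop and boundary) factors and a sign: $$\cdots\mathcal Z_2\Lambda_2\,\mathcal Z_1\Lambda_1\simeq(-1)^{\tilde\sigma_4(\rho)}\,\mathcal Z^{D8}_A[K;\rho]\,\Lambda^K_{A,\rho}(x)$$ in each of the following cases. (i) **One leg along 3** ($A=\{3\}$, $\pi$ a plane partition in directions $1,2,4$ with layers $\nu^{(k)}$, which are Young diagrams in directions $1,2$): $u_k=K$, $y_k=x_k$, $\nu_k=\nu^{(k)}$, $s_k=\Pi^{(k)}$, $s_k^\circ=\emptyset$. With $\boldsymbol\nu^{(j)}=\sum_{b\in\nu^{(j)}}\chi_{x_j}(b)$, $$\tilde\sigma_4(\rho)=\Big[\sum_{j>i}\Big(P_{1234}\frac{\boldsymbol\nu^{(j)}}{P_3}\boldsymbol\Pi^{(i)\vee}+P_{123}\boldsymbol\Pi^{(i)\vee}\boldsymbol\Pi^{(j)}\Big)\Big]^{(0)}.$$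 (ii) **One leg along 4** ($A=\{4\}$, $\pi$ a plane partition in directions $1,2,3$): $u_k=K$, $y_k=x_k$, $\nu_k=\emptyset$, $s_k=\pi\cup\Pi^{(k)}$, $s_k^\circ=\pi$, and $$\tilde\sigma_4(\rho)=\Big[\sum_{j>i}\Big(P_{1234}\,q_4^{j-1}\boldsymbol\pi\,\boldsymbol\Pi^{(i)\vee}+P_{123}\boldsymbol\Pi^{(i)\vee}\boldsymbol\Pi^{(j)}\Big)\Big]^{(0)}.$$ (iii) **One surface 34** ($A=\{3,4\}$, $\pi=\lambda$ a Young diagram in directions $1,2$): $u_k=K$, $y_k=x_k$, $\nu_k=\lambda$, $s_k=\Pi^{(k)}$, $s_k^\circ=\emptyset$, and $$\tilde\sigma_4(\rho)=\Big[\sum_{j>i}\Big(P_{1234}\frac{\boldsymbol\lambda\,q_4^{j-1}}{P_3}\boldsymbol\Pi^{(i)\vee}+P_{123}\boldsymbol\Pi^{(i)\vee}\boldsymbol\Pi^{(j)}\Big)\Big]^{(0)}.$$ (iv) **One surface 12** ($A=\{1,2\}$, $\pi=\lambda$ a Young diagram in directions $3,4$, with $k^{(j)}$ boxes in the row $b_4=j$):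 $u_k=Kq_3^{-k^{(k)}}$, $y_k=x_kq_3^{k^{(k)}}$, $\nu_k=\emptyset$, $s_k$ is $\Pi^{(k)}$ translated by $-k^{(k)}$ in direction $3$, $s_k^\circ=\emptyset$, and $$\tilde\sigma_4(\rho)=\Big[\sum_{j>i}\Big(-P_4\,x_jq_3^{k^{(j)}}\boldsymbol\Pi^{(i)\vee}+P_{123}\boldsymbol\Pi^{(i)\vee}\boldsymbol\Pi^{(j)}\Big)\Big]^{(0)}.$$ In all four cases only finitely many pairs $j>i$ contribute to the constant term. -/

import Mathlib

open Filter Topology Finset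

noncomputable section

namespace DTqq

/-! ## Boxes and partitions

The directions `1, 2, 3, 4` are the elements `0, 1, 2, 3` of `Fin 4`, and a box is recorded by its
coordinates minus one, so the corner box is `0`. Boxes of a plane partition or of a Young diagram
are boxes whose coordinates vanish in the missing directions. -/

/-- A box of the four-dimensional orthant. -/
abbrev Box := Fin 4 → ℕ

/-- Set the coordinates in the directions of `A` to zero. -/
def flat (A : Finset (Fin 4)) (b : Box) : Box := fun i => if i ∈ A then 0 else b i

/-- `π` is a finite partition in the directions complementary to `A` (a plane partition if `A` is
one direction, a Young diagram if `A` consists of two directions), and `ρ` is the finite set of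
boxes such that the boundary `{b | flat A b ∈ π}` (the copies of `π` extended infinitely along the
directions of `A`) together with the disjoint set `ρ` is a solid partition of infinite size. -/
structure IsSolidWithBoundary (A : Finset (Fin 4)) (π ρ : Finset Box) : Prop where
  boundary_lower : IsLowerSet (π : Set Box)
  boundary_flat : ∀ b ∈ π, ∀ a ∈ A, b a = 0
  disjoint : ∀ b ∈ ρ, flat A b ∉ π
  lower : IsLowerSet {b : Box | b ∈ ρ ∨ flat A b ∈ π}

/-- The `k`-th layer (`k = 0, 1, 2, …`) of a set of boxes in the decomposition along direction `4`,
as a set of boxes in the directions `1, 2, 3`. -/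
def layer (k : ℕ) (s : Finset Box) : Finset Box := (s.filter fun b => b 3 = k).image (flat {3})

/-- The `k`-th part of a Young diagram in the directions `3, 4`: its number of boxes with fourth
coordinate `k`. -/
def height (k : ℕ) (s : Finset Box) : ℕ := (s.filter fun b => b 3 = k).card

/-- Move the origin by `h` in direction `3`. -/
def lower3 (h : ℕ) (s : Finset Box) : Finset Box :=
  s.image fun b i => if i = 2 then b i - h else b i

/-! ## Characters and the index -/

/-- Exponents of the Laurent monomials in the independent variables `q₁, q₂, q₃, K, x`. -/
abbrev Weight := Fin 5 → ℤ

/-- Characters: Laurent polynomials with integer coefficients in `q₁, q₂, q₃, K, x`. -/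
abbrev Chr := AddMonoidAlgebra ℤ Weight

/-- The weights of `q₁, q₂, q₃` and of `q₄ = (q₁ q₂ q₃)⁻¹`. -/
def wq : Fin 4 → Weight :=
  ![![1, 0, 0, 0, 0], ![0, 1, 0, 0, 0], ![0, 0, 1, 0, 0], ![-1, -1, -1, 0, 0]]

/-- The weight of `K`. -/
def wK : Weight := ![0, 0, 0, 1, 0]

/-- The weight of `x`. -/
def wx : Weight := ![0, 0, 0, 0, 1]

/-- The weight of `χ_y(b) = y q₁^{b₁} q₂^{b₂} q₃^{b₃} q₄^{b₄}`, for a monomial `y`. -/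
def wbox (y : Weight) (b : Box) : Weight := y + ∑ a, b a • wq a

/-- A Laurent monomial. -/
def mono (w : Weight) : Chr := AddMonoidAlgebra.single w 1

/-- The character `∑_{b ∈ s} χ_y(b)`. -/
def chr (y : Weight) (s : Finset Box) : Chr := ∑ b ∈ s, mono (wbox y b)

/-- The dual character: all monomials are inverted. -/
def dual (X : Chr) : Chr := AddMonoidAlgebra.mapDomain (fun w => -w) X

/-- `P_S = ∏_{a ∈ S} (1 - q_a)`. -/
def P (S : Finset (Fin 4)) : Chr := ∏ a ∈ S, (1 - mono (wq a))

/-- The constant term (unmovable part) of a character. -/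
def constTerm (X : Chr) : ℤ := X.coeff 0

/-- The value of a Laurent monomial. -/
def ev (q : Fin 4 → ℂ) (K x : ℂ) (w : Weight) : ℂ :=
  q 0 ^ w 0 * q 1 ^ w 1 * q 2 ^ w 2 * K ^ w 3 * x ^ w 4

/-- The index: `𝕀[∑ nᵢ xᵢ] = ∏ (1 - xᵢ⁻¹) ^ nᵢ`, the product being over the distinct monomials of the
character, with their total multiplicities. -/
def index (q : Fin 4 → ℂ) (K x : ℂ) (X : Chr) : ℂ :=
  ∏ w ∈ X.coeff.support, (1 - (ev q K x w)⁻¹) ^ (X.coeff w)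

/-- The coefficient of the D6 `qq`-character in the directions `1, 2, 3` with D6 distance parameter
the monomial `u`, with one leg along direction `3` of asymptotic Young diagram `ν` (a set of boxes
in the directions `1, 2`), at the finite set `s` of boxes outside of the leg:
`𝕀[-P₄^∨ (1 - u⁻¹) x⁻¹ 𝐬 + P₁₂₃₄ (𝛎 / P₃)^∨ 𝐬 + P₁₂₃^∨ 𝐬^∨ 𝐬]`, where `P₁₂₃₄ / P₃^∨ = P₁₂₄^∨` since
`q₁ q₂ q₃ q₄ = 1`. -/
def d6Coeff (q : Fin 4 → ℂ) (K x : ℂ) (u : Weight) (ν s : Finset Box) : ℂ :=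
  index q K x
    (-(dual (P {3}) * (1 - mono (-u)) * mono (-wx) * chr wx s)
      + dual (P {0, 1, 3}) * dual (chr wx ν) * chr wx s
      + dual (P {0, 1, 2}) * dual (chr wx s) * chr wx s)

/-- The D8 coefficient with special direction `4`, with boundary `π` extended along the directions
of `A`, at the finite set `ρ` of boxes outside of the boundary:
`𝕀[-((1 - K) x)^∨ 𝛒 + P₁₂₃₄ (𝛑 / P_A)^∨ 𝛒 + P₁₂₃^∨ 𝛒^∨ 𝛒]`, where `P₁₂₃₄ / P_A^∨` is the dual of the
product of the `1 - q_a` with `a ∉ A`. -/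
def d8Coeff (q : Fin 4 → ℂ) (K x : ℂ) (A : Finset (Fin 4)) (π ρ : Finset Box) : ℂ :=
  index q K x
    (-(dual ((1 - mono wK) * mono wx) * chr wx ρ)
      + dual (P Aᶜ) * dual (chr wx π) * chr wx ρ
      + dual (P {0, 1, 2}) * dual (chr wx ρ) * chr wx ρ)

/-! ## Vertex operators on the Fock space

The oscillators satisfy `[a_n, a_m] = -(1/n) P₁₂₃₄^{[n]} δ_{n+m,0}`. The Fock space is the polynomial
ring in `p₁, p₂, …`, the variable `p_n` having index `n - 1`: for `n > 0`, `a_{-n}` is the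
multiplication by `p_n` and `a_n = -(1/n) P₁₂₃₄^{[n]} ∂/∂p_n`. The vacuum is `1`. -/

/-- The modes `c_n` (`n ≠ 0`) of the normal-ordered operator `:exp(∑_{n ≠ 0} c_n a_n):`. The
normal-ordered product of two such operators has the sum of their modes, and the normal-ordered
quotient their difference. The value at `n = 0` is never used. -/
abbrev Modes := ℤ → ℂ

/-- `P_S^{[n]} = ∏_{a ∈ S} (1 - q_a^n)`. -/
def adams (q : Fin 4 → ℂ) (S : Finset (Fin 4)) (n : ℤ) : ℂ := ∏ a ∈ S, (1 - q a ^ n)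

/-- The commutator `[a_{n+1}, a_{-(n+1)}]`. -/
def commutator (q : Fin 4 → ℂ) (n : ℕ) : ℂ := -(1 / ((n : ℂ) + 1)) * adams q univ ((n : ℤ) + 1)

/-- The modes of the brane vertex operator of type `S` with spectral parameter the monomial `y`;
the oscillators `s_n` of type `S` are given by `a_n = P_S^{[-n]} s_n`, so that `∑ s_n y^{-n}` has the
modes below. For `S` of size `0, 1, 2, 3, 4` these are the operators
`A(y)`, `S_a(y)`, `X_{ab}(y)`, `W_{abc}(y)`, `Z(y)`. -/
def brane (q : Fin 4 → ℂ) (K x : ℂ) (S : Finset (Fin 4)) (y : Weight) : Modes :=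
  fun n => ev q K x y ^ (-n) / adams q S (-n)

/-- The D6 operator `Λ^{u,∅∅ν}_{123,s}(y)`, that is
`:W₁₂₃(y) / W₁₂₃(u y) ∏_{b ∈ ν} S₃(χ_y(b))⁻¹ ∏_{b ∈ s} A(χ_y(b))⁻¹:`. -/
def d6Op (q : Fin 4 → ℂ) (K x : ℂ) (u y : Weight) (ν s : Finset Box) : Modes :=
  brane q K x {0, 1, 2} y - brane q K x {0, 1, 2} (u + y)
    - ∑ b ∈ ν, brane q K x {2} (wbox y b) - ∑ b ∈ s, brane q K x ∅ (wbox y b)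

/-- The D8 operator with boundary `π` extended along the directions of `A`:
`:Z(x) / Z(K x) ∏_{b ∈ π} V_A(χ_x(b))⁻¹ ∏_{b ∈ ρ} A(χ_x(b))⁻¹:`, where `V_A` is `S_a` for `A = {a}` and
`X_A` for `A` of size two. -/
def d8Op (q : Fin 4 → ℂ) (K x : ℂ) (A : Finset (Fin 4)) (π ρ : Finset Box) : Modes :=
  brane q K x univ wx - brane q K x univ (wK + wx)
    - ∑ b ∈ π, brane q K x A (wbox wx b) - ∑ b ∈ ρ, brane q K x ∅ (wbox wx b)

/-- Exponents of the monomials in the variables `p₁, p₂, …`, which form a basis of the Fock space. -/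
abbrev Occ := ℕ →₀ ℕ

/-- The energy of a basis vector: the degree for which `p_n` has degree `n`. -/
def energy (m : Occ) : ℕ := m.sum fun n k => (n + 1) * k

/-- The creation part `exp(∑_{n > 0} c_{-n} p_n)` applied to the vacuum. -/
def creation (c : Modes) : MvPowerSeries ℕ ℂ :=
  fun m => m.prod fun n k => c (-((n : ℤ) + 1)) ^ k / (k.factorial : ℂ)

/-- The annihilation part `exp(∑_{n > 0} c_n a_n)`: as `a_n` is a multiple of `∂/∂p_n`, it is the
translation of every `p_n` by `c_n [a_n, a_{-n}]`. -/
def annihilation (q : Fin 4 → ℂ) (c : Modes) : MvPolynomial ℕ ℂ →ₐ[ℂ] MvPolynomial ℕ ℂ :=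
  MvPolynomial.aeval fun n =>
    MvPolynomial.X n + MvPolynomial.C (c ((n : ℤ) + 1) * commutator q n)

/-- The matrix element of `:exp(∑_{n ≠ 0} c_n a_n):`, at row `m` and column `m'`. -/
def matrixElement (q : Fin 4 → ℂ) (c : Modes) (m m' : Occ) : ℂ :=
  MvPowerSeries.coeff m
    (creation c * (annihilation q c (MvPolynomial.monomial m' 1) : MvPowerSeries ℕ ℂ))

/-- Matrices on the Fock space with entries formal power series in a parameter `t`. -/
abbrev FockMatrix := Occ → Occ → PowerSeries ℂ

/-- The composition `V t^D V'`, where `D` is the energy operator: in degree `d`, an intermediate state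
of energy `e` contributes `t^e`. As `t^D V'(x') t^{-D} = V'(t x')`, the parameter `t` scales the
spectral parameters to the radially ordered region. -/
def radialMul (V V' : FockMatrix) : FockMatrix := fun m m'' =>
  PowerSeries.mk fun d => ∑ e ∈ range (d + 1),
    ∑ᶠ m' ∈ {m' : Occ | energy m' = e}, PowerSeries.coeff (d - e) (V m m' * V' m' m'')

/-- The ordered product `V_N t^D V_{N-1} t^D ⋯ t^D V_0` of normal-ordered operators with modes
`c 0, …, c N`, the operator of highest index standing on the left. -/
def orderedProd (q : Fin 4 → ℂ) (c : ℕ → Modes) : ℕ → FockMatrix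
  | 0 => fun m m' => PowerSeries.C (matrixElement q (c 0) m m')
  | N + 1 => radialMul (fun m m' => PowerSeries.C (matrixElement q (c (N + 1)) m m'))
      (orderedProd q c N)

/-! ## Analytic continuation and regularization -/

/-- The ratio `f / g` of two power series in `t` is the expansion of a rational function which is
regular at `t = 1`, with value `v` there. -/
def HasContinuedRatio (f g : PowerSeries ℂ) (v : ℂ) : Prop :=
  ∃ p s : Polynomial ℂ, s.eval 1 ≠ 0 ∧ (s : PowerSeries ℂ) * f = (p : PowerSeries ℂ) * g ∧
    p.eval 1 = v * s.eval 1

/-- The series `∑ u_k` has the regularized sum `v`: the rational function with expansion `∑ u_k t^k`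
is regular at `t = 1`, with value `v` there. For instance `∑ r^k = 1 / (1 - r)` for all `r ≠ 1`. -/
def HasRegularizedSum (u : ℕ → ℂ) (v : ℂ) : Prop := HasContinuedRatio (PowerSeries.mk u) 1 v

/-- The sequence `u_N` is, for large `N`, the value at `Q ^ N` of a rational function which is regular
at `0`, with value `z` there. -/
def HasRegularizedLimit (Q : ℂ) (u : ℕ → ℂ) (z : ℂ) : Prop :=
  ∃ p s : Polynomial ℂ, s.eval 0 ≠ 0 ∧ p.eval 0 = z * s.eval 0 ∧
    ∀ᶠ N in atTop, s.eval (Q ^ N) ≠ 0 ∧ u N * s.eval (Q ^ N) = p.eval (Q ^ N)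

/-- `∏_k (coef k) ⋯ Λ(2) Λ(1) Λ(0) ≃ z Λ∞` up to one-loop and boundary factors: `coefVac` and `Λvac`
are the coefficients and operators of the layers with the same boundary and without any further
boxes, and all scalars are taken relatively to them.

For every `N` the ordered product of the layers `0, …, N`, divided by the vacuum expectation value of
the ordered product of the vacuum layers, is continued to `t = 1` and equals a scalar `R N` times the
normal-ordered product of the layers. With the coefficients, these scalars tend to `z`: in the
regularized sense, and as a convergent sequence if `|q₄| < 1`. The modes of the infinite
normal-ordered product, regularized, are those of `Λ∞`. -/
def Reproduces (q : Fin 4 → ℂ) (coef coefVac : ℕ → ℂ) (Λ Λvac : ℕ → Modes) (z : ℂ) (Λlim : Modes) :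
    Prop :=
  (∀ k, coefVac k ≠ 0) ∧
  ∃ R : ℕ → ℂ,
    (∀ N m m', HasContinuedRatio (orderedProd q Λ N m m') (orderedProd q Λvac N 0 0)
      (R N * matrixElement q (∑ k ∈ range (N + 1), Λ k) m m')) ∧
    HasRegularizedLimit (q 3) (fun N => (∏ k ∈ range (N + 1), coef k / coefVac k) * R N) z ∧
    (‖q 3‖ < 1 →
      Tendsto (fun N => (∏ k ∈ range (N + 1), coef k / coefVac k) * R N) atTop (𝓝 z)) ∧
    ∀ n : ℤ, n ≠ 0 → HasRegularizedSum (fun k => Λ k n) (Λlim n)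

/-! ## The sign factors -/

/-- The weight of `x_k = x q₄^k`. -/
def wlayer (k : ℕ) : Weight := wx + k • wq 3

/-- The character `𝚷^{(k)}` of the `k`-th layer. -/
def layerChr (k : ℕ) (s : Finset Box) : Chr := chr (wlayer k) (layer k s)

/-- The constant term of `∑_{j > i} f i j`. -/
def constTermSum (f : ℕ → ℕ → Chr) : ℤ :=
  ∑ᶠ ij ∈ {ij : ℕ × ℕ | ij.1 < ij.2}, constTerm (f ij.1 ij.2)

/-- One leg along `3`: `[∑_{j > i} (P₁₂₃₄ 𝛎^{(j)} / P₃ 𝚷^{(i)∨} + P₁₂₃ 𝚷^{(i)∨} 𝚷^{(j)})]^{(0)}`. -/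
def signLeg3 (π ρ : Finset Box) : ℤ :=
  constTermSum fun i j => P {0, 1, 3} * layerChr j π * dual (layerChr i ρ)
    + P {0, 1, 2} * dual (layerChr i ρ) * layerChr j ρ

/-- One leg along `4`: `[∑_{j > i} (P₁₂₃₄ q₄^{j-1} 𝛑 𝚷^{(i)∨} + P₁₂₃ 𝚷^{(i)∨} 𝚷^{(j)})]^{(0)}`. -/
def signLeg4 (π ρ : Finset Box) : ℤ :=
  constTermSum fun i j => P univ * chr (wlayer j) π * dual (layerChr i ρ)
    + P {0, 1, 2} * dual (layerChr i ρ) * layerChr j ρ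

/-- Surface `34`: `[∑_{j > i} (P₁₂₃₄ 𝛌 q₄^{j-1} / P₃ 𝚷^{(i)∨} + P₁₂₃ 𝚷^{(i)∨} 𝚷^{(j)})]^{(0)}`. -/
def signFace34 (π ρ : Finset Box) : ℤ :=
  constTermSum fun i j => P {0, 1, 3} * chr (wlayer j) π * dual (layerChr i ρ)
    + P {0, 1, 2} * dual (layerChr i ρ) * layerChr j ρ

/-- Surface `12`: `[∑_{j > i} (-P₄ x_j q₃^{k^{(j)}} 𝚷^{(i)∨} + P₁₂₃ 𝚷^{(i)∨} 𝚷^{(j)})]^{(0)}`, where `k^{(j)}` is the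
`j`-th part of the asymptotic Young diagram. -/
def signFace12 (π ρ : Finset Box) : ℤ :=
  constTermSum fun i j => -(P {3} * mono (wlayer j + height j π • wq 2) * dual (layerChr i ρ))
    + P {0, 1, 2} * dual (layerChr i ρ) * layerChr j ρ

end DTqq

end

noncomputable section

namespace DTqq

/-! Let `N k` be the numerator, over the common denominator `P₁₂₃`, of the modes of the `k`-th
vacuum layer, and `B k` the character of the boxes of `ρ` in that layer. A vertex operator is
determined up to a scalar by its relations with the oscillators. Hence an ordered product is its
vacuum expectation value times, at `t = 1`, the normal-ordered product (`exists_orderedProd_eq`),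
and the vacuum expectation value is the exponential of the pairwise contractions. Relative to the
vacuum layers, the contraction of two layers has no denominator left: it is the Laurent polynomial
`pairChr` (`contraction_eq`). Its exponential is a finite product of powers of `1 - z t ^ e`, whose
value at `t = 1` is the index of `pairChr` (`hasContinuedRatio_orderedProd`).

The scalar to be computed is therefore the index of one sum: the relative characters of the single
layers plus the `pairChr` of all pairs `i < j`. The identities `P₁₂₃^∨ = -q₄ P₁₂₃` and `P₁₂₃₄ = P₁₂₃
+ P₁₂₃^∨` and the telescoping of `P₄ ∑ N j` turn this sum into the D8 character, plus differences of
a character `Y` and its dual, plus a remainder proportional to `q₄ ^ (-(n + 1))` (`sum_layers_eq`).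
Each monomial `w` of `Y` contributes `(1 - w) / (1 - w⁻¹) = -w` to the index of `Y^∨ - Y`, so this
index is `±1`, governed by the constant term of `Y`, when the determinant is trivial
(`index_dualHom_sub_self`). The index of the remainder is a product of powers of factors `1 - q₄ ^ n
a`, with regularized limit `1`. `reproduces_of_layers` assembles these facts.

The geometry of solid partitions enters only through constant terms. In degree zero in `K`, `N k` is
`P₁₂₃` times the formal character of the points of the `k`-th layer outside the boundary, and `N k -
P₁₂₃ B k` plays the same role for the points outside the whole partition. Coefficients are thus
mixed differences of indicator functions, which vanish where these functions are locally constant.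
Everything above a box of `ρ` lies outside the boundary, and everything in the orthant below it lies
in the partition. So the constant terms that would give zeros or poles vanish, and so do those of
the boundary terms in the signs; only `P₁₂₃ 𝚷^{(i)∨} 𝚷^{(j)}` contributes to the sign. The four
cases differ only in the choice of `N k`. -/

/-! ## Matrix elements of vertex operators -/

/-- The occupation number vector with one quantum in the mode `n`. -/
abbrev quantum (n : ℕ) : Occ := Finsupp.single n 1

theorem occ_induction {p : Occ → Prop} (zero : p 0) (add : ∀ m n, p m → p (m + quantum n))
    (m : Occ) : p m := by
  induction m using Finsupp.induction with
  | zero => exact zero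
  | single_add a b f _ _ ih =>
    clear * - ih add
    induction b with
    | zero => simpa using ih
    | succ k hk =>
      have := add _ a hk
      rwa [add_right_comm, ← Finsupp.single_add] at this

theorem energy_add (m m' : Occ) : energy (m + m') = energy m + energy m' :=
  Finsupp.sum_add_index' (fun _ => rfl) fun _ _ _ => mul_add _ _ _

@[simp] theorem energy_zero : energy 0 = 0 := rfl

@[simp] theorem energy_quantum (n : ℕ) : energy (quantum n) = n + 1 := by
  simp [energy]

theorem finite_energy_le (d : ℕ) : {m : Occ | energy m ≤ d}.Finite := by
  refine (Finset.finite_toSet (Finset.finsupp (range d) fun _ => range (d + 1))).subset ?_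
  intro m hm
  have key : ∀ n ∈ m.support, (n + 1) * m n ≤ d := fun n hn =>
    (Finset.single_le_sum (f := fun n => (n + 1) * m n) (fun _ _ => Nat.zero_le _) hn).trans hm
  have hpos : ∀ n ∈ m.support, 1 ≤ m n := fun n hn =>
    Nat.one_le_iff_ne_zero.2 (Finsupp.mem_support_iff.1 hn)
  rw [Finset.mem_coe, Finset.mem_finsupp_iff]
  refine ⟨fun n hn => ?_, fun n hn => ?_⟩
  · have h1 := key n hn
    have h2 := hpos n hn
    rw [mem_range]
    nlinarith
  · by_cases h : n ∈ m.support
    · have h1 := key n h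
      rw [mem_range]
      nlinarith
    · simp [Finsupp.notMem_support_iff.1 h]

/-- The occupation number vectors of energy at most `d`. -/
def occLE (d : ℕ) : Finset Occ := (finite_energy_le d).toFinset

@[simp] theorem mem_occLE {d : ℕ} {m : Occ} : m ∈ occLE d ↔ energy m ≤ d := by simp [occLE]

/-! ### Exponential series and sums over Fock states weighted by energy. -/

/-- The exponential `exp (∑ a_n p_n)`. -/
def expSeries {R : Type*} [CommRing R] [Algebra ℂ R] (a : ℕ → R) : MvPowerSeries ℕ R :=
  fun m => m.prod fun n k => a n ^ k * algebraMap ℂ R (1 / (k.factorial : ℂ))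

section ExpSeries

variable {R : Type*} [CommRing R] [Algebra ℂ R]

theorem coeff_expSeries (a : ℕ → R) (m : Occ) : MvPowerSeries.coeff m (expSeries a) =
    m.prod fun n k => a n ^ k * algebraMap ℂ R (1 / (k.factorial : ℂ)) := rfl

theorem coeff_expSeries_zero (a : ℕ → R) : MvPowerSeries.coeff 0 (expSeries a) = 1 := by
  simp [coeff_expSeries]

/-- This recursion, with the constant term `1`, determines the exponential; later comparisons of
coefficients use it in place of the product formula. -/
theorem coeff_expSeries_add_quantum (a : ℕ → R) (m : Occ) (n : ℕ) :
    ((m n : R) + 1) * MvPowerSeries.coeff (m + quantum n) (expSeries a) =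
      a n * MvPowerSeries.coeff m (expSeries a) := by
  have h0 : ∀ i, a i ^ 0 * algebraMap ℂ R (1 / ((0 : ℕ).factorial : ℂ)) = 1 := by simp
  have hf : ((m n : R) + 1) * algebraMap ℂ R (1 / ((m n + 1).factorial : ℂ)) =
      algebraMap ℂ R (1 / ((m n).factorial : ℂ)) := by
    have : ((m n : R) + 1) = algebraMap ℂ R ((m n : ℂ) + 1) := by simp
    rw [this, ← map_mul, Nat.factorial_succ]
    congr 1
    have h1 : ((m n).factorial : ℂ) ≠ 0 := by exact_mod_cast (m n).factorial_ne_zero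
    have h2 : (m n : ℂ) + 1 ≠ 0 := by exact_mod_cast (m n).succ_ne_zero
    push_cast
    field_simp
  rw [coeff_expSeries, coeff_expSeries,
    Finsupp.prod_of_support_subset (s := insert n m.support) _ (by
      refine Finsupp.support_add.trans ?_
      intro i hi
      rcases Finset.mem_union.1 hi with h | h
      · exact Finset.mem_insert_of_mem h
      · have := Finsupp.support_single_subset h
        simp_all) _ (fun i _ => h0 i),
    Finsupp.prod_of_support_subset (s := insert n m.support) _ (Finset.subset_insert _ _) _
      (fun i _ => h0 i),
    ← Finset.mul_prod_erase _ _ (Finset.mem_insert_self n _),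
    ← Finset.mul_prod_erase (insert n m.support) (fun x => a x ^ m x * _)
      (Finset.mem_insert_self n _)]
  have hrest : ∏ x ∈ (insert n m.support).erase n, (a x ^ (m + quantum n) x *
        algebraMap ℂ R (1 / (((m + quantum n) x).factorial : ℂ))) =
      ∏ x ∈ (insert n m.support).erase n, a x ^ m x * algebraMap ℂ R (1 / ((m x).factorial : ℂ)) := by
    refine Finset.prod_congr rfl fun x hx => ?_
    have : (m + quantum n) x = m x := by simp [(Finset.ne_of_mem_erase hx).symm]
    rw [this]
  have hn : (m + quantum n) n = m n + 1 := by simp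
  rw [hrest, hn, ← hf, pow_succ]
  ring

theorem pderiv_expSeries (a : ℕ → R) (n : ℕ) :
    MvPowerSeries.pderiv R n (expSeries a) = MvPowerSeries.C (a n) * expSeries a := by
  ext m
  rw [MvPowerSeries.coeff_pderiv, MvPowerSeries.coeff_C_mul, ← coeff_expSeries_add_quantum]
  ring

/-- Both sides have constant term `1` and solve `∂ₙ F = (aₙ + bₙ) F` for all `n`, which has a unique
solution in characteristic zero. -/
theorem expSeries_add [IsDomain R] (a b : ℕ → R) :
    expSeries (a + b) = expSeries a * expSeries b := by
  have : CharZero R := charZero_of_injective_algebraMap (algebraMap ℂ R).injective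
  ext m
  induction m using occ_induction with
  | zero => simp [MvPowerSeries.coeff_mul, coeff_expSeries_zero]
  | add m n ih =>
    have hne : (m n : R) + 1 ≠ 0 := by exact_mod_cast (m n).succ_ne_zero
    have h1 : MvPowerSeries.pderiv R n (expSeries a * expSeries b) =
        MvPowerSeries.C (a n + b n) * (expSeries a * expSeries b) := by
      rw [Derivation.leibniz, pderiv_expSeries, pderiv_expSeries, map_add, smul_eq_mul, smul_eq_mul]
      ring
    have h2 := congrArg (MvPowerSeries.coeff m) h1
    rw [MvPowerSeries.coeff_pderiv, MvPowerSeries.coeff_C_mul, ← ih] at h2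
    apply mul_left_cancel₀ hne
    rw [coeff_expSeries_add_quantum, mul_comm ((m n : R) + 1), h2]
    rfl

end ExpSeries

open PowerSeries in
/-- The sum `∑ t ^ energy m * F m` over all occupation number vectors. -/
def energySum (F : Occ → PowerSeries ℂ) : PowerSeries ℂ :=
  PowerSeries.mk fun d => ∑ m ∈ occLE d, coeff d (X ^ energy m * F m)

theorem coeff_X_pow_energy_mul {d : ℕ} {m : Occ} (F : PowerSeries ℂ) (h : d < energy m) :
    PowerSeries.coeff d (PowerSeries.X ^ energy m * F) = 0 := by
  rw [PowerSeries.coeff_X_pow_mul', if_neg (not_le.2 h)]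

/-- States of energy above `d` do not reach degree `d`, so the cutoff may be raised at will.
Identities between infinite sums become identities between finite sums with a common cutoff. -/
theorem coeff_energySum (F : Occ → PowerSeries ℂ) {d e : ℕ} (h : d ≤ e) :
    PowerSeries.coeff d (energySum F) =
      PowerSeries.coeff d (∑ m ∈ occLE e, PowerSeries.X ^ energy m * F m) := by
  rw [energySum, PowerSeries.coeff_mk, map_sum]
  refine Finset.sum_subset (fun m hm => ?_) fun m _ hm => ?_
  · rw [mem_occLE] at *
    omega
  · exact coeff_X_pow_energy_mul _ (by simpa using hm)

theorem coeff_mul_eq_of_le {f f' g g' : PowerSeries ℂ} {d : ℕ}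
    (hf : ∀ i ≤ d, PowerSeries.coeff i f = PowerSeries.coeff i f')
    (hg : ∀ i ≤ d, PowerSeries.coeff i g = PowerSeries.coeff i g') :
    PowerSeries.coeff d (f * g) = PowerSeries.coeff d (f' * g') := by
  rw [PowerSeries.coeff_mul, PowerSeries.coeff_mul]
  refine Finset.sum_congr rfl fun ij hij => ?_
  have := Finset.HasAntidiagonal.mem_antidiagonal.1 hij
  rw [hf _ (by omega), hg _ (by omega)]

theorem energySum_add (F G : Occ → PowerSeries ℂ) :
    energySum (fun m => F m + G m) = energySum F + energySum G := by
  ext d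
  simp [energySum, mul_add, Finset.sum_add_distrib]

theorem energySum_mul_left (c : PowerSeries ℂ) (F : Occ → PowerSeries ℂ) :
    energySum (fun m => c * F m) = c * energySum F := by
  ext d
  rw [coeff_energySum _ le_rfl,
    coeff_mul_eq_of_le (fun _ _ => rfl) fun i hi => coeff_energySum F hi,
    Finset.mul_sum]
  congr 1
  exact Finset.sum_congr rfl fun m _ => by ring

/-- Only states containing a quantum of mode `n` contribute; removing that quantum lowers the energy
by `n + 1`. -/
theorem energySum_shift {F : Occ → PowerSeries ℂ} (n : ℕ) (hF : ∀ m, m n = 0 → F m = 0) :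
    energySum F = PowerSeries.X ^ (n + 1) * energySum fun m => F (m + quantum n) := by
  ext d
  rw [coeff_energySum _ le_rfl,
    coeff_mul_eq_of_le (fun _ _ => rfl) fun i hi => coeff_energySum _ hi,
    map_sum, Finset.mul_sum, map_sum]
  have hlast : ∀ m, PowerSeries.X ^ energy (m + quantum n) * F (m + quantum n) =
      PowerSeries.X ^ (n + 1) * (PowerSeries.X ^ energy m * F (m + quantum n)) := fun m => by
    rw [energy_add, energy_quantum]
    ring
  symm
  -- Adding a quantum may leave the range of energies at most `d`, but such terms vanish in degree
  -- `d`; hence a bijection between nonzero terms only.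
  refine Finset.sum_bij_ne_zero (fun m _ _ => m + quantum n) (fun m _ hne => ?_)
    (fun _ _ _ _ _ _ h => add_right_cancel h) (fun m hm hne => ?_) fun m _ _ => ?_
  · rw [← hlast] at hne
    rw [mem_occLE]
    by_contra hlt
    exact hne (coeff_X_pow_energy_mul _ (not_le.1 hlt))
  · have hmn : m n ≠ 0 := fun h => hne (by rw [hF m h, mul_zero, map_zero])
    have hm' : m - quantum n + quantum n = m :=
      tsub_add_cancel_of_le (by simpa [Nat.one_le_iff_ne_zero] using hmn)
    refine ⟨m - quantum n, ?_, ?_, hm'⟩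
    · rw [mem_occLE] at *
      rw [← hm', energy_add] at hm
      omega
    · rwa [← hlast, hm']
  · rw [hlast]

theorem radialMul_eq (V V' : FockMatrix) (m m'' : Occ) :
    radialMul V V' m m'' = energySum fun m' => V m m' * V' m' m'' := by
  ext d
  rw [radialMul, PowerSeries.coeff_mk, energySum, PowerSeries.coeff_mk]
  rw [← Finset.sum_fiberwise_of_maps_to (s := occLE d) (t := range (d + 1)) (g := energy)
    (fun m hm => by rw [mem_occLE] at hm; rw [mem_range]; omega)]
  refine Finset.sum_congr rfl fun e he => ?_
  rw [mem_range] at he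
  rw [finsum_mem_eq_sum_of_inter_support_eq (t := (occLE d).filter fun m => energy m = e)]
  · refine Finset.sum_congr rfl fun m hm => ?_
    obtain ⟨_, rfl⟩ := Finset.mem_filter.1 hm
    rw [PowerSeries.coeff_X_pow_mul', if_pos (by omega)]
  · congr 1
    ext m
    simp only [Set.mem_ofPred_eq, coe_filter, mem_occLE]
    exact ⟨fun h => ⟨by omega, h⟩, fun h => h.2⟩

/-! ### Relations characterizing vertex operators, and their products. -/

/-- The relations with the creation and annihilation operators that characterize, up to a scalar,
the operator which translates `p_n` by `v n`, scales it by `τ n` and multiplies by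
`exp (∑ u_n p_n)`. -/
structure IsVertexMatrix {R : Type*} [CommRing R] (u τ v : ℕ → R) (V : Occ → Occ → R) : Prop where
  succ_succ : ∀ m m' n,
    V (m + quantum n) (m' + quantum n) = τ n * V m m' + v n * V (m + quantum n) m'
  zero_succ : ∀ m m' n, m n = 0 → V m (m' + quantum n) = v n * V m m'
  vacuum : ∀ m n, ((m n : R) + 1) * V (m + quantum n) 0 = u n * V m 0

theorem creation_eq (c : Modes) : creation c = expSeries fun n => c (-((n : ℤ) + 1)) := by
  ext m
  rw [coeff_expSeries]
  simp [creation, MvPowerSeries.coeff_apply, div_eq_mul_inv]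

section MatrixElement

variable (q : Fin 4 → ℂ) (c : Modes)

theorem matrixElement_zero : matrixElement q c 0 0 = 1 := by
  simp [matrixElement, creation_eq, coeff_expSeries_zero]

theorem annihilation_monomial_add_quantum (m' : Occ) (n : ℕ) :
    annihilation q c (MvPolynomial.monomial (m' + quantum n) 1) =
      (MvPolynomial.X n + MvPolynomial.C (c ((n : ℤ) + 1) * commutator q n)) *
        annihilation q c (MvPolynomial.monomial m' 1) := by
  rw [add_comm m', MvPolynomial.monomial_single_add, pow_one, map_mul, annihilation,
    MvPolynomial.aeval_X]

/-- A further quantum in the column multiplies the state by `p_n`, which the annihilation part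
translates; the creation part commutes with multiplication by `p_n`. The vacuum column is the
exponential series itself. -/
theorem matrixElement_isVertexMatrix :
    IsVertexMatrix (fun n => c (-((n : ℤ) + 1))) 1 (fun n => c ((n : ℤ) + 1) * commutator q n)
      (matrixElement q c) where
  succ_succ m m' n := by
    rw [matrixElement, annihilation_monomial_add_quantum]
    push_cast
    rw [add_mul, mul_add, map_add, mul_left_comm, MvPowerSeries.X, add_comm m,
      MvPowerSeries.coeff_add_monomial_mul, mul_left_comm (creation c), MvPowerSeries.coeff_C_mul]
    rfl
  zero_succ m m' n hm := by
    rw [matrixElement, annihilation_monomial_add_quantum]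
    push_cast
    rw [add_mul, mul_add, map_add, mul_left_comm, MvPowerSeries.X,
      MvPowerSeries.coeff_monomial_mul, if_neg, mul_left_comm (creation c),
      MvPowerSeries.coeff_C_mul, zero_add]
    · rfl
    · intro h
      have := h n
      simp [hm] at this
  vacuum m n := by
    simp only [matrixElement, creation_eq]
    simpa using coeff_expSeries_add_quantum (fun n => c (-((n : ℤ) + 1))) m n

theorem pderiv_annihilation (p : MvPolynomial ℕ ℂ) (n : ℕ) :
    MvPolynomial.pderiv n (annihilation q c p) = annihilation q c (MvPolynomial.pderiv n p) := by
  induction p using MvPolynomial.induction_on with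
  | C a => simp [annihilation]
  | add p p' h h' => simp [h, h']
  | mul_X p i h =>
    rw [map_mul, Derivation.leibniz, Derivation.leibniz, h, annihilation, MvPolynomial.aeval_X]
    by_cases hi : i = n
    · subst hi
      simp
    · simp [MvPolynomial.pderiv_X_of_ne hi]

/-- This is `∂ₙ V = V (∂ₙ + c₋ₙ)`: translations commute with derivatives and the creation part is an
exponential. If `m' n = 0` the truncated subtraction is harmless, since its coefficient vanishes. -/
theorem matrixElement_add_quantum_left (m m' : Occ) (n : ℕ) :
    ((m n : ℂ) + 1) * matrixElement q c (m + quantum n) m' =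
      m' n * matrixElement q c m (m' - quantum n) +
        c (-((n : ℤ) + 1)) * matrixElement q c m m' := by
  have h := MvPowerSeries.coeff_pderiv (R := ℂ) (n := m) (i := n)
    (f := creation c * (annihilation q c (MvPolynomial.monomial m' 1) : MvPowerSeries ℕ ℂ))
  rw [Derivation.leibniz, creation_eq, pderiv_expSeries, MvPowerSeries.pderiv_coe,
    pderiv_annihilation, MvPolynomial.pderiv_monomial, ← creation_eq] at h
  rw [mul_comm, matrixElement, ← h]
  have : (MvPolynomial.monomial (m' - quantum n) (1 * (m' n : ℂ)) : MvPolynomial ℕ ℂ) =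
      (m' n : ℂ) • MvPolynomial.monomial (m' - quantum n) 1 := by
    rw [MvPolynomial.smul_monomial, smul_eq_mul, one_mul, mul_one]
  rw [this, map_smul, smul_eq_mul, smul_eq_mul, MvPolynomial.coe_smul, mul_smul_comm, map_add]
  rw [mul_comm (MvPolynomial.toMvPowerSeries _), mul_assoc, MvPowerSeries.coeff_C_mul]
  simp [matrixElement]

end MatrixElement

open PowerSeries in
/-- The operator `V t ^ D V'` is again a vertex operator up to a scalar. -/
theorem IsVertexMatrix.radialMul {q : Fin 4 → ℂ} {c : Modes} {u τ v : ℕ → PowerSeries ℂ}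
    {V : FockMatrix} (hV : IsVertexMatrix u τ v V) :
    IsVertexMatrix (fun n => C (c (-((n : ℤ) + 1))) + X ^ (n + 1) * u n)
      (fun n => X ^ (n + 1) * τ n)
      (fun n => v n + X ^ (n + 1) * τ n * C (c ((n : ℤ) + 1) * commutator q n))
      (radialMul (fun m m' => C (matrixElement q c m m')) V) := by
  set c' : Occ → Occ → ℂ := matrixElement q c with hc'
  have hc := matrixElement_isVertexMatrix q c
  rw [← hc'] at hc
  -- Subtracting `v n` times the column with one quantum fewer kills the intermediate states without
  -- quanta of mode `n`, by `zero_succ`. The shift then applies to the difference, and `succ_succ`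
  -- simplifies it.
  have split : ∀ (W : Occ → PowerSeries ℂ) (m' : Occ) (n : ℕ),
      energySum (fun k => W k * V k (m' + quantum n)) =
        X ^ (n + 1) * τ n * energySum (fun k => W (k + quantum n) * V k m') +
          v n * energySum (fun k => W k * V k m') := by
    intro W m' n
    have h1 : (fun k => W k * V k (m' + quantum n)) = fun k =>
        (W k * V k (m' + quantum n) - v n * (W k * V k m')) + v n * (W k * V k m') := by
      funext k
      ring
    rw [h1, energySum_add, energySum_mul_left, energySum_shift n]
    · have h2 : (fun k => W (k + quantum n) * V (k + quantum n) (m' + quantum n) -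
          v n * (W (k + quantum n) * V (k + quantum n) m')) =
          fun k => τ n * (W (k + quantum n) * V k m') := by
        funext k
        rw [hV.succ_succ]
        ring
      rw [h2, energySum_mul_left, mul_assoc]
    · intro k hk
      rw [hV.zero_succ k m' n hk]
      ring
  refine ⟨fun m m' n => ?_, fun m m' n hm => ?_, fun m n => ?_⟩
  · rw [radialMul_eq, radialMul_eq, radialMul_eq, split]
    have h3 : (fun k => C (c' (m + quantum n) (k + quantum n)) * V k m') = fun k =>
        C (c' m k) * V k m' +
          C (c ((n : ℤ) + 1) * commutator q n) * (C (c' (m + quantum n) k) * V k m') := by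
      funext k
      rw [hc.succ_succ, map_add, map_mul C (c _ * _)]
      simp only [Pi.one_apply, one_mul]
      ring
    rw [h3, energySum_add, energySum_mul_left]
    ring
  · rw [radialMul_eq, radialMul_eq, split]
    have h3 : (fun k => C (c' m (k + quantum n)) * V k m') = fun k =>
          C (c ((n : ℤ) + 1) * commutator q n) * (C (c' m k) * V k m') := by
      funext k
      rw [hc.zero_succ _ _ _ hm, map_mul C (c _ * _)]
      ring
    rw [h3, energySum_mul_left]
    ring
  · rw [radialMul_eq, radialMul_eq, ← energySum_mul_left]
    -- A quantum in the row is either passed to the intermediate state, by the derivative relation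
    -- of the left factor, or created by the left factor itself.
    have h4 : (fun k => ((m n : PowerSeries ℂ) + 1) * (C (c' (m + quantum n) k) * V k 0)) = fun k =>
        C (k n : ℂ) * C (c' m (k - quantum n)) * V k 0 +
          C (c (-((n : ℤ) + 1))) * (C (c' m k) * V k 0) := by
      funext k
      have := congrArg (C (R := ℂ)) (matrixElement_add_quantum_left q c m k n)
      rw [← hc'] at this
      simp only [map_mul, map_add, map_natCast, map_one] at this
      rw [← mul_assoc, this, map_natCast]
      ring
    rw [h4, energySum_add, energySum_mul_left, energySum_shift n]
    · have h5 : (fun k : Occ => C ((k + quantum n) n : ℂ) * C (c' m (k + quantum n - quantum n)) *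
          V (k + quantum n) 0) = fun k => u n * (C (c' m k) * V k 0) := by
        funext k
        have := hV.vacuum k n
        rw [add_tsub_cancel_right, mul_left_comm, ← this]
        simp
        ring
      rw [h5, energySum_mul_left]
      ring
    · intro k hk
      rw [hk]
      simp

instance : CharZero (PowerSeries ℂ) :=
  charZero_of_injective_algebraMap (algebraMap ℂ _).injective

theorem IsVertexMatrix.apply_zero {u τ v : ℕ → PowerSeries ℂ} {V : FockMatrix}
    (hV : IsVertexMatrix u τ v V) (m : Occ) :
    V m 0 = V 0 0 * MvPowerSeries.coeff m (expSeries u) := by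
  induction m using occ_induction with
  | zero => rw [coeff_expSeries_zero, mul_one]
  | add m n ih =>
    have hne : (m n : PowerSeries ℂ) + 1 ≠ 0 := Nat.cast_add_one_ne_zero _
    apply mul_left_cancel₀ hne
    rw [hV.vacuum, ih, mul_left_comm ((m n : PowerSeries ℂ) + 1), coeff_expSeries_add_quantum]
    ring

/-! ### Vacuum expectation values as exponentials of contractions. -/

/-- The exponential `exp (∑ a_n t ^ (n + 1))`. -/
def energyExp (a : ℕ → PowerSeries ℂ) : PowerSeries ℂ :=
  energySum fun m => MvPowerSeries.coeff m (expSeries a)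

/-- In the sum over intermediate states, the vacuum row of the left factor gives plain powers of its
translations, and the vacuum column of the right factor gives exponential coefficients. Their
product is the exponential coefficient of the contraction. -/
theorem IsVertexMatrix.radialMul_zero {q : Fin 4 → ℂ} {c : Modes} {u τ v : ℕ → PowerSeries ℂ}
    {V : FockMatrix} (hV : IsVertexMatrix u τ v V) :
    DTqq.radialMul (fun m m' => PowerSeries.C (matrixElement q c m m')) V 0 0 =
      V 0 0 * energyExp
        (fun n => PowerSeries.C (c ((n : ℤ) + 1) * commutator q n) * u n) := by
  rw [radialMul_eq, energyExp, ← energySum_mul_left]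
  congr 1
  funext m
  rw [hV.apply_zero, mul_left_comm]
  congr 1
  induction m using occ_induction with
  | zero => simp [matrixElement_zero, coeff_expSeries_zero]
  | add m n ih =>
    have hne : (m n : PowerSeries ℂ) + 1 ≠ 0 := Nat.cast_add_one_ne_zero _
    apply mul_left_cancel₀ hne
    rw [mul_left_comm, coeff_expSeries_add_quantum, coeff_expSeries_add_quantum, ← ih,
      (matrixElement_isVertexMatrix q c).zero_succ _ _ _ rfl, map_mul]
    ring

/-- A Cauchy product at cutoff `d`: pairs of states whose total energy exceeds `d` do not contribute
to degree `d`. -/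
theorem energyExp_add (a b : ℕ → PowerSeries ℂ) :
    energyExp (a + b) = energyExp a * energyExp b := by
  ext d
  rw [energyExp, energyExp, energyExp, coeff_energySum _ le_rfl,
    coeff_mul_eq_of_le (fun i hi => coeff_energySum _ hi)
    fun i hi => coeff_energySum _ hi, Finset.sum_mul_sum, ← Finset.sum_product', expSeries_add]
  set f := fun m => MvPowerSeries.coeff m (expSeries a)
  set g := fun m => MvPowerSeries.coeff m (expSeries b)
  have h1 : ∀ m ∈ occLE d, PowerSeries.X ^ energy m *
      MvPowerSeries.coeff m (expSeries a * expSeries b) =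
      ∑ x ∈ (occLE d ×ˢ occLE d) with x.1 + x.2 = m,
        PowerSeries.X ^ energy x.1 * f x.1 * (PowerSeries.X ^ energy x.2 * g x.2) := by
    intro m hm
    rw [MvPowerSeries.coeff_mul, Finset.mul_sum]
    refine Finset.sum_congr ?_ ?_
    · ext x
      simp only [Finset.HasAntidiagonal.mem_antidiagonal, Finset.mem_filter, Finset.mem_product,
        mem_occLE]
      refine ⟨fun h => ⟨?_, h⟩, fun h => h.2⟩
      rw [mem_occLE, ← h, energy_add] at hm
      omega
    · intro x hx
      rw [← (Finset.mem_filter.1 hx).2, energy_add]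
      ring
  rw [Finset.sum_congr rfl h1, Finset.sum_fiberwise_eq_sum_filter, map_sum, map_sum]
  refine Finset.sum_subset (Finset.filter_subset _ _) fun x _ hx' => ?_
  have hlt : d < energy (x.1 + x.2) := by
    by_contra h
    exact hx' (by simp_all)
  rw [show PowerSeries.X ^ energy x.1 * f x.1 * (PowerSeries.X ^ energy x.2 * g x.2) =
    PowerSeries.X ^ energy (x.1 + x.2) * (f x.1 * g x.2) by rw [energy_add]; ring]
  exact coeff_X_pow_energy_mul _ hlt

/-- The value is idempotent by `energyExp_add`, and nonzero because its constant coefficient is `1`.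
-/
theorem energyExp_zero : energyExp 0 = 1 := by
  have h := energyExp_add 0 0
  rw [add_zero] at h
  have h0 : energyExp 0 ≠ 0 := by
    intro h0
    have := congrArg (PowerSeries.coeff 0) h0
    rw [energyExp, coeff_energySum _ le_rfl] at this
    have h1 : occLE 0 = {0} := by
      ext m
      simp only [mem_occLE, nonpos_iff_eq_zero, Finset.mem_singleton]
      refine ⟨fun h => ?_, fun h => by simp [h]⟩
      ext n
      by_contra hn
      have h2 : m - quantum n + quantum n = m :=
        tsub_add_cancel_of_le (by simpa [Nat.one_le_iff_ne_zero] using hn)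
      rw [← h2, energy_add, energy_quantum] at h
      omega
    simp [h1, coeff_expSeries_zero] at this
  exact (mul_left_cancel₀ h0 (by rw [mul_one]; exact h)).symm

theorem energyExp_sum {ι : Type*} (s : Finset ι) (a : ι → ℕ → PowerSeries ℂ) :
    energyExp (∑ i ∈ s, a i) = ∏ i ∈ s, energyExp (a i) := by
  classical
  induction s using Finset.induction_on with
  | empty => simp [energyExp_zero]
  | insert i s hi ih => rw [Finset.sum_insert hi, Finset.prod_insert hi, energyExp_add, ih]

open PowerSeries in
/-- The coefficients of `exp (-∑ z ^ (n + 1) / (n + 1) t ^ (n + 1)) = 1 - z t`, degree by degree. -/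
theorem sum_expSeries_log (z : ℂ) (d : ℕ) :
    ∑ m ∈ occLE d with energy m = d,
      MvPowerSeries.coeff m (expSeries fun n => -(1 / ((n : ℂ) + 1)) * z ^ (n + 1)) =
    if d = 0 then 1 else if d = 1 then -z else 0 := by
  set α : ℕ → ℂ := fun n => -(1 / ((n : ℂ) + 1)) * z ^ (n + 1) with hα
  set h : Occ → ℂ := fun m => MvPowerSeries.coeff m (expSeries α) with hh
  have hcoeff : ∀ (f : Occ → ℂ) (d : ℕ), coeff d (energySum fun m => C (f m)) =
      ∑ m ∈ occLE d with energy m = d, f m := by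
    intro f d
    rw [energySum, coeff_mk, Finset.sum_filter]
    refine Finset.sum_congr rfl fun m _ => ?_
    rw [mul_comm, coeff_C_mul, coeff_X_pow, mul_ite, mul_one, mul_zero]
    simp only [eq_comm]
  set H : ℕ → ℂ := fun d => ∑ m ∈ occLE d with energy m = d, h m with hH
  change H d = _
  have hone : ∀ n : ℕ, (n + 1 : ℂ) * α n = -z ^ (n + 1) := fun n => by
    have : (n : ℂ) + 1 ≠ 0 := by exact_mod_cast n.succ_ne_zero
    simp only [hα]
    field_simp
  -- The occupation number as a weight removes one quantum of mode `n`, which is possible in total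
  -- energy `d + 1` only for `n ≤ d`.
  have inner : ∀ n d : ℕ, (∑ m ∈ occLE (d + 1) with energy m = d + 1, (m n : ℂ) * h m) =
      if n ≤ d then α n * H (d - n) else 0 := by
    intro n d
    rw [← hcoeff fun m => (m n : ℂ) * h m, energySum_shift n (fun m hm => by simp [hm])]
    have : (fun m : Occ => C (((m + quantum n) n : ℂ) * h (m + quantum n))) =
        fun m : Occ => C (α n) * C (h m) := by
      funext m
      rw [← map_mul, hh]
      simp only
      rw [← coeff_expSeries_add_quantum]
      simp
    rw [this, energySum_mul_left, coeff_X_pow_mul', coeff_C_mul, hcoeff]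
    simp only [add_le_add_iff_right, Nat.add_sub_add_right, hH]
  -- Newton's identity: the energy, written as the sum of `(n + 1) * m n`, is inserted under the sum
  -- over states.
  have newton : ∀ d : ℕ, ((d : ℂ) + 1) * H (d + 1) = -∑ n ∈ range (d + 1), z ^ (n + 1) * H (d - n) := by
    intro d
    have h1 : ((d : ℂ) + 1) * H (d + 1) = ∑ n ∈ range (d + 1), ((n : ℂ) + 1) *
        ∑ m ∈ occLE (d + 1) with energy m = d + 1, (m n : ℂ) * h m := by
      simp only [hH, Finset.mul_sum]
      rw [Finset.sum_comm]
      refine Finset.sum_congr rfl fun m hm => ?_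
      have he := (Finset.mem_filter.1 hm).2
      have h2 : ((d : ℂ) + 1) = ∑ n ∈ range (d + 1), ((n : ℂ) + 1) * m n := by
        have : energy m = ∑ n ∈ range (d + 1), (n + 1) * m n := by
          refine Finsupp.sum_of_support_subset _ (fun n hn => ?_) _ fun _ _ => by simp
          have hle := Finset.single_le_sum (f := fun n => (n + 1) * m n)
            (fun _ _ => Nat.zero_le _) hn
          have hpos := Nat.one_le_iff_ne_zero.2 (Finsupp.mem_support_iff.1 hn)
          have : (n + 1) * m n ≤ d + 1 := he ▸ hle
          rw [mem_range]
          nlinarith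
        rw [he] at this
        exact_mod_cast this
      rw [h2, Finset.sum_mul]
      exact Finset.sum_congr rfl fun n _ => by ring
    rw [h1, ← Finset.sum_neg_distrib]
    refine Finset.sum_congr rfl fun n hn => ?_
    rw [inner, if_pos (by rw [mem_range] at hn; omega), ← mul_assoc, hone]
    ring
  have h0 : H 0 = 1 := by
    have : (occLE 0).filter (fun m => energy m = 0) = {0} := by
      ext m
      simp only [Finset.mem_filter, mem_occLE, nonpos_iff_eq_zero, and_self, Finset.mem_singleton]
      refine ⟨fun h => ?_, fun h => by simp [h]⟩
      ext n
      by_contra hn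
      have h2 : m - quantum n + quantum n = m :=
        tsub_add_cancel_of_le (by simpa [Nat.one_le_iff_ne_zero] using hn)
      rw [← h2, energy_add, energy_quantum] at h
      omega
    simp [hH, hh, this, coeff_expSeries_zero]
  -- Two consecutive Newton identities eliminate the long sum. The factor `d` on the right makes `H
  -- 2` vanish, and then all later coefficients.
  have step : ∀ d : ℕ, ((d : ℂ) + 2) * H (d + 2) = z * d * H (d + 1) := by
    intro d
    have h1 := newton (d + 1)
    have h2 := newton d
    rw [Finset.sum_range_succ'] at h1
    simp only [Nat.add_sub_add_right, zero_add, pow_one, Nat.sub_zero] at h1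
    have h3 : ∑ n ∈ range (d + 1), z ^ (n + 1 + 1) * H (d - n) =
        z * ∑ n ∈ range (d + 1), z ^ (n + 1) * H (d - n) := by
      rw [Finset.mul_sum]
      exact Finset.sum_congr rfl fun n _ => by ring
    rw [h3] at h1
    push_cast at h1
    linear_combination h1 - z * h2
  have h1 : H 1 = -z := by simpa [h0] using newton 0
  have h2 : ∀ d, H (d + 2) = 0 := by
    intro d
    induction d with
    | zero => simpa using step 0
    | succ d ih =>
      have := step (d + 1)
      rw [ih, mul_zero] at this
      have hne : ((d + 1 : ℕ) : ℂ) + 2 ≠ 0 := by exact_mod_cast (show d + 1 + 2 ≠ 0 by omega)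
      exact (mul_eq_zero.1 this).resolve_left hne
  match d with
  | 0 => simpa using h0
  | 1 => simpa using h1
  | d + 2 => simpa using h2 d

/-- The modes of `log (1 - z t ^ (e + 1))`. -/
def logModes (z : ℂ) (e : ℕ) : ℕ → PowerSeries ℂ := fun n =>
  PowerSeries.C (-(1 / ((n : ℂ) + 1)) * z ^ (n + 1)) * PowerSeries.X ^ ((n + 1) * e)

-- The factor `t ^ e` per unit of energy amounts to the substitution of `t ^ (e + 1)` for `t` in `1
-- - z t`.
open PowerSeries in
theorem energyExp_logModes (z : ℂ) (e : ℕ) :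
    energyExp (logModes z e) = 1 - C z * X ^ (e + 1) := by
  set α : ℕ → ℂ := fun n => -(1 / ((n : ℂ) + 1)) * z ^ (n + 1) with hα
  have hc : ∀ m, MvPowerSeries.coeff m (expSeries (logModes z e)) =
      C (MvPowerSeries.coeff m (expSeries α)) * X ^ (e * energy m) := by
    intro m
    induction m using occ_induction with
    | zero => simp [coeff_expSeries_zero]
    | add m n ih =>
      have hne : (m n : PowerSeries ℂ) + 1 ≠ 0 := Nat.cast_add_one_ne_zero _
      have h1 := congrArg (C (R := ℂ)) (coeff_expSeries_add_quantum α m n)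
      simp only [map_mul, map_add, map_natCast, map_one] at h1
      apply mul_left_cancel₀ hne
      rw [coeff_expSeries_add_quantum, ih, ← mul_assoc ((m n : PowerSeries ℂ) + 1), h1, energy_add,
        energy_quantum, logModes]
      ring
  ext d
  rw [energyExp, energySum, coeff_mk]
  have h2 : ∀ m ∈ occLE d, coeff d (X ^ energy m *
      MvPowerSeries.coeff m (expSeries (logModes z e))) =
      if (e + 1) * energy m = d then MvPowerSeries.coeff m (expSeries α) else 0 := by
    intro m _
    rw [hc, mul_left_comm, coeff_C_mul, ← pow_add, coeff_X_pow, mul_ite, mul_one, mul_zero,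
      show energy m + e * energy m = (e + 1) * energy m by ring]
    simp only [eq_comm]
  rw [Finset.sum_congr rfl h2, ← Finset.sum_filter, map_sub, coeff_C_mul, coeff_one, coeff_X_pow]
  by_cases hd : (e + 1) ∣ d
  · obtain ⟨k, rfl⟩ := hd
    have h3 : (occLE ((e + 1) * k)).filter (fun m => (e + 1) * energy m = (e + 1) * k) =
        (occLE k).filter fun m => energy m = k := by
      ext m
      simp only [Finset.mem_filter, mem_occLE]
      constructor
      · rintro ⟨_, h⟩
        have := Nat.eq_of_mul_eq_mul_left e.succ_pos h
        omega
      · rintro ⟨_, rfl⟩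
        exact ⟨by nlinarith, rfl⟩
    rw [h3, hα, sum_expSeries_log]
    rcases k with _ | _ | k
    · simp
    · simp
    · have : (e + 1) * (k + 1 + 1) ≠ e + 1 := by nlinarith
      simp [this]
  · have h3 : (occLE d).filter (fun m => (e + 1) * energy m = d) = ∅ :=
      Finset.filter_false_of_mem fun m _ h => hd ⟨_, h.symm⟩
    have h4 : d ≠ 0 := fun h => hd (h ▸ dvd_zero _)
    have h5 : d ≠ e + 1 := fun h => hd (h ▸ dvd_rfl)
    simp [h3, h4, h5]

/-! ### Continuation of ordered products to `t = 1`. -/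

theorem HasContinuedRatio.mul {f g f' g' : PowerSeries ℂ} {v v' : ℂ}
    (h : HasContinuedRatio f g v) (h' : HasContinuedRatio f' g' v') :
    HasContinuedRatio (f * f') (g * g') (v * v') := by
  obtain ⟨p, s, hs, hfg, hp⟩ := h
  obtain ⟨p', s', hs', hfg', hp'⟩ := h'
  refine ⟨p * p', s * s', by simp [hs, hs'], ?_, ?_⟩
  · push_cast
    linear_combination (↑s' * f') * hfg + (↑p * g) * hfg'
  · rw [Polynomial.eval_mul, hp, hp', Polynomial.eval_mul]
    ring

theorem HasContinuedRatio.refl (f : PowerSeries ℂ) : HasContinuedRatio f f 1 :=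
  ⟨1, 1, by simp, by simp, by simp⟩

theorem HasContinuedRatio.poly (p : Polynomial ℂ) :
    HasContinuedRatio (p : PowerSeries ℂ) 1 (p.eval 1) :=
  ⟨p, 1, by simp, by simp, by simp⟩

theorem HasContinuedRatio.prod {ι : Type*} {s : Finset ι} {f : ι → PowerSeries ℂ} {v : ι → ℂ}
    (h : ∀ i ∈ s, HasContinuedRatio (f i) 1 (v i)) :
    HasContinuedRatio (∏ i ∈ s, f i) 1 (∏ i ∈ s, v i) := by
  classical
  induction s using Finset.induction_on with
  | empty => simpa using HasContinuedRatio.refl 1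
  | insert i s hi ih =>
    rw [Finset.prod_insert hi, Finset.prod_insert hi]
    simpa using (h i (Finset.mem_insert_self _ _)).mul
      (ih fun j hj => h j (Finset.mem_insert_of_mem hj))

theorem energyExp_nsmul (k : ℕ) (a : ℕ → PowerSeries ℂ) :
    energyExp (k • a) = energyExp a ^ k := by
  simpa using energyExp_sum (range k) fun _ => a

/-- For negative exponents the power of `1 - z t ^ (e + 1)` is the denominator; `z ≠ 1` keeps it
nonzero at `t = 1`. -/
theorem hasContinuedRatio_energyExp_zsmul {z : ℂ} (hz : z ≠ 1) (e : ℕ) (k : ℤ) :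
    HasContinuedRatio (energyExp (k • logModes z e)) 1 ((1 - z) ^ k) := by
  have hz' : 1 - z ≠ 0 := sub_ne_zero.2 hz.symm
  set P : Polynomial ℂ := 1 - Polynomial.C z * Polynomial.X ^ (e + 1) with hP
  have hP1 : P.eval 1 = 1 - z := by simp [hP]
  have hPc : (P : PowerSeries ℂ) = energyExp (logModes z e) := by
    rw [energyExp_logModes, hP]
    push_cast
    rfl
  obtain ⟨n, rfl | rfl⟩ := k.eq_nat_or_neg
  · refine ⟨P ^ n, 1, by simp, ?_, by simp [hP1]⟩
    rw [natCast_zsmul, energyExp_nsmul, ← hPc]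
    push_cast
    ring
  · refine ⟨1, P ^ n, by simp [hP1, hz'], ?_, by simp [hP1, hz']⟩
    rw [Polynomial.coe_pow, hPc, ← energyExp_nsmul, ← natCast_zsmul, ← energyExp_add,
      neg_smul, add_neg_cancel, energyExp_zero]
    simp

-- The creation modes of layer `i` are moved to the left across `N - i` factors `t ^ D`, its
-- annihilation modes to the right across `i` of them, and a spectator quantum crosses all `N`.
open PowerSeries in
theorem isVertexMatrix_orderedProd (q : Fin 4 → ℂ) (c : ℕ → Modes) (N : ℕ) :
    IsVertexMatrix
      (fun n => ∑ i ∈ range (N + 1), C (c i (-((n : ℤ) + 1))) * X ^ ((n + 1) * (N - i)))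
      (fun n => X ^ ((n + 1) * N))
      (fun n => ∑ i ∈ range (N + 1),
        C (c i ((n : ℤ) + 1) * commutator q n) * X ^ ((n + 1) * i))
      (orderedProd q c N) := by
  induction N with
  | zero =>
    have h := matrixElement_isVertexMatrix q (c 0)
    refine ⟨fun m m' n => ?_, fun m m' n hm => ?_, fun m n => ?_⟩
    · simp [orderedProd, h.succ_succ]
    · simp [orderedProd, h.zero_succ _ _ _ hm]
    · have := congrArg (C (R := ℂ)) (h.vacuum m n)
      simpa [orderedProd] using this
  | succ N ih =>
    have h := ih.radialMul (q := q) (c := c (N + 1))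
    rw [orderedProd]
    convert h using 1
    · funext n
      rw [Finset.sum_range_succ, Finset.mul_sum, add_comm]
      congr 1
      · simp
      · refine Finset.sum_congr rfl fun i hi => ?_
        rw [mem_range] at hi
        rw [show N + 1 - i = N - i + 1 by omega]
        ring
    · funext n
      ring
    · funext n
      rw [Finset.sum_range_succ]
      ring

/-- The recursions reduce every entry to the vacuum entry, with coefficients polynomial in `t`. At
`t = 1` they become the recursions of the normal-ordered product, whose modes are the sum of the
modes of the layers. -/
theorem exists_orderedProd_eq (q : Fin 4 → ℂ) (c : ℕ → Modes) (N : ℕ) (m m' : Occ) :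
    ∃ p : Polynomial ℂ, orderedProd q c N m m' = orderedProd q c N 0 0 * (p : PowerSeries ℂ) ∧
      p.eval 1 = matrixElement q (∑ k ∈ range (N + 1), c k) m m' := by
  have hV := isVertexMatrix_orderedProd q c N
  have hM := matrixElement_isVertexMatrix q (∑ k ∈ range (N + 1), c k)
  set V := orderedProd q c N
  set W := matrixElement q (∑ k ∈ range (N + 1), c k)
  set u : ℕ → Polynomial ℂ := fun n => ∑ i ∈ range (N + 1),
    Polynomial.C (c i (-((n : ℤ) + 1))) * Polynomial.X ^ ((n + 1) * (N - i)) with hu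
  set v : ℕ → Polynomial ℂ := fun n => ∑ i ∈ range (N + 1),
    Polynomial.C (c i ((n : ℤ) + 1) * commutator q n) * Polynomial.X ^ ((n + 1) * i) with hv
  have hcoe : ∀ (f : ℕ → Polynomial ℂ), ((∑ i ∈ range (N + 1), f i : Polynomial ℂ) :
      PowerSeries ℂ) = ∑ i ∈ range (N + 1), (f i : PowerSeries ℂ) := fun f => by
    simp only [← Polynomial.coeToPowerSeries.ringHom_apply, map_sum]
  have hu' : ∀ n, ((u n : Polynomial ℂ) : PowerSeries ℂ) = ∑ i ∈ range (N + 1),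
      PowerSeries.C (c i (-((n : ℤ) + 1))) * PowerSeries.X ^ ((n + 1) * (N - i)) := fun n => by
    simp [hu, hcoe]
  have hv' : ∀ n, ((v n : Polynomial ℂ) : PowerSeries ℂ) = ∑ i ∈ range (N + 1),
      PowerSeries.C (c i ((n : ℤ) + 1) * commutator q n) * PowerSeries.X ^ ((n + 1) * i) :=
    fun n => by simp [hv, hcoe]
  have hu1 : ∀ n, (u n).eval 1 = (∑ k ∈ range (N + 1), c k) (-((n : ℤ) + 1)) := fun n => by
    simp [hu, Polynomial.eval_finsetSum]
  have hv1 : ∀ n, (v n).eval 1 = (∑ k ∈ range (N + 1), c k) ((n : ℤ) + 1) * commutator q n :=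
    fun n => by simp [hv, Polynomial.eval_finsetSum, Finset.sum_mul]
  have base : ∀ m, ∃ p : Polynomial ℂ, V m 0 = V 0 0 * (p : PowerSeries ℂ) ∧ p.eval 1 = W m 0 := by
    intro m
    induction m using occ_induction with
    | zero => exact ⟨1, by simp, by simp [W, matrixElement_zero]⟩
    | add m n ih =>
      obtain ⟨p, h1, h2⟩ := ih
      have hne : (m n : ℂ) + 1 ≠ 0 := Nat.cast_add_one_ne_zero _
      have hne' : (m n : PowerSeries ℂ) + 1 ≠ 0 := Nat.cast_add_one_ne_zero _
      have hC : ((m n : PowerSeries ℂ) + 1) * PowerSeries.C (((m n : ℂ) + 1)⁻¹) = 1 := by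
        have : (m n : PowerSeries ℂ) + 1 = PowerSeries.C ((m n : ℂ) + 1) := by simp
        rw [this, ← map_mul, mul_inv_cancel₀ hne, map_one]
      refine ⟨Polynomial.C (((m n : ℂ) + 1)⁻¹) * u n * p, ?_, ?_⟩
      · apply mul_left_cancel₀ hne'
        rw [hV.vacuum, h1]
        push_cast
        rw [hu']
        linear_combination -(∑ i ∈ range (N + 1),
          PowerSeries.C (c i (-((n : ℤ) + 1))) * PowerSeries.X ^ ((n + 1) * (N - i))) *
            (V 0 0 * (p : PowerSeries ℂ)) * hC
      · apply mul_left_cancel₀ hne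
        rw [hM.vacuum, ← h2, ← hu1]
        simp only [Polynomial.eval_mul, Polynomial.eval_C]
        field_simp
  induction m' using occ_induction generalizing m with
  | zero => exact base m
  | add m' n ih =>
    by_cases hm : m n = 0
    · obtain ⟨p, h1, h2⟩ := ih m
      refine ⟨v n * p, ?_, ?_⟩
      · rw [hV.zero_succ _ _ _ hm, h1]
        push_cast
        rw [hv']
        ring
      · rw [hM.zero_succ _ _ _ hm, ← h2, ← hv1, Polynomial.eval_mul]
    · have hm' : m - quantum n + quantum n = m :=
        tsub_add_cancel_of_le (by simpa [Nat.one_le_iff_ne_zero] using hm)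
      obtain ⟨p, h1, h2⟩ := ih m
      obtain ⟨p', h1', h2'⟩ := ih (m - quantum n)
      refine ⟨Polynomial.X ^ ((n + 1) * N) * p' + v n * p, ?_, ?_⟩
      · rw [← hm', hV.succ_succ, hm', h1, h1']
        push_cast
        rw [hv']
        ring
      · rw [← hm', hM.succ_succ, hm', ← h2, ← h2', ← hv1]
        simp

theorem orderedProd_succ_zero (q : Fin 4 → ℂ) (c : ℕ → Modes) (N : ℕ) :
    orderedProd q c (N + 1) 0 0 = orderedProd q c N 0 0 * energyExp
      (∑ i ∈ range (N + 1), fun n => PowerSeries.C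
        (c (N + 1) ((n : ℤ) + 1) * c i (-((n : ℤ) + 1)) * commutator q n) *
          PowerSeries.X ^ ((n + 1) * (N - i))) := by
  rw [orderedProd, (isVertexMatrix_orderedProd q c N).radialMul_zero]
  congr 2
  funext n
  rw [Finset.mul_sum, Finset.sum_apply]
  refine Finset.sum_congr rfl fun i _ => ?_
  simp only [map_mul]
  ring

/-- If the contractions of the layers and those of the vacuum layers differ by the logarithm of a
rational function which is regular at `t = 1`, the ordered product is the normal-ordered one times
the product of the values of these functions. -/
theorem hasContinuedRatio_orderedProd {ι : Type*} (q : Fin 4 → ℂ) (c cvac : ℕ → Modes) (z : ι → ℂ)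
    (S : ℕ → ℕ → Finset ι) (Y : ℕ → ℕ → ι → ℤ) (hz : ∀ i j, i < j → ∀ w ∈ S i j, z w ≠ 1)
    (hY : ∀ i j, i < j → ∀ n : ℕ,
      c j ((n : ℤ) + 1) * c i (-((n : ℤ) + 1)) * commutator q n =
        cvac j ((n : ℤ) + 1) * cvac i (-((n : ℤ) + 1)) * commutator q n -
          1 / ((n : ℂ) + 1) * ∑ w ∈ S i j, Y i j w * z w ^ (n + 1))
    (N : ℕ) (m m' : Occ) :
    HasContinuedRatio (orderedProd q c N m m') (orderedProd q cvac N 0 0)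
      ((∏ j ∈ range (N + 1), ∏ i ∈ range j, ∏ w ∈ S i j, (1 - z w) ^ Y i j w) *
        matrixElement q (∑ k ∈ range (N + 1), c k) m m') := by
  have hvac : HasContinuedRatio (orderedProd q c N 0 0) (orderedProd q cvac N 0 0)
      (∏ j ∈ range (N + 1), ∏ i ∈ range j, ∏ w ∈ S i j, (1 - z w) ^ Y i j w) := by
    clear m m'
    induction N with
    | zero => simpa [orderedProd, matrixElement_zero] using HasContinuedRatio.refl 1
    | succ N ih =>
      rw [orderedProd_succ_zero, orderedProd_succ_zero, Finset.prod_range_succ]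
      refine ih.mul ?_
      -- Layers `i` and `N + 1` are separated by `N + 1 - i` factors `t ^ D`; as `logModes` with
      -- parameter `e` belongs to `1 - z t ^ (e + 1)`, the parameter is `N - i`.
      have h1 : ∀ i ∈ range (N + 1), (fun n : ℕ => PowerSeries.C
          (c (N + 1) ((n : ℤ) + 1) * c i (-((n : ℤ) + 1)) * commutator q n) *
            PowerSeries.X ^ ((n + 1) * (N - i))) = (fun n : ℕ => PowerSeries.C
          (cvac (N + 1) ((n : ℤ) + 1) * cvac i (-((n : ℤ) + 1)) * commutator q n) *
            PowerSeries.X ^ ((n + 1) * (N - i))) +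
          ∑ w ∈ S i (N + 1), Y i (N + 1) w • logModes (z w) (N - i) := by
        intro i hi
        funext n
        rw [hY i (N + 1) (mem_range.1 hi), Pi.add_apply, Finset.sum_apply]
        simp only [logModes, Pi.smul_apply, zsmul_eq_mul, map_sub, sub_mul]
        rw [sub_eq_add_neg, Finset.mul_sum, map_sum, Finset.sum_mul, ← Finset.sum_neg_distrib]
        congr 1
        refine Finset.sum_congr rfl fun w _ => ?_
        simp only [map_mul, map_neg, map_intCast]
        ring
      rw [Finset.sum_congr rfl h1, Finset.sum_add_distrib, energyExp_add]
      have h2 := (HasContinuedRatio.refl (energyExp (∑ i ∈ range (N + 1), fun n : ℕ => PowerSeries.C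
          (cvac (N + 1) ((n : ℤ) + 1) * cvac i (-((n : ℤ) + 1)) * commutator q n) *
            PowerSeries.X ^ ((n + 1) * (N - i))))).mul
        (HasContinuedRatio.prod (s := range (N + 1)) (f := fun i => ∏ w ∈ S i (N + 1),
            energyExp (Y i (N + 1) w • logModes (z w) (N - i)))
          (v := fun i => ∏ w ∈ S i (N + 1), (1 - z w) ^ Y i (N + 1) w) fun i hi =>
            HasContinuedRatio.prod fun w hw => hasContinuedRatio_energyExp_zsmul
              (hz i (N + 1) (mem_range.1 hi) w hw) _ _)
      rw [one_mul, mul_one] at h2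
      convert h2 using 2
      rw [energyExp_sum]
      exact Finset.prod_congr rfl fun i _ => energyExp_sum _ _
  obtain ⟨p, h1, h2⟩ := exists_orderedProd_eq q c N m m'
  rw [h1, ← h2]
  simpa using hvac.mul (HasContinuedRatio.poly p)

/-! ## Characters -/

theorem mono_add (a b : Weight) : mono (a + b) = mono a * mono b := by
  simp [mono, AddMonoidAlgebra.single_mul_single]

theorem mono_zero : mono 0 = 1 := rfl

theorem mono_ne_zero_mul_neg (a : Weight) : mono a * mono (-a) = 1 := by
  rw [← mono_add, add_neg_cancel, mono_zero]

theorem mono_nsmul (n : ℕ) (a : Weight) : mono (n • a) = mono a ^ n := by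
  induction n with
  | zero => simp [mono_zero]
  | succ n ih => rw [succ_nsmul, mono_add, ih, pow_succ]

theorem coeff_mono_mul (a : Weight) (X : Chr) (w : Weight) :
    (mono a * X).coeff w = X.coeff (w - a) := by
  rw [mono, AddMonoidAlgebra.coeff_single_mul_apply, one_mul, sub_eq_neg_add]

theorem coeff_mono (a w : Weight) : (mono a).coeff w = if a = w then 1 else 0 := by
  rw [mono, AddMonoidAlgebra.coeff_single, Finsupp.single_apply]

/-- Duality as a ring homomorphism. -/
def dualHom : Chr →+* Chr :=
  AddMonoidAlgebra.mapDomainRingHom ℤ (negAddMonoidHom : Weight →+ Weight)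

theorem dual_eq (X : Chr) : dual X = dualHom X := rfl

theorem dual_mono (a : Weight) : dual (mono a) = mono (-a) := by
  simp [dual, mono]

@[simp] theorem dualHom_mono (a : Weight) : dualHom (mono a) = mono (-a) := dual_mono a

theorem coeff_dual (X : Chr) (w : Weight) : (dual X).coeff w = X.coeff (-w) := by
  have := Finsupp.mapDomain_apply (f := fun w : Weight => -w) neg_injective X.coeff (-w)
  rw [neg_neg] at this
  exact this

theorem coeff_dualHom (X : Chr) (w : Weight) : (dualHom X).coeff w = X.coeff (-w) := coeff_dual X w

@[simp] theorem dualHom_dualHom (X : Chr) : dualHom (dualHom X) = X := by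
  ext w
  rw [coeff_dualHom, coeff_dualHom, neg_neg]

theorem constTerm_add (X Y : Chr) : constTerm (X + Y) = constTerm X + constTerm Y := rfl
theorem constTerm_neg (X : Chr) : constTerm (-X) = -constTerm X := rfl
theorem constTerm_sub (X Y : Chr) : constTerm (X - Y) = constTerm X - constTerm Y := rfl

theorem constTerm_dualHom (X : Chr) : constTerm (dualHom X) = constTerm X := by
  rw [constTerm, coeff_dualHom, neg_zero, constTerm]

/-- The number of monomials, with multiplicities. -/
def rank : Chr →+* ℤ := (AddMonoidAlgebra.lift ℤ ℤ Weight 1).toRingHom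

@[simp] theorem rank_mono (a : Weight) : rank (mono a) = 1 := by
  simp [rank, mono]

@[simp] theorem rank_P {S : Finset (Fin 4)} (hS : S.Nonempty) : rank (P S) = 0 := by
  obtain ⟨a, ha⟩ := hS
  rw [P, map_prod]
  exact Finset.prod_eq_zero ha (by simp)

/-- All monomials of `X` have degree `i` in `x` and degree between `lo` and `hi` in `K`. -/
def InBand (X : Chr) (i lo hi : ℤ) : Prop :=
  ∀ w, X.coeff w ≠ 0 → w 4 = i ∧ lo ≤ w 3 ∧ w 3 ≤ hi

namespace InBand

variable {X Y : Chr} {i lo hi i' lo' hi' : ℤ}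

theorem mono' (h : InBand X i lo hi) (h1 : lo' ≤ lo) (h2 : hi ≤ hi') : InBand X i lo' hi' :=
  fun w hw => ⟨(h w hw).1, h1.trans (h w hw).2.1, (h w hw).2.2.trans h2⟩

theorem zero : InBand 0 i lo hi := fun w hw => by simp at hw

theorem add (h : InBand X i lo hi) (h' : InBand Y i lo hi) : InBand (X + Y) i lo hi := by
  intro w hw
  by_cases h0 : X.coeff w = 0
  · exact h' w (by simpa [h0] using hw)
  · exact h w h0

theorem neg (h : InBand X i lo hi) : InBand (-X) i lo hi := fun w hw => h w (by simpa using hw)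

theorem sub (h : InBand X i lo hi) (h' : InBand Y i lo hi) : InBand (X - Y) i lo hi := by
  rw [sub_eq_add_neg]
  exact h.add h'.neg

theorem sum {ι : Type*} {s : Finset ι} {X : ι → Chr} (h : ∀ j ∈ s, InBand (X j) i lo hi) :
    InBand (∑ j ∈ s, X j) i lo hi :=
  Finset.sum_induction _ (fun X => InBand X i lo hi) (fun _ _ => add) zero h

theorem mul (h : InBand X i lo hi) (h' : InBand Y i' lo' hi') :
    InBand (X * Y) (i + i') (lo + lo') (hi + hi') := by
  intro w hw
  have := AddMonoidAlgebra.support_coeff_mul_subset X Y (Finsupp.mem_support_iff.2 hw)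
  obtain ⟨a, ha, b, hb, rfl⟩ := Finset.mem_add.1 this
  have h1 := h a (Finsupp.mem_support_iff.1 ha)
  have h2 := h' b (Finsupp.mem_support_iff.1 hb)
  simp only [Pi.add_apply]
  omega

theorem dualHom (h : InBand X i lo hi) : InBand (dualHom X) (-i) (-hi) (-lo) := by
  intro w hw
  rw [coeff_dualHom] at hw
  have := h _ hw
  simp only [Pi.neg_apply] at this
  omega

theorem of_mono {a : Weight} (h1 : a 4 = i) (h2 : lo ≤ a 3) (h3 : a 3 ≤ hi) :
    InBand (mono a) i lo hi := by
  intro w hw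
  rw [coeff_mono] at hw
  have : a = w := by
    by_contra h
    simp [h] at hw
  subst this
  exact ⟨h1, h2, h3⟩

theorem one : InBand 1 0 0 0 := of_mono (a := 0) rfl le_rfl le_rfl

end InBand

theorem wq_apply_three (a : Fin 4) : wq a 3 = 0 := by fin_cases a <;> rfl
theorem wq_apply_four (a : Fin 4) : wq a 4 = 0 := by fin_cases a <;> rfl

theorem inBand_P (S : Finset (Fin 4)) : InBand (P S) 0 0 0 := by
  rw [P]
  refine Finset.prod_induction _ (fun X => InBand X 0 0 0) (fun _ _ h h' => ?_) InBand.one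
    fun a _ => InBand.one.sub (InBand.of_mono (wq_apply_four a) (wq_apply_three a).ge
      (wq_apply_three a).le)
  simpa using h.mul h'

/-! ### Evaluation at generic parameters. -/

/-- The parameters are generic. -/
structure Generic (q : Fin 4 → ℂ) (K x : ℂ) : Prop where
  prod_eq : q 0 * q 1 * q 2 * q 3 = 1
  indep : ∀ a b c : ℤ, q 0 ^ a * q 1 ^ b * q 2 ^ c = 1 → a = 0 ∧ b = 0 ∧ c = 0
  K_ne_zero : K ≠ 0
  K_ne : ∀ a b c : ℤ, K ≠ q 0 ^ a * q 1 ^ b * q 2 ^ c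
  x_ne_zero : x ≠ 0

namespace Generic

variable {q : Fin 4 → ℂ} {K x : ℂ} (h : Generic q K x)

end Generic

namespace Generic

variable {q : Fin 4 → ℂ} {K x : ℂ}

theorem q_ne_zero (h : Generic q K x) (a : Fin 4) : q a ≠ 0 := by
  intro ha
  have := h.prod_eq
  fin_cases a <;> simp_all

theorem ev_add (h : Generic q K x) (w w' : Weight) :
    ev q K x (w + w') = ev q K x w * ev q K x w' := by
  simp only [ev, Pi.add_apply, zpow_add₀ (h.q_ne_zero _), zpow_add₀ h.K_ne_zero,
    zpow_add₀ h.x_ne_zero]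
  ring

theorem ev_ne_zero (h : Generic q K x) (w : Weight) : ev q K x w ≠ 0 := by
  have := h.q_ne_zero
  have := h.K_ne_zero
  have := h.x_ne_zero
  simp [ev, zpow_ne_zero, *]

theorem ev_zero : ev q K x 0 = 1 := by simp [ev]

theorem ev_neg (h : Generic q K x) (w : Weight) : ev q K x (-w) = (ev q K x w)⁻¹ := by
  exact eq_inv_of_mul_eq_one_left (by rw [← h.ev_add, neg_add_cancel, ev_zero])

theorem ev_wq (h : Generic q K x) (a : Fin 4) : ev q K x (wq a) = q a := by
  fin_cases a
  · simp [ev, wq]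
  · simp [ev, wq]
  · simp [ev, wq]
  · have h0 := h.q_ne_zero 0
    have h1 := h.q_ne_zero 1
    have h2 := h.q_ne_zero 2
    simp only [ev, wq]
    simp
    field_simp
    linear_combination -h.prod_eq

/-- This is the purpose of the bands: with degree zero in `x` and degree between `-1` and `1` in
`K`, it suffices that `K` itself is not a monomial in the `q`'s. Nothing is needed about `K ^ 2` or
`x`. -/
theorem ev_eq_one (h : Generic q K x) {w : Weight} (h4 : w 4 = 0) (h3 : -1 ≤ w 3) (h3' : w 3 ≤ 1)
    (hw : ev q K x w = 1) : w = 0 := by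
  have h0 := h.q_ne_zero 0
  have h1 := h.q_ne_zero 1
  have h2 := h.q_ne_zero 2
  have hK := h.K_ne_zero
  rw [ev, h4, zpow_zero, mul_one] at hw
  have : w 3 = -1 ∨ w 3 = 0 ∨ w 3 = 1 := by omega
  rcases this with h3 | h3 | h3
  · rw [h3, zpow_neg_one] at hw
    exact absurd (by field_simp at hw; exact hw.symm) (h.K_ne (w 0) (w 1) (w 2))
  · rw [h3, zpow_zero, mul_one] at hw
    obtain ⟨ha, hb, hc⟩ := h.indep _ _ _ hw
    funext i
    fin_cases i <;> assumption
  · rw [h3, zpow_one] at hw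
    refine absurd ?_ (h.K_ne (-w 0) (-w 1) (-w 2))
    rw [zpow_neg, zpow_neg, zpow_neg]
    field_simp
    linear_combination hw

/-- The value of a character at the `n`-th powers of the variables. -/
def evHom (h : Generic q K x) (n : ℤ) : Chr →+* ℂ :=
  (AddMonoidAlgebra.lift ℤ ℂ Weight
    { toFun := fun w => ev q K x w.toAdd ^ n
      map_one' := by rw [toAdd_one, ev_zero, one_zpow]
      map_mul' := fun w w' => by rw [toAdd_mul, h.ev_add, mul_zpow] }).toRingHom

@[simp] theorem evHom_mono (h : Generic q K x) (n : ℤ) (w : Weight) :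
    h.evHom n (mono w) = ev q K x w ^ n := by
  simp [evHom, mono]

theorem evHom_apply (h : Generic q K x) (n : ℤ) (X : Chr) :
    h.evHom n X = ∑ w ∈ X.coeff.support, (X.coeff w : ℂ) * ev q K x w ^ n := by
  simp [evHom, AddMonoidAlgebra.lift_apply, Finsupp.sum]

theorem evHom_dualHom (h : Generic q K x) (n : ℤ) (X : Chr) :
    h.evHom n (dualHom X) = h.evHom (-n) X := by
  have : (h.evHom n).comp dualHom = h.evHom (-n) := by
    apply AddMonoidAlgebra.ringHom_ext
    · intro r
      simp [dualHom, evHom, ev_zero]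
    · intro w
      have := h.evHom_mono n (-w)
      rw [h.ev_neg, inv_zpow, ← zpow_neg, ← h.evHom_mono (-n) w, ← dualHom_mono] at this
      exact this
  exact RingHom.congr_fun this X

@[simp] theorem evHom_P (h : Generic q K x) (n : ℤ) (S : Finset (Fin 4)) :
    h.evHom n (P S) = adams q S n := by
  simp [P, adams, h.ev_wq]

theorem adams_ne_zero (h : Generic q K x) (S : Finset (Fin 4)) {n : ℤ} (hn : n ≠ 0) :
    adams q S n ≠ 0 := by
  rw [adams, Finset.prod_ne_zero_iff]
  intro a _ ha
  rw [sub_eq_zero, ← h.ev_wq a, ev, mul_zpow, mul_zpow, mul_zpow, mul_zpow, ← zpow_mul, ← zpow_mul,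
    ← zpow_mul, wq_apply_three, wq_apply_four, zpow_zero, zpow_zero, one_zpow, mul_one, mul_one] at ha
  obtain ⟨h0, h1, h2⟩ := h.indep _ _ _ ha.symm
  fin_cases a <;> simp [wq] at h0 h1 h2 <;> exact hn (by assumption)

end Generic

/-! ## The index -/

/-- A character without constant term to which the index can be applied multiplicatively. -/
def Movable (X : Chr) : Prop := InBand X 0 (-1) 1 ∧ constTerm X = 0

namespace Movable

variable {X Y : Chr}

theorem add (h : Movable X) (h' : Movable Y) : Movable (X + Y) :=
  ⟨h.1.add h'.1, by rw [constTerm_add, h.2, h'.2, add_zero]⟩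

theorem sub (h : Movable X) (h' : Movable Y) : Movable (X - Y) :=
  ⟨h.1.sub h'.1, by rw [constTerm_sub, h.2, h'.2, sub_zero]⟩

theorem sum {ι : Type*} {s : Finset ι} {X : ι → Chr} (h : ∀ i ∈ s, Movable (X i)) :
    Movable (∑ i ∈ s, X i) :=
  Finset.sum_induction _ Movable (fun _ _ => add) ⟨.zero, rfl⟩ h

theorem dualHom (h : Movable X) : Movable (dualHom X) :=
  ⟨by simpa using h.1.dualHom, by rw [constTerm_dualHom, h.2]⟩

theorem dualHom_sub_self (h : InBand X 0 (-1) 1) : Movable (DTqq.dualHom X - X) :=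
  ⟨by simpa using h.dualHom.sub h, by rw [constTerm_sub, constTerm_dualHom, sub_self]⟩

theorem ev_ne_one (h : Movable X) {q : Fin 4 → ℂ} {K x : ℂ} (hq : Generic q K x) {w : Weight}
    (hw : w ∈ X.coeff.support) : ev q K x w ≠ 1 := by
  intro h1
  have h2 := h.1 w (Finsupp.mem_support_iff.1 hw)
  have := hq.ev_eq_one h2.1 h2.2.1 h2.2.2 h1
  subst this
  exact Finsupp.mem_support_iff.1 hw h.2

end Movable

section Index

variable {q : Fin 4 → ℂ} {K x : ℂ}

theorem index_eq_prod (X : Chr) :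
    index q K x X = X.coeff.prod fun w k => (1 - (ev q K x w)⁻¹) ^ k := rfl

theorem index_zero : index q K x 0 = 1 := by simp [index_eq_prod]

theorem index_factor_ne_zero (hq : Generic q K x) {X : Chr} (h : Movable X) {w : Weight}
    (hw : w ∈ X.coeff.support) : 1 - (ev q K x w)⁻¹ ≠ 0 := by
  rw [sub_ne_zero, ne_comm, Ne, inv_eq_one]
  exact h.ev_ne_one hq hw

theorem index_ne_zero (hq : Generic q K x) {X : Chr} (h : Movable X) : index q K x X ≠ 0 :=
  Finset.prod_ne_zero_iff.2 fun _ hw => zpow_ne_zero _ (index_factor_ne_zero hq h hw)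

/-- No factor of a movable character is zero, so integer exponents add even when they have opposite
signs. -/
theorem index_add (hq : Generic q K x) {X Y : Chr} (h : Movable X) (h' : Movable Y) :
    index q K x (X + Y) = index q K x X * index q K x Y := by
  classical
  rw [index_eq_prod, index_eq_prod, index_eq_prod, AddMonoidAlgebra.coeff_add]
  refine Finsupp.prod_add_index (fun _ _ => zpow_zero _) fun w hw k l => zpow_add₀ ?_ k l
  rcases Finset.mem_union.1 hw with hw | hw
  · exact index_factor_ne_zero hq h hw
  · exact index_factor_ne_zero hq h' hw

theorem index_sub (hq : Generic q K x) {X Y : Chr} (h : Movable X) (h' : Movable Y) :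
    index q K x (X - Y) = index q K x X / index q K x Y := by
  rw [eq_div_iff (index_ne_zero hq h'), ← index_add hq (h.sub h') h', sub_add_cancel]

theorem index_sum (hq : Generic q K x) {ι : Type*} {s : Finset ι} {X : ι → Chr}
    (h : ∀ i ∈ s, Movable (X i)) :
    index q K x (∑ i ∈ s, X i) = ∏ i ∈ s, index q K x (X i) := by
  classical
  induction s using Finset.induction_on with
  | empty => simp [index_zero]
  | insert i s hi ih =>
    rw [Finset.sum_insert hi, Finset.prod_insert hi, index_add hq (h i (Finset.mem_insert_self _ _))
      (.sum fun j hj => h j (Finset.mem_insert_of_mem hj)),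
      ih fun j hj => h j (Finset.mem_insert_of_mem hj)]

/-- The product of the monomials `-w` of a character. -/
def signedDet (q : Fin 4 → ℂ) (K x : ℂ) (X : Chr) : ℂ := X.coeff.prod fun w k => (-ev q K x w) ^ k

theorem signedDet_add (hq : Generic q K x) (X Y : Chr) :
    signedDet q K x (X + Y) = signedDet q K x X * signedDet q K x Y :=
  Finsupp.prod_add_index' (fun _ => zpow_zero _)
    fun w k l => zpow_add₀ (neg_ne_zero.2 (hq.ev_ne_zero w)) k l

theorem signedDet_single (w : Weight) (k : ℤ) :
    signedDet q K x (AddMonoidAlgebra.single w k) = (-ev q K x w) ^ k := by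
  rw [signedDet, AddMonoidAlgebra.coeff_single, Finsupp.prod_single_index (zpow_zero _)]

/-- Each monomial `w` of `Y` occurs against `a w`, so the signs and `w` cancel and only a power of
`a` remains. A factor `1 - a` together with rank zero thus trivializes the determinant. -/
theorem signedDet_one_sub_mono_mul (hq : Generic q K x) (a : Weight) (Y : Chr) :
    signedDet q K x ((1 - mono a) * Y) = ev q K x a ^ (-rank Y) := by
  induction Y using AddMonoidAlgebra.induction_linear with
  | zero => simp [signedDet]
  | add X Y hX hY =>
    rw [mul_add, signedDet_add hq, hX, hY, map_add, neg_add, zpow_add₀ (hq.ev_ne_zero a)]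
  | single w k =>
    have h1 : rank (AddMonoidAlgebra.single w k) = k := by simp [rank]
    have h2 : (1 - mono a) * AddMonoidAlgebra.single w k + AddMonoidAlgebra.single (a + w) k =
        AddMonoidAlgebra.single w k := by
      rw [sub_mul, one_mul, mono, AddMonoidAlgebra.single_mul_single, one_mul, sub_add_cancel]
    have h3 := congrArg (signedDet q K x) h2
    rw [signedDet_add hq, signedDet_single, signedDet_single, hq.ev_add, neg_mul_eq_mul_neg,
      mul_zpow] at h3
    have h4 : (-ev q K x w) ^ k ≠ 0 := zpow_ne_zero _ (neg_ne_zero.2 (hq.ev_ne_zero w))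
    have h5 : ev q K x a ^ k ≠ 0 := zpow_ne_zero _ (hq.ev_ne_zero a)
    rw [h1, zpow_neg]
    field_simp
    apply mul_right_cancel₀ h4
    linear_combination h3

theorem signedDet_eq_one (hq : Generic q K x) {a : Weight} {Y : Chr} (hY : rank Y = 0) :
    signedDet q K x ((1 - mono a) * Y) = 1 := by
  rw [signedDet_one_sub_mono_mul hq, hY, neg_zero, zpow_zero]

/-- Factor by factor this is `(1 - w) / (1 - w⁻¹) = -w`. -/
theorem index_dualHom_sub_self_of_movable (hq : Generic q K x) {X : Chr} (h : Movable X) :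
    index q K x (dualHom X - X) = signedDet q K x X := by
  classical
  rw [index_sub hq h.dualHom h, div_eq_iff (index_ne_zero hq h)]
  have h1 : index q K x (dualHom X) = ∏ w ∈ X.coeff.support, (1 - ev q K x w) ^ X.coeff w := by
    rw [index]
    refine Finset.prod_nbij' (fun w => -w) (fun w => -w) ?_ ?_ ?_ ?_ ?_
    · intro w hw
      simpa [coeff_dualHom] using hw
    · intro w hw
      simpa [coeff_dualHom] using hw
    · simp
    · simp
    · intro w _
      rw [coeff_dualHom, hq.ev_neg]
  rw [h1, signedDet, Finsupp.prod, index, ← Finset.prod_mul_distrib]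
  refine Finset.prod_congr rfl fun w _ => ?_
  rw [← mul_zpow]
  congr 1
  have := hq.ev_ne_zero w
  field_simp
  ring

/-- Inverting the monomials of a character of vanishing rank and trivial determinant changes the
index by the sign of the constant term. -/
theorem index_dualHom_sub_self (hq : Generic q K x) {X : Chr} (hX : InBand X 0 (-1) 1)
    (hdet : signedDet q K x X = 1) : index q K x (dualHom X - X) = (-1) ^ constTerm X := by
  -- The constant term is self-dual and drops out of the difference. It still counts in the
  -- determinant, as a power of `-1`; removing it makes the previous computation applicable.
  set c : Chr := AddMonoidAlgebra.single 0 (constTerm X) with hc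
  have hdc : dualHom c = c := by
    ext w
    simp [coeff_dualHom, hc, Finsupp.single_apply, eq_comm (a := (0 : Weight))]
  have hm : Movable (X - c) := by
    refine ⟨hX.sub ?_, by simp [constTerm, hc]⟩
    intro w hw
    have : w = 0 := by
      by_contra h
      simp [hc, Ne.symm h] at hw
    subst this
    simp
  have h1 := index_dualHom_sub_self_of_movable hq hm
  rw [map_sub, hdc, sub_sub_sub_cancel_right] at h1
  rw [h1]
  have h2 := signedDet_add hq (X - c) c
  rw [sub_add_cancel, hdet, hc, signedDet_single, Generic.ev_zero] at h2
  have h3 : ((-1 : ℂ) ^ constTerm X) * (-1) ^ constTerm X = 1 := by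
    rw [← mul_zpow]
    norm_num
  have h4 : ((-1 : ℂ) ^ constTerm X) ≠ 0 := zpow_ne_zero _ (by norm_num)
  apply mul_right_cancel₀ h4
  rw [h3]
  exact h2.symm

theorem index_sub_dualHom (hq : Generic q K x) {X : Chr} (hX : InBand X 0 (-1) 1)
    (hdet : signedDet q K x X = 1) : index q K x (X - dualHom X) = (-1) ^ constTerm X := by
  have h0 : Movable (0 : Chr) := ⟨.zero, rfl⟩
  have h := Movable.dualHom_sub_self hX
  have h1 := index_sub hq h0 h
  rw [zero_sub, neg_sub, index_zero, index_dualHom_sub_self hq hX hdet] at h1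
  rw [h1, one_div, ← inv_zpow]
  norm_num

end Index

/-! ## Ordered products of layers -/

theorem P_three : P {3} = 1 - mono (wq 3) := by simp [P]

theorem P_zero_one_two :
    P {0, 1, 2} = (1 - mono (wq 0)) * ((1 - mono (wq 1)) * (1 - mono (wq 2))) := by
  rw [P, Finset.prod_insert (by decide), Finset.prod_insert (by decide), Finset.prod_singleton]

theorem mono_wq_prod : mono (wq 0) * mono (wq 1) * mono (wq 2) * mono (wq 3) = 1 := by
  rw [← mono_add, ← mono_add, ← mono_add, ← mono_zero]
  congr 1
  funext i
  fin_cases i <;> rfl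

/-- Each factor satisfies `1 - q⁻¹ = -q⁻¹ (1 - q)`, and `(q₁ q₂ q₃)⁻¹ = q₄`. -/
theorem dualHom_P_zero_one_two : dualHom (P {0, 1, 2}) = -(mono (wq 3) * P {0, 1, 2}) := by
  have h0 := mono_ne_zero_mul_neg (wq 0)
  have h1 := mono_ne_zero_mul_neg (wq 1)
  have h2 := mono_ne_zero_mul_neg (wq 2)
  have h3 := mono_wq_prod
  simp only [P_zero_one_two, map_mul, map_sub, map_one, dualHom_mono]
  set a := mono (wq 0)
  set b := mono (wq 1)
  set c := mono (wq 2)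
  set d := mono (wq 3)
  set a' := mono (-wq 0)
  set b' := mono (-wq 1)
  set c' := mono (-wq 2)
  have e1 : (1 - a') * ((1 - b') * (1 - c')) =
      a * b * c * d * ((1 - a') * ((1 - b') * (1 - c'))) := by rw [h3, one_mul]
  have ha : a * (1 - a') = -(1 - a) := by linear_combination -h0
  have hb : b * (1 - b') = -(1 - b) := by linear_combination -h1
  have hc : c * (1 - c') = -(1 - c) := by linear_combination -h2
  rw [e1, show a * b * c * d * ((1 - a') * ((1 - b') * (1 - c'))) =
    d * (a * (1 - a')) * (b * (1 - b')) * (c * (1 - c')) by ring, ha, hb, hc]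
  ring

/-- This splits `P₁₂₃₄` into a self-dual pair, matching the contraction of two layers with the two
off-diagonal terms of the D8 character. -/
theorem P_three_mul_P : P {3} * P {0, 1, 2} = P {0, 1, 2} + dualHom (P {0, 1, 2}) := by
  rw [dualHom_P_zero_one_two, P_three]
  ring

/-- The contraction of the `j`-th with the `i`-th layer relative to that of the vacuum layers, for
`i < j`: `𝕀` of this character is the scalar factor in the product of the two layers. The vacuum
modes are the quotients of `N i` and the boxes of the layers are `B i`. -/
def pairChr (N B : ℕ → Chr) (i j : ℕ) : Chr :=
  -(dualHom (P {3}) * B j * dualHom (N i)) - P {3} * N j * dualHom (B i)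
    + (P {0, 1, 2} + dualHom (P {0, 1, 2})) * B j * dualHom (B i)

theorem adams_univ (q : Fin 4 → ℂ) (n : ℤ) :
    adams q univ n = adams q {0, 1, 2} n * (1 - q 3 ^ n) := by
  simp [adams, Fin.prod_univ_four, mul_assoc]

/-- The commutator cancels the denominator of layer `i`. What remains over the denominator of layer
`j` becomes polynomial by `P₁₂₃^∨ = -q₄ P₁₂₃`, except for the product of the two vacuum numerators,
which is the vacuum contraction. -/
theorem contraction_eq {q : Fin 4 → ℂ} {K x : ℂ} (hq : Generic q K x) {N B : ℕ → Chr}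
    {Λ Λvac : ℕ → Modes}
    (hΛ : ∀ k n, n ≠ 0 → Λ k n = hq.evHom (-n) (N k - P {0, 1, 2} * B k) / adams q {0, 1, 2} (-n))
    (hΛvac : ∀ k n, n ≠ 0 → Λvac k n = hq.evHom (-n) (N k) / adams q {0, 1, 2} (-n)) (i j n : ℕ) :
    Λ j ((n : ℤ) + 1) * Λ i (-((n : ℤ) + 1)) * commutator q n =
      Λvac j ((n : ℤ) + 1) * Λvac i (-((n : ℤ) + 1)) * commutator q n -
        1 / ((n : ℂ) + 1) * ∑ w ∈ (pairChr N B i j).coeff.support,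
          ((pairChr N B i j).coeff w : ℂ) * (ev q K x w)⁻¹ ^ (n + 1) := by
  set m : ℤ := (n : ℤ) + 1 with hm
  have hm0 : m ≠ 0 := by omega
  have hsum : ∑ w ∈ (pairChr N B i j).coeff.support,
      ((pairChr N B i j).coeff w : ℂ) * (ev q K x w)⁻¹ ^ (n + 1) =
        hq.evHom (-m) (pairChr N B i j) := by
    rw [hq.evHom_apply]
    refine Finset.sum_congr rfl fun w _ => ?_
    rw [zpow_neg, ← inv_zpow]
    rfl
  have ha := hq.adams_ne_zero {0, 1, 2} hm0
  have ha' := hq.adams_ne_zero {0, 1, 2} (neg_ne_zero.2 hm0)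
  have hr : adams q {0, 1, 2} m = -((q 3 ^ (-m)) * adams q {0, 1, 2} (-m)) := by
    have := congrArg (hq.evHom (-m)) dualHom_P_zero_one_two
    rw [hq.evHom_dualHom, neg_neg, map_neg, map_mul, hq.evHom_mono, hq.ev_wq] at this
    simpa only [hq.evHom_P] using this
  have hq3 : q 3 ^ m ≠ 0 := zpow_ne_zero _ (hq.q_ne_zero 3)
  rw [hsum, hΛ j m hm0, hΛ i (-m) (neg_ne_zero.2 hm0), hΛvac j m hm0,
    hΛvac i (-m) (neg_ne_zero.2 hm0), commutator, ← hm, adams_univ, neg_neg, pairChr]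
  have hP3 : hq.evHom (-m) (P {3}) = 1 - q 3 ^ (-m) := by simp [adams]
  simp only [map_add, map_sub, map_neg, map_mul, hq.evHom_dualHom, neg_neg, hq.evHom_P]
  simp only [adams, Finset.prod_singleton] at hP3 ⊢
  -- The products unfolded by `simp` are folded back, so that they can be generalized to variables
  -- tied only by `hr`.
  change _ = _ - _ * (-((1 - q 3 ^ m) * _ * _) - (1 - q 3 ^ (-m)) * _ * _ +
    (adams q {0, 1, 2} (-m) + adams q {0, 1, 2} m) * _ * _)
  change _ / adams q {0, 1, 2} (-m) * (_ / adams q {0, 1, 2} m) * (_ * (adams q {0, 1, 2} m * _)) =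
    _ / adams q {0, 1, 2} (-m) * (_ / adams q {0, 1, 2} m) * (_ * (adams q {0, 1, 2} m * _)) - _
  change (_ - adams q {0, 1, 2} (-m) * _) / _ * ((_ - adams q {0, 1, 2} m * _) / _) * _ = _
  generalize hA : adams q {0, 1, 2} m = A at *
  generalize adams q {0, 1, 2} (-m) = A' at *
  rw [zpow_neg] at hr ⊢
  generalize q 3 ^ m = Q at *
  have hn : (n : ℂ) + 1 ≠ 0 := Nat.cast_add_one_ne_zero n
  rw [hr] at ha ⊢
  field_simp
  ring

theorem sum_mul_sum_range {R : Type*} [CommRing R] (a b : ℕ → R) (N : ℕ) :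
    (∑ j ∈ range N, a j) * ∑ j ∈ range N, b j =
      ∑ j ∈ range N, (a j * b j + ∑ i ∈ range j, (a i * b j + a j * b i)) := by
  induction N with
  | zero => simp
  | succ N ih =>
    rw [Finset.sum_range_succ, Finset.sum_range_succ, Finset.sum_range_succ, ← ih,
      Finset.sum_add_distrib, ← Finset.sum_mul, ← Finset.mul_sum]
    ring

/-- The characters of the layers and their contractions add up to the character of the whole, up to
the inversion of monomials and a remainder. -/
theorem sum_layers_eq (N B Q : ℕ → Chr) (b b' : Chr) (n : ℕ)
    (hb : P {3} * ∑ j ∈ range (n + 1), N j = b - mono ((n + 1) • wq 3) * b') :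
    ∑ j ∈ range (n + 1), (-(dualHom (P {3}) * dualHom (N j) * B j)
        + dualHom (P {0, 1, 2}) * dualHom (B j) * B j + (dualHom (Q j) - Q j))
      + ∑ j ∈ range (n + 1), ∑ i ∈ range j, pairChr N B i j =
    -(dualHom b * ∑ j ∈ range (n + 1), B j) + dualHom (P {0, 1, 2})
        * dualHom (∑ j ∈ range (n + 1), B j) * ∑ j ∈ range (n + 1), B j
      + ∑ j ∈ range (n + 1), (dualHom (Q j) - Q j)
      + ∑ j ∈ range (n + 1), ∑ i ∈ range j,
        (P {0, 1, 2} * dualHom (B i) * B j - dualHom (P {0, 1, 2} * dualHom (B i) * B j))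
      + ∑ j ∈ range (n + 1), ∑ i ∈ range j,
        (dualHom (P {3} * N j * dualHom (B i)) - P {3} * N j * dualHom (B i))
      + mono (-((n + 1) • wq 3)) * (dualHom b' * ∑ j ∈ range (n + 1), B j) := by
  -- The numerator of the infinite product is a finite sum of layer numerators up to the `q₄ ^ (n +
  -- 1)` term; the latter becomes the remainder.
  have h1 : dualHom b = dualHom (P {3}) * ∑ j ∈ range (n + 1), dualHom (N j) +
      mono (-((n + 1) • wq 3)) * dualHom b' := by
    rw [← map_sum, ← map_mul, hb, map_sub, map_mul, dualHom_mono, sub_add_cancel]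
  have h2 := sum_mul_sum_range (fun j => dualHom (N j)) B (n + 1)
  have h3 := sum_mul_sum_range (fun j => dualHom (B j)) B (n + 1)
  rw [← map_sum] at h3
  rw [h1, mul_assoc (dualHom (P {0, 1, 2})), h3, add_mul, mul_assoc (dualHom (P {3})), h2]
  -- Replacing `P₄ N_j B_i^∨` and `P₁₂₃ B_i^∨ B_j` by their duals completes the off-diagonal terms
  -- of the products of sums. The price is a difference of a character and its dual.
  have h4 : ∀ j, ∑ i ∈ range j, pairChr N B i j =
      -(dualHom (P {3}) * ∑ i ∈ range j, (dualHom (N i) * B j + dualHom (N j) * B i)) +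
      dualHom (P {0, 1, 2}) * ∑ i ∈ range j, (dualHom (B i) * B j + dualHom (B j) * B i) +
      ∑ i ∈ range j,
        (P {0, 1, 2} * dualHom (B i) * B j - dualHom (P {0, 1, 2} * dualHom (B i) * B j)) +
      ∑ i ∈ range j,
        (dualHom (P {3} * N j * dualHom (B i)) - P {3} * N j * dualHom (B i)) := by
    intro j
    rw [Finset.mul_sum, Finset.mul_sum, ← Finset.sum_neg_distrib, ← Finset.sum_add_distrib,
      ← Finset.sum_add_distrib, ← Finset.sum_add_distrib]
    refine Finset.sum_congr rfl fun i _ => ?_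
    simp only [pairChr, map_mul, dualHom_dualHom]
    ring
  simp only [h4]
  simp only [Finset.sum_add_distrib, Finset.mul_sum, Finset.sum_neg_distrib, mul_add, neg_add]
  simp only [mul_assoc]
  ring

/-! ## Regularized limits and sums -/

namespace HasRegularizedLimit

variable {Q z z' : ℂ} {u u' : ℕ → ℂ}

theorem congr (h : HasRegularizedLimit Q u z) (huu' : ∀ᶠ n in atTop, u' n = u n) :
    HasRegularizedLimit Q u' z := by
  obtain ⟨p, s, hs, hp, hN⟩ := h
  refine ⟨p, s, hs, hp, ?_⟩
  filter_upwards [hN, huu'] with n h1 h2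
  rwa [h2]

theorem const (Q z : ℂ) : HasRegularizedLimit Q (fun _ => z) z :=
  ⟨Polynomial.C z, 1, by simp, by simp, by simp⟩

theorem mul (h : HasRegularizedLimit Q u z) (h' : HasRegularizedLimit Q u' z') :
    HasRegularizedLimit Q (fun n => u n * u' n) (z * z') := by
  obtain ⟨p, s, hs, hp, hN⟩ := h
  obtain ⟨p', s', hs', hp', hN'⟩ := h'
  refine ⟨p * p', s * s', by simp [hs, hs'], ?_, ?_⟩
  · rw [Polynomial.eval_mul, Polynomial.eval_mul, hp, hp']
    ring
  · filter_upwards [hN, hN'] with n h1 h2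
    simp only [Polynomial.eval_mul]
    exact ⟨mul_ne_zero h1.1 h2.1, by rw [← h1.2, ← h2.2]; ring⟩

theorem prod {ι : Type*} {s : Finset ι} {u : ι → ℕ → ℂ}
    (h : ∀ i ∈ s, HasRegularizedLimit Q (u i) 1) :
    HasRegularizedLimit Q (fun n => ∏ i ∈ s, u i n) 1 := by
  classical
  induction s using Finset.induction_on with
  | empty => simpa using const Q 1
  | insert i s hi ih =>
    simp only [Finset.prod_insert hi]
    simpa using (h i (Finset.mem_insert_self _ _)).mul
      (ih fun j hj => h j (Finset.mem_insert_of_mem hj))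

theorem one_sub_pow_mul_zpow (a : ℂ) (k : ℤ) (h : ∀ᶠ n : ℕ in atTop, 1 - Q ^ n * a ≠ 0) :
    HasRegularizedLimit Q (fun n => (1 - Q ^ n * a) ^ k) 1 := by
  set P : Polynomial ℂ := 1 - Polynomial.C a * Polynomial.X with hP
  have hev : ∀ n : ℕ, P.eval (Q ^ n) = 1 - Q ^ n * a := fun n => by
    simp only [hP, Polynomial.eval_sub, Polynomial.eval_one, Polynomial.eval_mul, Polynomial.eval_C,
      Polynomial.eval_X]
    ring
  have hP0 : P.eval 0 = 1 := by simp [hP]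
  obtain ⟨m, rfl | rfl⟩ := k.eq_nat_or_neg
  · exact ⟨P ^ m, 1, by simp, by simp [hP0], .of_forall fun n =>
      ⟨by simp, by rw [Polynomial.eval_one, Polynomial.eval_pow, hev, mul_one]; exact zpow_natCast _ _⟩⟩
  · refine ⟨1, P ^ m, by simp [hP0], by simp [hP0], ?_⟩
    filter_upwards [h] with n hn
    simp only [Polynomial.eval_pow, Polynomial.eval_one, hev, zpow_neg, zpow_natCast]
    exact ⟨pow_ne_zero _ hn, inv_mul_cancel₀ (pow_ne_zero _ hn)⟩

theorem tendsto (h : HasRegularizedLimit Q u z) (hQ : ‖Q‖ < 1) : Tendsto u atTop (𝓝 z) := by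
  obtain ⟨p, s, hs, hp, hN⟩ := h
  have h0 : Tendsto (fun n : ℕ => Q ^ n) atTop (𝓝 0) := tendsto_pow_atTop_nhds_zero_of_norm_lt_one hQ
  have h1 := ((p.continuous.tendsto 0).comp h0).div ((s.continuous.tendsto 0).comp h0) hs
  rw [hp, mul_div_cancel_right₀ _ hs] at h1
  refine h1.congr' ?_
  filter_upwards [hN] with n hn
  change p.eval (Q ^ n) / s.eval (Q ^ n) = u n
  rw [← hn.2]
  exact mul_div_cancel_right₀ _ hn.1

end HasRegularizedLimit

/-- The tail is a rational function with denominator `1 - Q t`, regular at `t = 1` for every `Q ≠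
1`, whatever the size of `Q`. -/
theorem hasRegularizedSum_of_geometric {u : ℕ → ℂ} {c Q : ℂ} (hQ : Q ≠ 1) (n : ℕ)
    (hu : ∀ k, n < k → u k = c * Q ^ k) :
    HasRegularizedSum u (∑ k ∈ range (n + 1), u k + c * Q ^ (n + 1) / (1 - Q)) := by
  have hQ' : 1 - Q ≠ 0 := sub_ne_zero.2 hQ.symm
  set p : Polynomial ℂ := ∑ k ∈ range (n + 1), Polynomial.C (u k) * Polynomial.X ^ k with hp
  set s : Polynomial ℂ := 1 - Polynomial.C Q * Polynomial.X with hs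
  have hs1 : s.eval 1 = 1 - Q := by simp [hs]
  have hp1 : p.eval 1 = ∑ k ∈ range (n + 1), u k := by simp [hp, Polynomial.eval_finsetSum]
  refine ⟨s * p + Polynomial.C (c * Q ^ (n + 1)) * Polynomial.X ^ (n + 1), s, ?_, ?_, ?_⟩
  · rwa [hs1]
  · rw [mul_one]
    push_cast
    have h1 : PowerSeries.mk u = (p : PowerSeries ℂ) +
        PowerSeries.X ^ (n + 1) * PowerSeries.mk fun k => c * Q ^ (k + (n + 1)) := by
      ext k
      rw [map_add, PowerSeries.coeff_mk, Polynomial.coeff_coe, PowerSeries.coeff_X_pow_mul', hp,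
        Polynomial.finsetSum_coeff]
      simp only [Polynomial.coeff_C_mul_X_pow]
      rw [Finset.sum_ite_eq]
      by_cases hk : k ≤ n
      · rw [if_pos (mem_range.2 (by omega)), if_neg (by omega), add_zero]
      · rw [if_neg (by simpa using hk), if_pos (by omega), PowerSeries.coeff_mk,
          Nat.sub_add_cancel (by omega), hu k (by omega), zero_add]
    have h2 : (s : PowerSeries ℂ) * (PowerSeries.mk fun k => c * Q ^ (k + (n + 1))) =
        PowerSeries.C (c * Q ^ (n + 1)) := by
      rw [hs]
      push_cast
      ext k
      rw [sub_mul, one_mul, map_sub, mul_assoc, PowerSeries.coeff_C_mul]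
      rcases k with _ | k
      · simp
      · rw [PowerSeries.coeff_succ_X_mul]
        simp only [PowerSeries.coeff_mk, PowerSeries.coeff_C]
        rw [if_neg (by omega)]
        ring
    rw [h1, mul_add, mul_left_comm, h2]
    ring
  · simp only [Polynomial.eval_add, Polynomial.eval_mul, hp1, hs1]
    simp
    field_simp

theorem HasRegularizedSum.add_finite {u u' : ℕ → ℂ} {v : ℂ} (h : HasRegularizedSum u v) (n : ℕ)
    (hu : ∀ k, n ≤ k → u' k = 0) :
    HasRegularizedSum (fun k => u k + u' k) (v + ∑ k ∈ range n, u' k) := by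
  obtain ⟨p, s, hs, h1, hp⟩ := h
  set r : Polynomial ℂ := ∑ k ∈ range n, Polynomial.C (u' k) * Polynomial.X ^ k with hr
  refine ⟨p + s * r, s, hs, ?_, ?_⟩
  · have h2 : PowerSeries.mk (fun k => u k + u' k) = PowerSeries.mk u + (r : PowerSeries ℂ) := by
      ext k
      rw [map_add, PowerSeries.coeff_mk, PowerSeries.coeff_mk, Polynomial.coeff_coe, hr,
        Polynomial.finsetSum_coeff]
      simp only [Polynomial.coeff_C_mul_X_pow]
      rw [Finset.sum_ite_eq]
      by_cases hk : k < n
      · rw [if_pos (mem_range.2 hk)]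
      · rw [if_neg (by simpa using hk), hu k (by omega)]
    rw [h2, mul_add, h1]
    push_cast
    ring
  · rw [Polynomial.eval_add, Polynomial.eval_mul, hp, hr, Polynomial.eval_finsetSum]
    simp
    ring

theorem HasRegularizedSum.const_mul {u : ℕ → ℂ} {v : ℂ} (h : HasRegularizedSum u v) (c : ℂ) :
    HasRegularizedSum (fun k => c * u k) (c * v) := by
  obtain ⟨p, s, hs, h1, hp⟩ := h
  refine ⟨Polynomial.C c * p, s, hs, ?_, ?_⟩
  · have h2 : PowerSeries.mk (fun k => c * u k) = PowerSeries.C c * PowerSeries.mk u := by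
      ext k
      simp
    rw [h2, mul_left_comm, h1]
    push_cast
    ring
  · rw [Polynomial.eval_mul, Polynomial.eval_C, hp, mul_assoc]

/-! ## The remainder -/

section Remainder

variable {q : Fin 4 → ℂ} {K x : ℂ}

/-- The support of `C` is finite, while the weights `(n + 1) • wq 3` leave every finite set. -/
theorem eventually_movable_remainder {C : Chr} (hC : InBand C 0 (-1) 1) :
    ∀ᶠ n : ℕ in atTop, Movable (mono (-((n + 1) • wq 3)) * C) := by
  have h1 : ∀ᶠ n : ℕ in atTop, ∀ w ∈ C.coeff.support, w ≠ (n + 1) • wq 3 := by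
    rw [Filter.eventually_all_finset]
    intro w _
    -- The coordinate of `(n + 1) • wq 3` at `q₁` is `-(n + 1)`, which is smaller than `w 0` for
    -- these `n`.
    filter_upwards [eventually_ge_atTop (w 0).natAbs] with n hn h
    have h0 := congrFun h 0
    simp [wq] at h0
    omega
  filter_upwards [h1] with n hn
  constructor
  · have h3 : (-((n + 1) • wq 3)) 3 = 0 := by simp [wq_apply_three]
    have h4 : (-((n + 1) • wq 3)) 4 = 0 := by simp [wq_apply_four]
    simpa using (InBand.of_mono h4 h3.ge h3.le).mul hC
  · rw [constTerm, coeff_mono_mul, sub_neg_eq_add, zero_add]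
    by_contra h
    exact hn _ (Finsupp.mem_support_iff.2 h) rfl

theorem ev_nsmul_wq_three (hq : Generic q K x) (n : ℕ) : ev q K x (n • wq 3) = q 3 ^ n := by
  induction n with
  | zero => simp [Generic.ev_zero]
  | succ n ih => rw [succ_nsmul, hq.ev_add, ih, hq.ev_wq, pow_succ]

theorem ev_remainder (hq : Generic q K x) (w : Weight) (n : ℕ) :
    (ev q K x (-((n + 1) • wq 3) + w))⁻¹ = q 3 ^ n * (q 3 * (ev q K x w)⁻¹) := by
  rw [hq.ev_add, hq.ev_neg, ev_nsmul_wq_three hq, mul_inv, inv_inv]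
  ring

theorem index_remainder (hq : Generic q K x) (C : Chr) (n : ℕ) :
    index q K x (mono (-((n + 1) • wq 3)) * C) =
      ∏ w ∈ C.coeff.support, (1 - q 3 ^ n * (q 3 * (ev q K x w)⁻¹)) ^ C.coeff w := by
  rw [index]
  refine Finset.prod_nbij' (fun w => w + (n + 1) • wq 3) (fun w => -((n + 1) • wq 3) + w)
    ?_ ?_ ?_ ?_ ?_
  · intro w hw
    rw [Finsupp.mem_support_iff, coeff_mono_mul, sub_neg_eq_add] at hw
    exact Finsupp.mem_support_iff.2 hw
  · intro w hw
    rw [Finsupp.mem_support_iff, coeff_mono_mul, sub_neg_eq_add, neg_add_cancel_comm]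
    exact Finsupp.mem_support_iff.1 hw
  · intro w _
    abel
  · intro w _
    abel
  · intro w _
    rw [coeff_mono_mul, sub_neg_eq_add, ← ev_remainder hq,
      show -((n + 1) • wq 3) + (w + (n + 1) • wq 3) = w by abel]

/-- Every factor is a power of `1 - a Q ^ n`, a rational function of `Q ^ n` with value `1` at `0`.
Negative powers are admissible because the remainder is eventually movable. -/
theorem hasRegularizedLimit_remainder (hq : Generic q K x) {C : Chr} (hC : InBand C 0 (-1) 1) :
    HasRegularizedLimit (q 3) (fun n => index q K x (mono (-((n + 1) • wq 3)) * C)) 1 := by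
  simp only [index_remainder hq]
  refine HasRegularizedLimit.prod fun w hw => HasRegularizedLimit.one_sub_pow_mul_zpow _ _ ?_
  filter_upwards [eventually_movable_remainder hC] with n hn
  rw [← ev_remainder hq]
  refine index_factor_ne_zero hq hn ?_
  rw [Finsupp.mem_support_iff, coeff_mono_mul, add_sub_cancel_left]
  exact Finsupp.mem_support_iff.1 hw

end Remainder

/-! ### Gluing of layers with given characters. -/

section Layers

variable {q : Fin 4 → ℂ} {K x : ℂ} {N B : ℕ → Chr}

theorem inBand_mul_dualHom {X Y : Chr} (hX : InBand X 1 0 1) (hY : InBand Y 1 0 1)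
    {Z : Chr} (hZ : InBand Z 0 0 0) : InBand (Z * X * dualHom Y) 0 (-1) 1 := by
  simpa using (hZ.mul hX).mul hY.dualHom

/-- Each summand contains at most one vacuum numerator, the only source of `K`; the product of two
belongs to the vacuum contraction and has been divided out. -/
theorem inBand_pairChr (hN : ∀ k, InBand (N k) 1 0 1) (hB : ∀ k, InBand (B k) 1 0 0) (i j : ℕ) :
    InBand (pairChr N B i j) 0 (-1) 1 := by
  have hB' : ∀ k, InBand (B k) 1 0 1 := fun k => (hB k).mono' le_rfl zero_le_one
  have hd : ∀ S, InBand (dualHom (P S)) 0 0 0 := fun S => by simpa using (inBand_P S).dualHom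
  exact ((inBand_mul_dualHom (hB' j) (hN i) (hd _)).neg.sub
    (inBand_mul_dualHom (hN j) (hB' i) (inBand_P _))).add
    (inBand_mul_dualHom (hB' j) (hB' i) ((inBand_P _).add (hd _)))

/-- The hypothesis makes the support finite, so the `finsum` is a genuine sum and not its default
value `0`. -/
theorem constTermSum_eq_sum {f : ℕ → ℕ → Chr} {n : ℕ}
    (hf : ∀ i j, i < j → n ≤ j → constTerm (f i j) = 0) :
    constTermSum f = ∑ j ∈ range n, ∑ i ∈ range j, constTerm (f i j) := by
  rw [constTermSum, Finset.sum_sigma',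
    finsum_mem_eq_sum_of_inter_support_eq
      (t := ((range n).sigma fun j => range j).image fun p => (p.2, p.1))]
  · rw [Finset.sum_image]
    rintro ⟨a, b⟩ _ ⟨a', b'⟩ _ h
    simp only [Prod.mk.injEq] at h
    simp [h.1, h.2]
  · ext ⟨i, j⟩
    simp only [Set.mem_inter_iff, Set.mem_ofPred_eq, Function.mem_support, coe_image,
      Set.mem_image, mem_coe, Finset.mem_sigma, mem_range, Sigma.exists, Prod.mk.injEq]
    constructor
    · rintro ⟨hij, h⟩
      refine ⟨⟨j, i, ⟨?_, hij⟩, rfl, rfl⟩, h⟩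
      by_contra hj
      exact h (hf i j hij (not_lt.1 hj))
    · rintro ⟨⟨a, b, ⟨_, hab⟩, rfl, rfl⟩, h⟩
      exact ⟨hab, h⟩

theorem neg_one_zpow_sum {ι : Type*} (s : Finset ι) (k : ι → ℤ) :
    ((-1 : ℂ)) ^ (∑ i ∈ s, k i) = ∏ i ∈ s, (-1 : ℂ) ^ k i := by
  classical
  induction s using Finset.induction_on with
  | empty => simp
  | insert i s hi ih =>
    rw [Finset.sum_insert hi, Finset.prod_insert hi, zpow_add₀ (by norm_num), ih]

/-- Beyond the last box the layers are purely geometric. The regularized tail cancels the `q₄ ^ (n +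
1)` term in the telescoped sum, and the factor `1 - q₄ ^ (-n)` completes the denominator `P₁₂₃` to
`P₁₂₃₄`. -/
theorem hasRegularizedSum_modes (hq : Generic q K x) {b b' : Chr} {n₀ : ℕ} {Λ : ℕ → Modes}
    (hB0 : ∀ k, n₀ ≤ k → B k = 0)
    (hb : ∀ n, n₀ ≤ n →
      P {3} * ∑ j ∈ range (n + 1), N j = b - mono ((n + 1) • wq 3) * b')
    (hΛ : ∀ k n, n ≠ 0 → Λ k n = hq.evHom (-n) (N k - P {0, 1, 2} * B k) / adams q {0, 1, 2} (-n))
    {n : ℤ} (hn : n ≠ 0) :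
    HasRegularizedSum (fun k => Λ k n)
      (hq.evHom (-n) (b - P univ * ∑ j ∈ range n₀, B j) / adams q univ (-n)) := by
  set e := hq.evHom (-n) with he
  have ha := hq.adams_ne_zero {0, 1, 2} (neg_ne_zero.2 hn)
  have hu := hq.adams_ne_zero univ (neg_ne_zero.2 hn)
  set Qn : ℂ := q 3 ^ (-n) with hQn
  have hP3 : e (P {3}) = 1 - Qn := by simp [he, adams, hQn]
  have hQ1 : 1 - Qn ≠ 0 := by
    rw [adams_univ] at hu
    exact right_ne_zero_of_mul hu
  have hm : ∀ k : ℕ, e (mono (k • wq 3)) = Qn ^ k := fun k => by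
    rw [mono_nsmul, map_pow, hq.evHom_mono, hq.ev_wq]
  have hsum : ∀ k, n₀ ≤ k → (1 - Qn) * ∑ j ∈ range (k + 1), e (N j) = e b - Qn ^ (k + 1) * e b' := by
    intro k hk
    have := congrArg e (hb k hk)
    rwa [map_mul, hP3, map_sum, map_sub, map_mul, hm] at this
  -- Subtracting the telescoping identities for two consecutive `n` isolates a single layer.
  have htail : ∀ k, n₀ < k → e (N k) = e b' * Qn ^ k := by
    intro k hk
    obtain ⟨l, rfl⟩ : ∃ l, k = l + 1 := ⟨k - 1, by omega⟩
    have h1 := hsum (l + 1) (by omega)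
    rw [Finset.sum_range_succ, mul_add, hsum l (by omega)] at h1
    apply mul_left_cancel₀ hQ1
    linear_combination h1
  have h1 := hasRegularizedSum_of_geometric (sub_ne_zero.1 hQ1).symm n₀ htail
  have h2 : ∑ k ∈ range (n₀ + 1), e (N k) + e b' * Qn ^ (n₀ + 1) / (1 - Qn) = e b / (1 - Qn) := by
    have := hsum n₀ le_rfl
    field_simp
    linear_combination this
  rw [h2] at h1
  have h3 := (h1.add_finite (u' := fun k => -(adams q {0, 1, 2} (-n) * e (B k))) n₀
    fun k hk => by simp [hB0 k hk]).const_mul (adams q {0, 1, 2} (-n))⁻¹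
  convert h3 using 1
  · funext k
    rw [hΛ k n hn, ← he, map_sub, map_mul, he, hq.evHom_P]
    field_simp
    ring
  · rw [map_sub, map_mul, map_sum, Finset.sum_neg_distrib, ← Finset.mul_sum, he, hq.evHom_P,
      adams_univ, ← hQn]
    field_simp
    ring

/-- The ordered product of layers, given the characters of the layers. -/
theorem reproduces_of_layers (hq : Generic q K x) {Q X Xvac : ℕ → Chr} {b b' D : Chr} {n₀ : ℕ}
    {Λ Λvac : ℕ → Modes} {Λlim : Modes} {f : ℕ → ℕ → Chr}
    (hN : ∀ k, InBand (N k) 1 0 1) (hNrank : ∀ k, rank (N k) = 0)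
    (hB : ∀ k, InBand (B k) 1 0 0) (hB0 : ∀ k, n₀ ≤ k → B k = 0) (hb' : InBand b' 1 0 1)
    (hb : ∀ n, n₀ ≤ n →
      P {3} * ∑ j ∈ range (n + 1), N j = b - mono ((n + 1) • wq 3) * b')
    (hΛ : ∀ k n, n ≠ 0 → Λ k n = hq.evHom (-n) (N k - P {0, 1, 2} * B k) / adams q {0, 1, 2} (-n))
    (hΛvac : ∀ k n, n ≠ 0 → Λvac k n = hq.evHom (-n) (N k) / adams q {0, 1, 2} (-n))
    (hX : ∀ k, Movable (X k)) (hXvac : ∀ k, Movable (Xvac k))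
    (hXX : ∀ k, X k - Xvac k = -(dualHom (P {3}) * dualHom (N k) * B k)
        + dualHom (P {0, 1, 2}) * dualHom (B k) * B k + (dualHom (Q k) - Q k))
    (hQ : ∀ k, InBand (Q k) 0 (-1) 1) (hQdet : ∀ k, signedDet q K x (Q k) = 1)
    (hQ0 : ∀ k, constTerm (Q k) = 0)
    (hpair : ∀ i j, i < j → constTerm (pairChr N B i j) = 0)
    (hT : ∀ i j, i < j → constTerm (P {3} * N j * dualHom (B i)) = 0)
    (hf : ∀ i j, i < j → constTerm (f i j) = constTerm (P {0, 1, 2} * dualHom (B i) * B j))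
    (hD : D = -(dualHom b * ∑ j ∈ range n₀, B j) +
      dualHom (P {0, 1, 2}) * dualHom (∑ j ∈ range n₀, B j) * ∑ j ∈ range n₀, B j)
    (hΛlim : ∀ n, n ≠ 0 → Λlim n =
      hq.evHom (-n) (b - P univ * ∑ j ∈ range n₀, B j) / adams q univ (-n)) :
    Reproduces q (fun k => index q K x (X k)) (fun k => index q K x (Xvac k)) Λ Λvac
      ((-1) ^ constTermSum f * index q K x D) Λlim := by
  have hB' : ∀ k, InBand (B k) 1 0 1 := fun k => (hB k).mono' le_rfl zero_le_one
  have hM : ∀ i j, i < j → Movable (pairChr N B i j) := fun i j hij =>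
    ⟨inBand_pairChr hN hB i j, hpair i j hij⟩
  have hZ : ∀ i j, InBand (P {0, 1, 2} * dualHom (B i) * B j) 0 (-1) 1 := fun i j => by
    rw [mul_right_comm]
    exact inBand_mul_dualHom (hB' j) (hB' i) (inBand_P _)
  have hTband : ∀ i j, InBand (P {3} * N j * dualHom (B i)) 0 (-1) 1 := fun i j =>
    inBand_mul_dualHom (hN j) (hB' i) (inBand_P _)
  set C : Chr := dualHom b' * ∑ j ∈ range n₀, B j with hC
  have hCband : InBand C 0 (-1) 1 := by
    have := hb'.dualHom.mul (InBand.sum (s := range n₀) fun j _ => hB j)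
    exact InBand.mono' (by simpa using this) le_rfl zero_le_one
  have hsumB : ∀ n, n₀ ≤ n → ∑ j ∈ range n, B j = ∑ j ∈ range n₀, B j := fun n hn =>
    Finset.eventually_constant_sum hB0 hn
  have hprod : ∀ n, ∏ k ∈ range (n + 1), index q K x (X k) / index q K x (Xvac k) =
      index q K x (∑ k ∈ range (n + 1), (X k - Xvac k)) := fun n => by
    rw [index_sum hq fun k _ => (hX k).sub (hXvac k)]
    exact Finset.prod_congr rfl fun k _ => (index_sub hq (hX k) (hXvac k)).symm
  have hR : ∀ n, ∏ j ∈ range (n + 1), ∏ i ∈ range j, index q K x (pairChr N B i j) =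
      index q K x (∑ j ∈ range (n + 1), ∑ i ∈ range j, pairChr N B i j) := fun n => by
    rw [index_sum hq fun j _ => .sum fun i hi => hM i j (mem_range.1 hi)]
    exact Finset.prod_congr rfl fun j _ =>
      (index_sum hq fun i hi => hM i j (mem_range.1 hi)).symm
  have hMQ : ∀ n, Movable (∑ j ∈ range (n + 1), (dualHom (Q j) - Q j)) := fun n =>
    .sum fun j _ => Movable.dualHom_sub_self (hQ j)
  have hMT : ∀ n, Movable (∑ j ∈ range (n + 1), ∑ i ∈ range j,
      (dualHom (P {3} * N j * dualHom (B i)) - P {3} * N j * dualHom (B i))) := fun n =>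
    .sum fun j _ => .sum fun i _ => Movable.dualHom_sub_self (hTband i j)
  have hMZ' : ∀ i j, Movable (P {0, 1, 2} * dualHom (B i) * B j -
      dualHom (P {0, 1, 2} * dualHom (B i) * B j)) := fun i j => by
    simpa using Movable.dualHom_sub_self (X := dualHom (P {0, 1, 2} * dualHom (B i) * B j))
      (by simpa using (hZ i j).dualHom)
  have hMZ : ∀ n, Movable (∑ j ∈ range (n + 1), ∑ i ∈ range j,
      (P {0, 1, 2} * dualHom (B i) * B j - dualHom (P {0, 1, 2} * dualHom (B i) * B j))) := fun n =>
    .sum fun j _ => .sum fun i _ => hMZ' i j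
  have hIQ : ∀ n, index q K x (∑ j ∈ range (n + 1), (dualHom (Q j) - Q j)) = 1 := fun n => by
    rw [index_sum hq fun j _ => Movable.dualHom_sub_self (hQ j)]
    exact Finset.prod_eq_one fun j _ => by
      rw [index_dualHom_sub_self hq (hQ j) (hQdet j), hQ0, zpow_zero]
  have hIT : ∀ n, index q K x (∑ j ∈ range (n + 1), ∑ i ∈ range j,
      (dualHom (P {3} * N j * dualHom (B i)) - P {3} * N j * dualHom (B i))) = 1 := fun n => by
    rw [index_sum hq fun j _ => .sum fun i _ => Movable.dualHom_sub_self (hTband i j)]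
    refine Finset.prod_eq_one fun j _ => ?_
    rw [index_sum hq fun i _ => Movable.dualHom_sub_self (hTband i j)]
    refine Finset.prod_eq_one fun i hi => ?_
    rw [index_dualHom_sub_self hq (hTband i j), hT i j (mem_range.1 hi), zpow_zero]
    rw [P_three, mul_assoc]
    exact signedDet_eq_one hq (by rw [map_mul, hNrank, zero_mul])
  -- These are the only differences whose constant terms need not vanish; they carry the whole sign.
  have hIZ : ∀ n, n₀ ≤ n → index q K x (∑ j ∈ range (n + 1), ∑ i ∈ range j,
      (P {0, 1, 2} * dualHom (B i) * B j - dualHom (P {0, 1, 2} * dualHom (B i) * B j))) =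
        (-1) ^ constTermSum f := fun n hn => by
    rw [index_sum hq fun j _ => .sum fun i _ => hMZ' i j, constTermSum_eq_sum (n := n + 1)]
    · rw [neg_one_zpow_sum]
      refine Finset.prod_congr rfl fun j _ => ?_
      rw [neg_one_zpow_sum, index_sum hq fun i _ => hMZ' i j]
      refine Finset.prod_congr rfl fun i hi => ?_
      rw [hf i j (mem_range.1 hi), index_sub_dualHom hq (hZ i j)]
      rw [P_zero_one_two, mul_assoc, mul_assoc]
      exact signedDet_eq_one hq (by
        rw [map_mul, map_mul, map_sub, map_one, rank_mono, sub_self, zero_mul, zero_mul])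
    · intro i j hij hj
      rw [hf i j hij, hB0 j (by omega), mul_zero]
      rfl
  have hsum : ∀ n, n₀ ≤ n → ∑ k ∈ range (n + 1), (X k - Xvac k) +
      ∑ j ∈ range (n + 1), ∑ i ∈ range j, pairChr N B i j =
      D + ∑ j ∈ range (n + 1), (dualHom (Q j) - Q j)
      + ∑ j ∈ range (n + 1), ∑ i ∈ range j,
        (P {0, 1, 2} * dualHom (B i) * B j - dualHom (P {0, 1, 2} * dualHom (B i) * B j))
      + ∑ j ∈ range (n + 1), ∑ i ∈ range j,
        (dualHom (P {3} * N j * dualHom (B i)) - P {3} * N j * dualHom (B i))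
      + mono (-((n + 1) • wq 3)) * C := fun n hn => by
    simp only [hXX]
    rw [sum_layers_eq N B Q b b' n (hb n hn), hsumB (n + 1) (by omega), hD]
  have hMX : ∀ n, Movable (∑ k ∈ range (n + 1), (X k - Xvac k)) := fun n =>
    .sum fun k _ => (hX k).sub (hXvac k)
  have hMM : ∀ n, Movable (∑ j ∈ range (n + 1), ∑ i ∈ range j, pairChr N B i j) := fun n =>
    .sum fun j _ => .sum fun i hi => hM i j (mem_range.1 hi)
  have hrem := eventually_movable_remainder hCband
  -- In the identity for one large `n` every other term is movable, hence so is the D8 character.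
  have hMD : Movable D := by
    obtain ⟨n, h1, h2⟩ := (hrem.and (eventually_ge_atTop n₀)).exists
    have h3 := ((((hMX n).add (hMM n)).sub h1).sub (hMT n)).sub (hMZ n) |>.sub (hMQ n)
    rw [hsum n h2] at h3
    convert h3 using 1
    abel
  have hlim : HasRegularizedLimit (q 3)
      (fun n => (∏ k ∈ range (n + 1), index q K x (X k) / index q K x (Xvac k)) *
        ∏ j ∈ range (n + 1), ∏ i ∈ range j, index q K x (pairChr N B i j))
      ((-1) ^ constTermSum f * index q K x D) := by
    have h1 := (HasRegularizedLimit.const (q 3) ((-1) ^ constTermSum f * index q K x D)).mul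
      (hasRegularizedLimit_remainder hq hCband)
    rw [mul_one] at h1
    refine h1.congr ?_
    filter_upwards [hrem, eventually_ge_atTop n₀] with n h2 h3
    rw [hprod, hR, ← index_add hq (hMX n) (hMM n), hsum n h3,
      index_add hq (((hMD.add (hMQ n)).add (hMZ n)).add (hMT n)) h2,
      index_add hq ((hMD.add (hMQ n)).add (hMZ n)) (hMT n),
      index_add hq (hMD.add (hMQ n)) (hMZ n), index_add hq hMD (hMQ n), hIQ, hIT, hIZ n h3]
    ring
  refine ⟨fun k => index_ne_zero hq (hXvac k),
    fun n => ∏ j ∈ range (n + 1), ∏ i ∈ range j, index q K x (pairChr N B i j), ?_, hlim,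
    hlim.tendsto, ?_⟩
  · refine hasContinuedRatio_orderedProd q Λ Λvac (fun w => (ev q K x w)⁻¹)
      (fun i j => (pairChr N B i j).coeff.support) (fun i j => (pairChr N B i j).coeff) ?_ ?_
    · intro i j hij w hw
      rw [Ne, inv_eq_one]
      exact (hM i j hij).ev_ne_one hq hw
    · intro i j _ n
      exact contraction_eq hq hΛ hΛvac i j n
  · intro n hn
    rw [hΛlim n hn]
    exact hasRegularizedSum_modes hq hB0 hb hΛ hn

end Layers

/-! ## Constant terms -/

/-- The weight of `q₁ ^ a q₂ ^ b q₃ ^ c`. -/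
def pt (a b c : ℤ) : Weight := ![a, b, c, 0, 0]

/-- The coefficient of a character at the point `(a, b, c)` of the `k`-th layer. -/
def layerCoeff (X : Chr) (k : ℕ) (a b c : ℤ) : ℤ := X.coeff (wx + pt (a - k) (b - k) (c - k))

open Classical in
/-- The indicator function of a set of lattice points. -/
def ind (I : ℤ → ℤ → ℤ → Prop) (a b c : ℤ) : ℤ := if I a b c then 1 else 0

theorem ind_congr {I I' : ℤ → ℤ → ℤ → Prop} {a b c a' b' c' : ℤ} (h : I a b c ↔ I' a' b' c') :
    ind I a b c = ind I' a' b' c' := by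
  rw [ind, ind, propext h]

/-- The mixed backward difference in three directions. -/
def diff (f : ℤ → ℤ → ℤ → ℤ) (a b c : ℤ) : ℤ :=
  f a b c - f (a - 1) b c - f a (b - 1) c - f a b (c - 1) + f (a - 1) (b - 1) c
    + f (a - 1) b (c - 1) + f a (b - 1) (c - 1) - f (a - 1) (b - 1) (c - 1)

theorem wq_eq_pt : wq 0 = pt 1 0 0 ∧ wq 1 = pt 0 1 0 ∧ wq 2 = pt 0 0 1 ∧ wq 3 = pt (-1) (-1) (-1) :=
  ⟨rfl, rfl, rfl, rfl⟩

theorem pt_add (a b c a' b' c' : ℤ) : pt a b c + pt a' b' c' = pt (a + a') (b + b') (c + c') := by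
  funext i
  fin_cases i <;> simp [pt]

theorem pt_neg (a b c : ℤ) : -pt a b c = pt (-a) (-b) (-c) := by
  funext i
  fin_cases i <;> simp [pt]

theorem pt_sub (a b c a' b' c' : ℤ) : pt a b c - pt a' b' c' = pt (a - a') (b - b') (c - c') := by
  rw [sub_eq_add_neg, pt_neg, pt_add]
  rfl

theorem nsmul_pt (n : ℕ) (a b c : ℤ) : n • pt a b c = pt (n * a) (n * b) (n * c) := by
  funext i
  fin_cases i <;> simp [pt]

theorem pt_inj {a b c a' b' c' : ℤ} : pt a b c = pt a' b' c' ↔ a = a' ∧ b = b' ∧ c = c' := by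
  constructor
  · intro h
    exact ⟨congrFun h 0, congrFun h 1, congrFun h 2⟩
  · rintro ⟨rfl, rfl, rfl⟩
    rfl

theorem wlayer_eq (k : ℕ) : wlayer k = wx + pt (-k) (-k) (-k) := by
  rw [wlayer, wq_eq_pt.2.2.2, nsmul_pt]
  simp

theorem wbox_eq (y : Weight) (b : Box) :
    wbox y b = y + pt ((b 0 : ℤ) - b 3) ((b 1 : ℤ) - b 3) ((b 2 : ℤ) - b 3) := by
  rw [wbox, Fin.sum_univ_four, wq_eq_pt.1, wq_eq_pt.2.1, wq_eq_pt.2.2.1, wq_eq_pt.2.2.2]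
  simp only [nsmul_pt, pt_add]
  congr 2 <;> ring

theorem wbox_wlayer {k : ℕ} {b : Box} (hb : b 3 = 0) :
    wbox (wlayer k) b = wx + pt ((b 0 : ℤ) - k) ((b 1 : ℤ) - k) ((b 2 : ℤ) - k) := by
  rw [wbox_eq, hb, wlayer_eq, add_assoc, pt_add]
  congr 2 <;> push_cast <;> ring

theorem coeff_one_sub_mono_mul (a : Weight) (X : Chr) (w : Weight) :
    ((1 - mono a) * X).coeff w = X.coeff w - X.coeff (w - a) := by
  rw [sub_mul, one_mul, AddMonoidAlgebra.coeff_sub, Finsupp.sub_apply, coeff_mono_mul]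

theorem layerCoeff_P_mul (X : Chr) (k : ℕ) (a b c : ℤ) :
    layerCoeff (P {0, 1, 2} * X) k a b c = diff (layerCoeff X k) a b c := by
  simp only [P_zero_one_two, mul_assoc, layerCoeff, coeff_one_sub_mono_mul, wq_eq_pt.1,
    wq_eq_pt.2.1, wq_eq_pt.2.2.1, add_sub_assoc, pt_sub, diff, sub_zero]
  simp only [sub_right_comm]
  ring

theorem layerCoeff_P_zero_one_mul (X : Chr) (k : ℕ) (a b c : ℤ) :
    layerCoeff (P {0, 1} * X) k a b c = layerCoeff X k a b c - layerCoeff X k (a - 1) b c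
      - layerCoeff X k a (b - 1) c + layerCoeff X k (a - 1) (b - 1) c := by
  have h : P {0, 1} = (1 - mono (wq 0)) * (1 - mono (wq 1)) := by
    rw [P, Finset.prod_insert (by decide), Finset.prod_singleton]
  simp only [h, mul_assoc, layerCoeff, coeff_one_sub_mono_mul, wq_eq_pt.1,
    wq_eq_pt.2.1, add_sub_assoc, pt_sub, sub_zero]
  simp only [sub_right_comm]
  ring

theorem layerCoeff_sub (X Y : Chr) (k : ℕ) (a b c : ℤ) :
    layerCoeff (X - Y) k a b c = layerCoeff X k a b c - layerCoeff Y k a b c := rfl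

/-- The part of degree zero in `K` of the character `X` is `P₁₂₃` times the formal character of the
points of the set `I` in the `k`-th layer. -/
def HasIdeal (X : Chr) (k : ℕ) (I : ℤ → ℤ → ℤ → Prop) : Prop :=
  ∀ a b c, layerCoeff X k a b c = diff (ind I) a b c

/-- The mixed difference reads only the eight corners of the unit cube whose top corner is `(a, b,
c)`. -/
theorem diff_ind_eq_zero_of_forall_not {I : ℤ → ℤ → ℤ → Prop} {a b c : ℤ}
    (h : ∀ a' b' c', a' ≤ a → b' ≤ b → c' ≤ c → ¬ I a' b' c') : diff (ind I) a b c = 0 := by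
  simp [diff, ind, h]

theorem diff_ind_eq_zero_of_forall {I : ℤ → ℤ → ℤ → Prop} {a b c : ℤ}
    (h : ∀ a' b' c', a - 1 ≤ a' → b - 1 ≤ b' → c - 1 ≤ c' → I a' b' c') :
    diff (ind I) a b c = 0 := by
  simp [diff, ind, h]

/-- The points `(a, b, c)` with `(a, b, c, 0) ∈ s`. -/
def MemBoxes (s : Finset Box) (a b c : ℤ) : Prop :=
  ∃ v ∈ s, (v 0 : ℤ) = a ∧ (v 1 : ℤ) = b ∧ (v 2 : ℤ) = c

theorem layerCoeff_chr {s : Finset Box} (hs : ∀ b ∈ s, b 3 = 0) (k : ℕ) (a b c : ℤ) :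
    layerCoeff (chr (wlayer k) s) k a b c = ind (MemBoxes s) a b c := by
  have h1 : layerCoeff (chr (wlayer k) s) k a b c =
      ∑ v ∈ s, if (v 0 : ℤ) = a ∧ (v 1 : ℤ) = b ∧ (v 2 : ℤ) = c then 1 else 0 := by
    rw [layerCoeff, chr, AddMonoidAlgebra.coeff_sum, Finset.sum_apply']
    refine Finset.sum_congr rfl fun v hv => ?_
    rw [coeff_mono, wbox_wlayer (hs v hv)]
    simp only [add_right_inj, pt_inj, sub_left_inj]
  rw [h1, ind]
  split_ifs with h
  · obtain ⟨v, hv, h0, h1, h2⟩ := h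
    rw [Finset.sum_eq_single_of_mem v hv, if_pos ⟨h0, h1, h2⟩]
    intro w hw hne
    rw [if_neg]
    rintro ⟨h0', h1', h2'⟩
    apply hne
    funext i
    fin_cases i
    · exact_mod_cast h0'.trans h0.symm
    · exact_mod_cast h1'.trans h1.symm
    · exact_mod_cast h2'.trans h2.symm
    · exact (hs w hw).trans (hs v hv).symm
  · refine Finset.sum_eq_zero fun v hv => if_neg fun hv' => h ⟨v, hv, hv'⟩

theorem HasIdeal.sub_boxes {X : Chr} {k : ℕ} {I I' : ℤ → ℤ → ℤ → Prop} (h : HasIdeal X k I)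
    {s : Finset Box} (hs : ∀ b ∈ s, b 3 = 0)
    (hI : ∀ a b c, I a b c ↔ I' a b c ∨ MemBoxes s a b c)
    (hd : ∀ a b c, MemBoxes s a b c → ¬ I' a b c) :
    HasIdeal (X - P {0, 1, 2} * chr (wlayer k) s) k I' := by
  intro a b c
  have h1 : ∀ a b c, ind I a b c = ind I' a b c + ind (MemBoxes s) a b c := by
    intro a b c
    have := hI a b c
    have := hd a b c
    simp only [ind]
    split_ifs <;> simp_all
  rw [layerCoeff_sub, layerCoeff_P_mul, h]
  simp only [diff, layerCoeff_chr hs, h1]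
  ring

/-- The indicator of a half-infinite column has as difference in direction `3` the indicator of its
bottom box. Hence `P₁₂` times the bottoms is `P₁₂₃` times the leg. -/
theorem HasIdeal.sub_leg {X : Chr} {k : ℕ} {I I' : ℤ → ℤ → ℤ → Prop} (h : HasIdeal X k I)
    {s : Finset Box} (hs : ∀ b ∈ s, b 3 = 0) (hs' : ∀ b ∈ s, b 2 = 0)
    (hI : ∀ a b c, I a b c ↔ I' a b c ∨ (MemBoxes s a b 0 ∧ 0 ≤ c))
    (hd : ∀ a b c, MemBoxes s a b 0 → ¬ I' a b c) :
    HasIdeal (X - P {0, 1} * chr (wlayer k) s) k I' := by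
  intro a b c
  have h1 : ∀ a b c, ind I a b c =
      ind I' a b c + ind (fun a b c => MemBoxes s a b 0 ∧ 0 ≤ c) a b c := by
    intro a b c
    have := hI a b c
    have := hd a b c
    simp only [ind]
    split_ifs <;> simp_all
  have h2 : ∀ a b c, ind (MemBoxes s) a b c =
      ind (fun a b c => MemBoxes s a b 0 ∧ 0 ≤ c) a b c -
        ind (fun a b c => MemBoxes s a b 0 ∧ 0 ≤ c) a b (c - 1) := by
    intro a b c
    by_cases hc : c = 0
    · subst hc
      by_cases h0 : MemBoxes s a b 0 <;> simp [ind, h0]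
    · have hm : ¬ MemBoxes s a b c := by
        rintro ⟨v, hv, _, _, h2⟩
        rw [hs' v hv] at h2
        exact hc (by simpa using h2.symm)
      have hiff : (MemBoxes s a b 0 ∧ 0 ≤ c) = (MemBoxes s a b 0 ∧ 0 ≤ c - 1) := by
        rw [show (0 ≤ c) = (0 ≤ c - 1) by rw [eq_iff_iff]; omega]
      rw [ind, if_neg hm, eq_comm, sub_eq_zero]
      exact ind_congr (iff_of_eq hiff)
  rw [layerCoeff_sub, layerCoeff_P_zero_one_mul, h]
  simp only [layerCoeff_chr hs, h2, diff, h1]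
  ring

/-- The indicator of an octant is a product of three step functions, and the mixed difference of
this product is a delta function at the corner. -/
theorem hasIdeal_mono (k h : ℕ) :
    HasIdeal (mono (wlayer k + h • wq 2)) k fun a b c => 0 ≤ a ∧ 0 ≤ b ∧ (h : ℤ) ≤ c := by
  intro a b c
  rw [layerCoeff, coeff_mono, wlayer_eq, wq_eq_pt.2.2.1, nsmul_pt, add_assoc, pt_add]
  simp only [add_right_inj, pt_inj]
  set u : ℤ → ℤ := fun n => if 0 ≤ n then 1 else 0 with hu
  have hind : ∀ a b c : ℤ, ind (fun a b c => 0 ≤ a ∧ 0 ≤ b ∧ (h : ℤ) ≤ c) a b c =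
      u a * u b * u (c - h) := by
    intro a b c
    simp only [ind, hu, sub_nonneg]
    by_cases h1 : 0 ≤ a <;> by_cases h2 : 0 ≤ b <;> simp [h1, h2]
  have hdu : ∀ n, u n - u (n - 1) = if n = 0 then 1 else 0 := by
    intro n
    simp only [hu]
    split_ifs <;> omega
  have hdiff : diff (ind fun a b c => 0 ≤ a ∧ 0 ≤ b ∧ (h : ℤ) ≤ c) a b c =
      (u a - u (a - 1)) * (u b - u (b - 1)) * (u (c - h) - u (c - h - 1)) := by
    simp only [diff, hind, sub_right_comm c 1]
    ring
  rw [hdiff, hdu, hdu, hdu]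
  by_cases h1 : a = 0 <;> by_cases h2 : b = 0 <;> simp [h1, h2]
  · split_ifs <;> omega
  all_goals omega

theorem HasIdeal.sub_mono_K {X : Chr} {k : ℕ} {I : ℤ → ℤ → ℤ → Prop} (h : HasIdeal X k I)
    {w : Weight} (hw : w 3 = 1) : HasIdeal (X - mono w) k I := by
  intro a b c
  rw [layerCoeff_sub, h, layerCoeff, coeff_mono, if_neg, sub_zero]
  intro h'
  have := congrFun h' 3
  rw [hw] at this
  simp [wx, pt] at this

theorem dualHom_chr (y : Weight) (s : Finset Box) :
    dualHom (chr y s) = ∑ b ∈ s, mono (-wbox y b) := by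
  rw [chr, map_sum]
  simp

theorem coeff_mul_dualHom_chr (X : Chr) (y : Weight) (s : Finset Box) (v : Weight) :
    (X * dualHom (chr y s)).coeff v = ∑ b ∈ s, X.coeff (v + wbox y b) := by
  rw [dualHom_chr, Finset.mul_sum, AddMonoidAlgebra.coeff_sum, Finset.sum_apply']
  refine Finset.sum_congr rfl fun b _ => ?_
  rw [mul_comm, coeff_mono_mul, sub_neg_eq_add]

theorem coeff_dualHom_mul_chr (X : Chr) (y : Weight) (s : Finset Box) (v : Weight) :
    (dualHom X * chr y s).coeff v = ∑ b ∈ s, X.coeff (wbox y b - v) := by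
  rw [chr, Finset.mul_sum, AddMonoidAlgebra.coeff_sum, Finset.sum_apply']
  refine Finset.sum_congr rfl fun b _ => ?_
  rw [mul_comm, coeff_mono_mul, coeff_dualHom, neg_sub]

theorem coeff_eq_layerCoeff (X : Chr) (k : ℕ) (a b c : ℤ) :
    X.coeff (wx + pt a b c) = layerCoeff X k (a + k) (b + k) (c + k) := by
  simp [layerCoeff]

section Ideals

variable {X : Chr} {i j : ℕ} {I : ℤ → ℤ → ℤ → Prop} {s : Finset Box}

/-- Seen from layer `j`, the box `v` of layer `i` sits at `v + (j - i)`, and the factor `P₄` adds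
the point one further up the diagonal. As `i < j`, both unit cubes lie above `v`, where the
indicator is constantly `1`. -/
theorem constTerm_mul_dualHom_chr_eq_zero (hX : HasIdeal X j I) (hij : i < j)
    (hs : ∀ b ∈ s, b 3 = 0)
    (hI : ∀ v ∈ s, ∀ a b c : ℤ, (v 0 : ℤ) ≤ a → (v 1 : ℤ) ≤ b → (v 2 : ℤ) ≤ c → I a b c) :
    constTerm (P {3} * X * dualHom (chr (wlayer i) s)) = 0 := by
  rw [constTerm, P_three, mul_assoc, coeff_one_sub_mono_mul, coeff_mul_dualHom_chr,
    coeff_mul_dualHom_chr, ← Finset.sum_sub_distrib]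
  refine Finset.sum_eq_zero fun v hv => ?_
  rw [wbox_wlayer (hs v hv), wq_eq_pt.2.2.2, zero_sub, pt_neg, zero_add, add_left_comm, pt_add,
    coeff_eq_layerCoeff X j, coeff_eq_layerCoeff X j, hX, hX, diff_ind_eq_zero_of_forall,
    diff_ind_eq_zero_of_forall, sub_zero]
  · intro a b c ha hb hc
    exact hI v hv a b c (by omega) (by omega) (by omega)
  · intro a b c ha hb hc
    exact hI v hv a b c (by omega) (by omega) (by omega)

/-- Seen from layer `i`, the box `v` of layer `j` sits at `v - (j - i)`. The point one further up
the diagonal is still at most `v`, so both cubes lie where the indicator is `0`. -/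
theorem constTerm_chr_mul_dualHom_eq_zero (hX : HasIdeal X i I) (hij : i < j)
    (hs : ∀ b ∈ s, b 3 = 0)
    (hI : ∀ v ∈ s, ∀ a b c : ℤ, a ≤ (v 0 : ℤ) → b ≤ (v 1 : ℤ) → c ≤ (v 2 : ℤ) → ¬ I a b c) :
    constTerm (dualHom (P {3}) * chr (wlayer j) s * dualHom X) = 0 := by
  rw [constTerm, P_three, map_sub, map_one, dualHom_mono, mul_assoc, coeff_one_sub_mono_mul,
    mul_comm (chr _ _), coeff_dualHom_mul_chr, coeff_dualHom_mul_chr, ← Finset.sum_sub_distrib]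
  refine Finset.sum_eq_zero fun v hv => ?_
  rw [wbox_wlayer (hs v hv), wq_eq_pt.2.2.2, zero_sub, neg_neg, sub_zero, add_sub_assoc, pt_sub,
    coeff_eq_layerCoeff X i, coeff_eq_layerCoeff X i, hX, hX, diff_ind_eq_zero_of_forall_not,
    diff_ind_eq_zero_of_forall_not, sub_zero]
  · intro a b c ha hb hc
    exact hI v hv a b c (by omega) (by omega) (by omega)
  · intro a b c ha hb hc
    exact hI v hv a b c (by omega) (by omega) (by omega)

/-- Regrouped as `q₄⁻¹ X^∨ S - (X - P₁₂₃ S)^∨ S`, the character reads the region before removal of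
the boxes on the cube just above each box, and the region after removal on the cube ending at the
box. The first is full, the second empty. -/
theorem constTerm_vertex_eq_zero {k : ℕ} {I' : ℤ → ℤ → ℤ → Prop} (hX : HasIdeal X k I)
    (hX' : HasIdeal (X - P {0, 1, 2} * chr (wlayer k) s) k I') (hs : ∀ b ∈ s, b 3 = 0)
    (hI : ∀ v ∈ s, ∀ a b c : ℤ, (v 0 : ℤ) ≤ a → (v 1 : ℤ) ≤ b → (v 2 : ℤ) ≤ c → I a b c)
    (hI' : ∀ v ∈ s, ∀ a b c : ℤ, a ≤ (v 0 : ℤ) → b ≤ (v 1 : ℤ) → c ≤ (v 2 : ℤ) → ¬ I' a b c) :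
    constTerm (-(dualHom (P {3}) * dualHom X * chr (wlayer k) s) +
      dualHom (P {0, 1, 2}) * dualHom (chr (wlayer k) s) * chr (wlayer k) s) = 0 := by
  have h : -(dualHom (P {3}) * dualHom X * chr (wlayer k) s) +
      dualHom (P {0, 1, 2}) * dualHom (chr (wlayer k) s) * chr (wlayer k) s =
      mono (-wq 3) * (dualHom X * chr (wlayer k) s) -
        dualHom (X - P {0, 1, 2} * chr (wlayer k) s) * chr (wlayer k) s := by
    simp only [P_three, map_sub, map_mul, map_one, dualHom_mono]
    ring
  rw [h, constTerm_sub, constTerm, constTerm, coeff_mono_mul, coeff_dualHom_mul_chr,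
    coeff_dualHom_mul_chr, ← Finset.sum_sub_distrib]
  refine Finset.sum_eq_zero fun v hv => ?_
  rw [wbox_wlayer (hs v hv), wq_eq_pt.2.2.2, zero_sub, neg_neg, sub_zero, add_sub_assoc, pt_sub,
    coeff_eq_layerCoeff _ k, coeff_eq_layerCoeff _ k, hX, hX', diff_ind_eq_zero_of_forall,
    diff_ind_eq_zero_of_forall_not, sub_zero]
  · intro a b c ha hb hc
    exact hI' v hv a b c (by omega) (by omega) (by omega)
  · intro a b c ha hb hc
    exact hI v hv a b c (by omega) (by omega) (by omega)

end Ideals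

/-- The quadratic term is absorbed into `N i - P₁₂₃ B i`, which describes the points outside the
whole partition; each summand then falls under one of the two vanishing lemmas for different layers.
-/
theorem pairChr_eq (N B : ℕ → Chr) (i j : ℕ) :
    pairChr N B i j = -(dualHom (P {3}) * B j * dualHom (N i - P {0, 1, 2} * B i)) -
      P {3} * N j * dualHom (B i) := by
  have h := congrArg dualHom P_three_mul_P
  rw [map_mul, map_add, dualHom_dualHom] at h
  rw [pairChr, map_sub, map_mul]
  linear_combination -B j * dualHom (B i) * h

/-! ## Layers of solid partitions -/

/-- The box in the `k`-th layer over a box in the directions `1, 2, 3`. -/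
def toLayer (k : ℕ) (b : Box) : Box := fun i => if i = 3 then k else b i

theorem mem_layer {k : ℕ} {s : Finset Box} {b : Box} :
    b ∈ layer k s ↔ b 3 = 0 ∧ toLayer k b ∈ s := by
  simp only [layer, Finset.mem_image, Finset.mem_filter]
  constructor
  · rintro ⟨v, ⟨hv, rfl⟩, rfl⟩
    refine ⟨by simp [flat], ?_⟩
    convert hv using 1
    funext i
    by_cases hi : i = 3
    · simp [toLayer, hi]
    · simp [toLayer, flat, hi]
  · rintro ⟨h3, hb⟩
    refine ⟨_, ⟨hb, by simp [toLayer]⟩, ?_⟩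
    funext i
    by_cases hi : i = 3
    · subst hi
      simp [flat, h3]
    · simp [toLayer, flat, hi]

theorem layer_eq_empty {n : ℕ} {s : Finset Box} (hs : ∀ b ∈ s, b 3 < n) {k : ℕ} (hk : n ≤ k) :
    layer k s = ∅ := by
  refine Finset.eq_empty_of_forall_notMem fun b hb => ?_
  have := hs _ (mem_layer.1 hb).2
  simp only [toLayer, if_true] at this
  omega

theorem wbox_toLayer (k : ℕ) {b : Box} (hb : b 3 = 0) :
    wbox wx (toLayer k b) = wbox (wlayer k) b := by
  rw [wbox_wlayer hb, wbox_eq]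
  simp [toLayer]

theorem chr_eq_sum_layer {n : ℕ} {s : Finset Box} (hs : ∀ b ∈ s, b 3 < n) :
    chr wx s = ∑ k ∈ range n, chr (wlayer k) (layer k s) := by
  rw [chr, ← Finset.sum_fiberwise_of_maps_to (t := range n) (g := fun b => b 3)
    fun b hb => mem_range.2 (hs b hb)]
  refine Finset.sum_congr rfl fun k _ => ?_
  rw [chr]
  refine (Finset.sum_bij (fun b _ => toLayer k b) ?_ ?_ ?_ ?_).symm
  · intro b hb
    rw [Finset.mem_filter]
    exact ⟨(mem_layer.1 hb).2, by simp [toLayer]⟩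
  · intro b hb b' hb' h
    funext i
    by_cases hi : i = 3
    · subst hi
      rw [(mem_layer.1 hb).1, (mem_layer.1 hb').1]
    · have := congrFun h i
      simpa [toLayer, hi] using this
  · intro b hb
    have hb3 := (Finset.mem_filter.1 hb).2
    refine ⟨flat {3} b, Finset.mem_image.2 ⟨b, hb, rfl⟩, ?_⟩
    funext i
    by_cases hi : i = 3
    · simp [toLayer, hi, hb3]
    · simp [toLayer, flat, hi]
  · intro b hb
    rw [wbox_toLayer k (mem_layer.1 hb).1]

/-- The points of the orthant outside of the boundary, in the `k`-th layer. -/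
def OutsideBoundary (A : Finset (Fin 4)) (π : Finset Box) (k : ℕ) (a b c : ℤ) : Prop :=
  0 ≤ a ∧ 0 ≤ b ∧ 0 ≤ c ∧ flat A ![a.toNat, b.toNat, c.toNat, k] ∉ π

/-- The points of the orthant outside of the solid partition, in the `k`-th layer. -/
def Outside (A : Finset (Fin 4)) (π ρ : Finset Box) (k : ℕ) (a b c : ℤ) : Prop :=
  OutsideBoundary A π k a b c ∧ ¬ MemBoxes (layer k ρ) a b c

theorem flat_mono (A : Finset (Fin 4)) {b b' : Box} (h : b ≤ b') : flat A b ≤ flat A b' := by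
  intro i
  simp only [flat]
  split_ifs
  · exact le_rfl
  · exact h i

namespace IsSolidWithBoundary

variable {A : Finset (Fin 4)} {π ρ : Finset Box}

/-- The boundary is closed downwards, so a boundary point above `v` would put the box of `ρ` itself
into the boundary. -/
theorem outsideBoundary (h : IsSolidWithBoundary A π ρ) {i j : ℕ} (hij : i ≤ j) {v : Box}
    (hv : v ∈ layer i ρ) {a b c : ℤ} (ha : (v 0 : ℤ) ≤ a) (hb : (v 1 : ℤ) ≤ b)
    (hc : (v 2 : ℤ) ≤ c) : OutsideBoundary A π j a b c := by
  refine ⟨by omega, by omega, by omega, fun hmem => ?_⟩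
  refine h.disjoint _ (mem_layer.1 hv).2 (h.boundary_lower (flat_mono A ?_) hmem)
  intro l
  fin_cases l <;> simp [toLayer] <;> omega

/-- A point of the orthant below a box of `ρ`, in the same or an earlier layer, belongs to the solid
partition. -/
theorem not_outside (h : IsSolidWithBoundary A π ρ) {i j : ℕ} (hij : i ≤ j) {v : Box}
    (hv : v ∈ layer j ρ) {a b c : ℤ} (ha : a ≤ (v 0 : ℤ)) (hb : b ≤ (v 1 : ℤ))
    (hc : c ≤ (v 2 : ℤ)) : ¬ Outside A π ρ i a b c := by
  rintro ⟨⟨ha0, hb0, hc0, hnot⟩, hnot'⟩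
  have hle : (![a.toNat, b.toNat, c.toNat, i] : Box) ≤ toLayer j v := by
    intro l
    fin_cases l <;> simp [toLayer] <;> omega
  rcases h.lower hle (Or.inl (mem_layer.1 hv).2) with h1 | h1
  · refine hnot' ⟨![a.toNat, b.toNat, c.toNat, 0], mem_layer.2 ⟨rfl, ?_⟩, ?_⟩
    · convert h1 using 1
      funext l
      fin_cases l <;> simp [toLayer]
    · simp [ha0, hb0, hc0]
  · exact hnot h1

theorem hasIdeal_outside (h : IsSolidWithBoundary A π ρ) {X : Chr} {k : ℕ}
    (hX : HasIdeal X k (OutsideBoundary A π k)) :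
    HasIdeal (X - P {0, 1, 2} * chr (wlayer k) (layer k ρ)) k (Outside A π ρ k) := by
  refine hX.sub_boxes (fun b hb => (mem_layer.1 hb).1) (fun a b c => ?_) fun a b c hm ho => ho.2 hm
  by_cases hm : MemBoxes (layer k ρ) a b c
  · simp only [hm, or_true, iff_true]
    obtain ⟨v, hv, rfl, rfl, rfl⟩ := hm
    exact h.outsideBoundary le_rfl hv le_rfl le_rfl le_rfl
  · simp [Outside, hm]

end IsSolidWithBoundary

/-! ## The characters of the `qq`-characters -/

/-- The character of a vertex with vacuum modes given by `X` and character of boxes `S`. -/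
def vertexChr (X S : Chr) : Chr :=
  -(dualHom (P {3}) * dualHom X * S) + dualHom (P {0, 1, 2}) * dualHom S * S

theorem vertexChr_zero (X : Chr) : vertexChr X 0 = 0 := by simp [vertexChr]

theorem chr_empty (y : Weight) : chr y ∅ = 0 := rfl

theorem chr_add (y w : Weight) (s : Finset Box) : chr (y + w) s = mono w * chr y s := by
  rw [chr, chr, Finset.mul_sum]
  refine Finset.sum_congr rfl fun b _ => ?_
  rw [← mono_add, wbox, wbox]
  congr 1
  abel

theorem P_zero_one_three : P {0, 1, 3} = P {3} * P {0, 1} := by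
  rw [P, P, P, Finset.prod_insert (by decide), Finset.prod_insert (by decide),
    Finset.prod_singleton, Finset.prod_insert (by decide), Finset.prod_singleton]
  ring

/-- Every term has total degree zero in the position, so the origin `y` is arbitrary. With `P₁₂₄ =
P₄ P₁₂` the framing and the leg combine into the numerator of the modes of the D6 operator without
boxes. -/
theorem d6Coeff_eq (q : Fin 4 → ℂ) (K x : ℂ) (u y : Weight) (ν s : Finset Box) :
    d6Coeff q K x u ν s =
      index q K x (vertexChr (mono y - mono (u + y) - P {0, 1} * chr y ν) (chr y s)) := by
  have h : ∀ t, chr y t = mono (y - wx) * chr wx t := fun t => by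
    rw [← chr_add, add_sub_cancel]
  have h1 := mono_ne_zero_mul_neg (y - wx)
  have h2 : mono (-y) * mono (y - wx) = mono (-wx) := by
    rw [← mono_add]
    congr 1
    abel
  rw [d6Coeff]
  congr 1
  simp only [dual_eq, vertexChr, h, P_zero_one_three, map_sub, map_mul, dualHom_mono, mono_add]
  rw [← h2]
  linear_combination
    -(dualHom (P {3}) * dualHom (P {0, 1}) * dualHom (chr wx ν) * chr wx s +
      dualHom (P {0, 1, 2}) * dualHom (chr wx s) * chr wx s) * h1

section Operators

variable {q : Fin 4 → ℂ} {K x : ℂ}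

theorem sum_ev_zpow (hq : Generic q K x) (y : Weight) (s : Finset Box) (n : ℤ) :
    ∑ b ∈ s, ev q K x (wbox y b) ^ n = hq.evHom n (chr y s) := by
  rw [chr, map_sum]
  simp

/-- All brane modes are brought to the denominator `P₁₂₃`: the operators `S₃` acquire the factor
`P₁₂` and the operators `A` the factor `P₁₂₃`. -/
theorem d6Op_eq (hq : Generic q K x) (u y : Weight) (ν s : Finset Box) {n : ℤ} (hn : n ≠ 0) :
    d6Op q K x u y ν s n =
      hq.evHom (-n) (mono y - mono (u + y) - P {0, 1} * chr y ν - P {0, 1, 2} * chr y s) /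
        adams q {0, 1, 2} (-n) := by
  have h1 := hq.adams_ne_zero {0, 1, 2} (neg_ne_zero.2 hn)
  have h2 : adams q {0, 1, 2} (-n) = adams q {2} (-n) * adams q {0, 1} (-n) := by
    rw [adams, adams, adams, Finset.prod_insert (by decide), Finset.prod_insert (by decide),
      Finset.prod_singleton, Finset.prod_insert (by decide), Finset.prod_singleton]
    ring
  have h3 : adams q ∅ (-n) = 1 := rfl
  have h4 := hq.adams_ne_zero {2} (neg_ne_zero.2 hn)
  have h5 := hq.adams_ne_zero {0, 1} (neg_ne_zero.2 hn)
  simp only [d6Op, Pi.sub_apply, Finset.sum_apply, brane, ← Finset.sum_div, sum_ev_zpow hq, map_sub,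
    map_mul, hq.evHom_P, hq.evHom_mono, h2, h3]
  field_simp

theorem d8Op_eq (hq : Generic q K x) (A : Finset (Fin 4)) (π ρ : Finset Box) {n : ℤ} (hn : n ≠ 0) :
    d8Op q K x A π ρ n =
      hq.evHom (-n) (mono wx - mono (wK + wx) - P Aᶜ * chr wx π - P univ * chr wx ρ) /
        adams q univ (-n) := by
  have h2 : adams q univ (-n) = adams q A (-n) * adams q Aᶜ (-n) := by
    rw [adams, adams, adams, Finset.prod_mul_prod_compl]
  have h3 : adams q ∅ (-n) = 1 := rfl
  have h4 := hq.adams_ne_zero A (neg_ne_zero.2 hn)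
  have h5 := hq.adams_ne_zero Aᶜ (neg_ne_zero.2 hn)
  simp only [d8Op, Pi.sub_apply, Finset.sum_apply, brane, ← Finset.sum_div, sum_ev_zpow hq, map_sub,
    map_mul, hq.evHom_P, hq.evHom_mono, h2, h3]
  field_simp

end Operators

theorem d8Coeff_eq (q : Fin 4 → ℂ) (K x : ℂ) (A : Finset (Fin 4)) (π ρ : Finset Box) :
    d8Coeff q K x A π ρ = index q K x
      (-(dualHom (mono wx - mono (wK + wx) - P Aᶜ * chr wx π) * chr wx ρ) +
        dualHom (P {0, 1, 2}) * dualHom (chr wx ρ) * chr wx ρ) := by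
  rw [d8Coeff]
  congr 1
  simp only [dual_eq, map_sub, map_mul, map_one, mono_add]
  ring

theorem inBand_wlayer_box {k : ℕ} (b : Box) : InBand (mono (wbox (wlayer k) b)) 1 0 0 := by
  have h : wbox (wlayer k) b = wx + pt ((b 0 : ℤ) - b 3 - k) ((b 1 : ℤ) - b 3 - k)
      ((b 2 : ℤ) - b 3 - k) := by
    rw [wbox_eq, wlayer_eq, add_assoc, pt_add]
    congr 2 <;> ring
  rw [h]
  exact InBand.of_mono rfl le_rfl le_rfl

theorem inBand_chr (k : ℕ) (s : Finset Box) : InBand (chr (wlayer k) s) 1 0 0 :=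
  InBand.sum fun b _ => inBand_wlayer_box b

theorem inBand_vertexChr {X S : Chr} (hX : InBand X 1 0 1) (hS : InBand S 1 0 0) :
    InBand (vertexChr X S) 0 (-1) 1 := by
  have hS' : InBand S 1 0 1 := hS.mono' le_rfl zero_le_one
  have hd : ∀ A, InBand (dualHom (P A)) 0 0 0 := fun A => by simpa using (inBand_P A).dualHom
  rw [vertexChr, mul_right_comm, mul_right_comm (dualHom (P {0, 1, 2}))]
  exact (inBand_mul_dualHom hS' hX (hd _)).neg.add (inBand_mul_dualHom hS' hS' (hd _))

/-! ### The gluing theorem for solid partitions. -/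

namespace IsSolidWithBoundary

variable {A : Finset (Fin 4)} {π ρ : Finset Box}

theorem constTerm_mul_dualHom (h : IsSolidWithBoundary A π ρ) {X : Chr} {i j : ℕ} (hij : i < j)
    {I : ℤ → ℤ → ℤ → Prop} (hX : HasIdeal X j I)
    (hI : ∀ a b c, OutsideBoundary A π j a b c → I a b c) :
    constTerm (P {3} * X * dualHom (chr (wlayer i) (layer i ρ))) = 0 :=
  constTerm_mul_dualHom_chr_eq_zero hX hij (fun _ hb => (mem_layer.1 hb).1)
    fun _ hv _ _ _ ha hb hc => hI _ _ _ (h.outsideBoundary hij.le hv ha hb hc)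

theorem movable_vertexChr (h : IsSolidWithBoundary A π ρ) {X : Chr} {k : ℕ} (hX1 : InBand X 1 0 1)
    (hX : HasIdeal X k (OutsideBoundary A π k)) :
    Movable (vertexChr X (chr (wlayer k) (layer k ρ))) :=
  ⟨inBand_vertexChr hX1 (inBand_chr _ _),
    constTerm_vertex_eq_zero hX (h.hasIdeal_outside hX) (fun _ hb => (mem_layer.1 hb).1)
      (fun _ hv _ _ _ ha hb hc => h.outsideBoundary le_rfl hv ha hb hc)
      (fun _ hv _ _ _ ha hb hc => h.not_outside le_rfl hv ha hb hc)⟩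

/-- The ordered product of the layers of a solid partition, given the vacuum modes. -/
theorem reproduces (h : IsSolidWithBoundary A π ρ) {q : Fin 4 → ℂ} {K x : ℂ} (hq : Generic q K x)
    {N Q X Xvac : ℕ → Chr} {b' : Chr} {n₀ : ℕ} {Λ Λvac : ℕ → Modes} {f : ℕ → ℕ → Chr}
    (hNI : ∀ k, HasIdeal (N k) k (OutsideBoundary A π k))
    (hN : ∀ k, InBand (N k) 1 0 1) (hNrank : ∀ k, rank (N k) = 0)
    (hn₀ : ∀ b ∈ ρ, b 3 < n₀) (hb' : InBand b' 1 0 1)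
    (hb : ∀ n, n₀ ≤ n → P {3} * ∑ j ∈ range (n + 1), N j =
      mono wx - mono (wK + wx) - P Aᶜ * chr wx π - mono ((n + 1) • wq 3) * b')
    (hΛ : ∀ k n, n ≠ 0 → Λ k n = hq.evHom (-n)
      (N k - P {0, 1, 2} * chr (wlayer k) (layer k ρ)) / adams q {0, 1, 2} (-n))
    (hΛvac : ∀ k n, n ≠ 0 → Λvac k n = hq.evHom (-n) (N k) / adams q {0, 1, 2} (-n))
    (hX : ∀ k, Movable (X k)) (hXvac : ∀ k, Movable (Xvac k))
    (hXX : ∀ k, X k - Xvac k = vertexChr (N k) (chr (wlayer k) (layer k ρ)) +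
      (dualHom (Q k) - Q k))
    (hQ : ∀ k, InBand (Q k) 0 (-1) 1) (hQdet : ∀ k, signedDet q K x (Q k) = 1)
    (hQ0 : ∀ k, constTerm (Q k) = 0)
    (hf : ∀ i j, i < j → constTerm (f i j) = constTerm
      (P {0, 1, 2} * dualHom (chr (wlayer i) (layer i ρ)) * chr (wlayer j) (layer j ρ))) :
    Reproduces q (fun k => index q K x (X k)) (fun k => index q K x (Xvac k)) Λ Λvac
      ((-1) ^ constTermSum f * d8Coeff q K x A π ρ) (d8Op q K x A π ρ) := by
  have hT : ∀ i j, i < j → constTerm (P {3} * N j * dualHom (chr (wlayer i) (layer i ρ))) = 0 :=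
    fun i j hij => h.constTerm_mul_dualHom hij (hNI j) fun _ _ _ => id
  rw [d8Coeff_eq]
  refine reproduces_of_layers (n₀ := n₀) (N := N) (Q := Q) (b' := b')
    (B := fun k => chr (wlayer k) (layer k ρ)) hq hN hNrank
    (fun k => inBand_chr k _) (fun k hk => by rw [layer_eq_empty hn₀ hk]; rfl) hb' hb hΛ hΛvac
    hX hXvac hXX hQ hQdet hQ0 (fun i j hij => ?_) hT hf (by rw [chr_eq_sum_layer hn₀]) ?_
  -- The two summands are handled by the region outside the partition in layer `i` and by the region
  -- outside the boundary in layer `j`.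
  · rw [pairChr_eq, constTerm_sub, constTerm_neg, hT i j hij, sub_zero, neg_eq_zero]
    exact constTerm_chr_mul_dualHom_eq_zero (h.hasIdeal_outside (hNI i)) hij
      (fun _ hb => (mem_layer.1 hb).1)
      fun _ hv _ _ _ ha hb hc => h.not_outside hij.le hv ha hb hc
  · intro n hn
    rw [d8Op_eq hq A π ρ hn, chr_eq_sum_layer hn₀]

/-- The ordered product of the layers of a solid partition if the vacuum layers have no boxes. -/
theorem reproduces_of_leg (h : IsSolidWithBoundary A π ρ) {q : Fin 4 → ℂ} {K x : ℂ}
    (hq : Generic q K x) {u y : ℕ → Weight} {ν s : ℕ → Finset Box} {b' : Chr} {n₀ : ℕ}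
    {N : ℕ → Chr} {f : ℕ → ℕ → Chr}
    (hNeq : ∀ k, N k = mono (y k) - mono (u k + y k) - P {0, 1} * chr (y k) (ν k))
    (hs : ∀ k, chr (y k) (s k) = chr (wlayer k) (layer k ρ))
    (hNI : ∀ k, HasIdeal (N k) k (OutsideBoundary A π k))
    (hN : ∀ k, InBand (N k) 1 0 1) (hn₀ : ∀ b ∈ ρ, b 3 < n₀) (hb' : InBand b' 1 0 1)
    (hb : ∀ n, n₀ ≤ n → P {3} * ∑ j ∈ range (n + 1), N j =
      mono wx - mono (wK + wx) - P Aᶜ * chr wx π - mono ((n + 1) • wq 3) * b')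
    (hf : ∀ i j, i < j → constTerm (f i j) = constTerm
      (P {0, 1, 2} * dualHom (chr (wlayer i) (layer i ρ)) * chr (wlayer j) (layer j ρ))) :
    Reproduces q (fun k => d6Coeff q K x (u k) (ν k) (s k)) (fun k => d6Coeff q K x (u k) (ν k) ∅)
      (fun k => d6Op q K x (u k) (y k) (ν k) (s k)) (fun k => d6Op q K x (u k) (y k) (ν k) ∅)
      ((-1) ^ constTermSum f * d8Coeff q K x A π ρ) (d8Op q K x A π ρ) := by
  have h1 : ∀ k, d6Coeff q K x (u k) (ν k) (s k) =
      index q K x (vertexChr (N k) (chr (wlayer k) (layer k ρ))) := fun k => by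
    rw [d6Coeff_eq q K x (u k) (y k), ← hNeq, hs]
  have h2 : ∀ k, d6Coeff q K x (u k) (ν k) ∅ = index q K x 0 := fun k => by
    rw [d6Coeff_eq q K x (u k) (y k), chr_empty, vertexChr_zero]
  simp only [h1, h2]
  refine h.reproduces hq (N := N) (Q := fun _ => 0) hNI hN (fun k => ?_) hn₀ hb' hb
    (fun k n hn => ?_) (fun k n hn => ?_) (fun k => h.movable_vertexChr (hN k) (hNI k))
    (fun _ => ⟨.zero, rfl⟩) (fun k => by simp) (fun _ => .zero) (fun _ => by simp [signedDet])
    (fun _ => rfl) hf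
  · rw [hNeq, map_sub, map_sub, map_mul, rank_mono, rank_mono, rank_P ⟨0, by simp⟩]
    simp
  · rw [d6Op_eq hq _ _ _ _ hn, ← hNeq, hs]
  · rw [d6Op_eq hq _ _ _ _ hn, ← hNeq, chr_empty, mul_zero, sub_zero]

end IsSolidWithBoundary

/-! ## The four boundaries -/

theorem exists_lt_of_boxes (π ρ : Finset Box) : ∃ n, (∀ b ∈ π, b 3 < n) ∧ ∀ b ∈ ρ, b 3 < n := by
  refine ⟨(π ∪ ρ).sup (fun b => b 3) + 1, fun b hb => ?_, fun b hb => ?_⟩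
  · exact Nat.lt_succ_of_le (Finset.le_sup (f := fun b : Box => b 3) (mem_union_left _ hb))
  · exact Nat.lt_succ_of_le (Finset.le_sup (f := fun b : Box => b 3) (mem_union_right _ hb))

/-- The numerator of the modes of `W₁₂₃(x_k) / W₁₂₃(K x_k)`. -/
def vacChr (k : ℕ) : Chr := mono (wlayer k) - mono (wK + wlayer k)

theorem mono_wlayer (k : ℕ) : mono (wlayer k) = mono (k • wq 3) * mono wx := by
  rw [← mono_add, wlayer, add_comm]

theorem chr_wlayer (k : ℕ) (s : Finset Box) : chr (wlayer k) s = mono (k • wq 3) * chr wx s :=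
  chr_add _ _ _

theorem vacChr_eq (k : ℕ) : vacChr k = mono (k • wq 3) * (mono wx - mono (wK + wx)) := by
  rw [vacChr, mono_add, mono_add, mono_wlayer]
  ring

theorem inBand_mono_add_pt (k : ℕ) (a b c : ℤ) : InBand (mono (wlayer k + pt a b c)) 1 0 0 := by
  rw [wlayer_eq, add_assoc, pt_add]
  exact InBand.of_mono rfl le_rfl le_rfl

theorem inBand_mono_wK (k : ℕ) : InBand (mono (wK + wlayer k)) 1 0 1 := by
  rw [wlayer_eq]
  exact InBand.of_mono rfl zero_le_one le_rfl

theorem inBand_vacChr (k : ℕ) : InBand (vacChr k) 1 0 1 := by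
  have h := inBand_mono_add_pt k 0 0 0
  rw [show pt 0 0 0 = 0 by funext i; fin_cases i <;> rfl, add_zero] at h
  exact (h.mono' le_rfl zero_le_one).sub (inBand_mono_wK k)

theorem wK_add_wlayer_apply (k : ℕ) : (wK + wlayer k) 3 = 1 := by
  rw [wlayer_eq]
  rfl

theorem hasIdeal_vacChr (k : ℕ) : HasIdeal (vacChr k) k fun a b c => 0 ≤ a ∧ 0 ≤ b ∧ 0 ≤ c := by
  have h := (hasIdeal_mono k 0).sub_mono_K (wK_add_wlayer_apply k)
  simpa [vacChr] using h

theorem P_three_mul_geom (n : ℕ) :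
    P {3} * ∑ j ∈ range n, mono (j • wq 3) = 1 - mono (n • wq 3) := by
  simp only [mono_nsmul, P_three]
  exact mul_neg_geom_sum _ _

theorem P_three_mul_sum_vacChr (n : ℕ) : P {3} * ∑ j ∈ range n, vacChr j =
    mono wx - mono (wK + wx) - mono (n • wq 3) * (mono wx - mono (wK + wx)) := by
  simp only [vacChr_eq, ← Finset.sum_mul]
  rw [← mul_assoc, P_three_mul_geom]
  ring

theorem P_univ : P univ = P {3} * P {0, 1, 2} := by
  rw [P, P, P, Fin.prod_univ_four, Finset.prod_insert (by decide), Finset.prod_insert (by decide),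
    Finset.prod_singleton, Finset.prod_singleton]
  ring

theorem memBoxes_iff {s : Finset Box} (hs : ∀ b ∈ s, b 3 = 0) (a b c : ℤ) :
    MemBoxes s a b c ↔ 0 ≤ a ∧ 0 ≤ b ∧ 0 ≤ c ∧ ![a.toNat, b.toNat, c.toNat, 0] ∈ s := by
  constructor
  · rintro ⟨v, hv, rfl, rfl, rfl⟩
    refine ⟨by omega, by omega, by omega, ?_⟩
    convert hv using 1
    funext i
    fin_cases i <;> simp [hs v hv]
  · rintro ⟨ha, hb, hc, h⟩
    exact ⟨_, h, by simp [ha], by simp [hb], by simp [hc]⟩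

section Leg

variable {A : Finset (Fin 4)} {π ρ s : Finset Box} {k : ℕ}

theorem hasIdeal_leg (hs : ∀ b ∈ s, b 3 = 0) (hs' : ∀ b ∈ s, b 2 = 0)
    (h : ∀ a b c : ℕ, flat A ![a, b, c, k] ∈ π ↔ ![a, b, 0, 0] ∈ s) :
    HasIdeal (vacChr k - P {0, 1} * chr (wlayer k) s) k (OutsideBoundary A π k) := by
  refine (hasIdeal_vacChr k).sub_leg hs hs' (fun a b c => ?_) fun a b c => ?_
  · simp only [OutsideBoundary, h, memBoxes_iff hs]
    simp only [Int.toNat_zero]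
    tauto
  · simp only [OutsideBoundary, h, memBoxes_iff hs]
    simp only [Int.toNat_zero]
    tauto

/-- The boundary term of the sign is the difference of `P₄ N_j 𝚷^{(i)∨}` with and without the leg,
and both constant terms vanish. Such terms therefore do not affect the sign. -/
theorem IsSolidWithBoundary.constTerm_leg (h : IsSolidWithBoundary A π ρ) {i j : ℕ} (hij : i < j)
    (hj : HasIdeal (vacChr j - P {0, 1} * chr (wlayer j) s) j (OutsideBoundary A π j)) :
    constTerm (P {0, 1, 3} * chr (wlayer j) s * dualHom (chr (wlayer i) (layer i ρ))) = 0 := by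
  have h1 := h.constTerm_mul_dualHom hij (hasIdeal_vacChr j)
    fun a b c hI => ⟨hI.1, hI.2.1, hI.2.2.1⟩
  have h2 := h.constTerm_mul_dualHom hij hj fun _ _ _ => id
  have h3 : P {0, 1, 3} * chr (wlayer j) s * dualHom (chr (wlayer i) (layer i ρ)) =
      P {3} * vacChr j * dualHom (chr (wlayer i) (layer i ρ)) -
        P {3} * (vacChr j - P {0, 1} * chr (wlayer j) s) *
          dualHom (chr (wlayer i) (layer i ρ)) := by
    rw [P_zero_one_three]
    ring
  rw [h3, constTerm_sub, h1, h2, sub_zero]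

theorem inBand_leg (k : ℕ) (s : Finset Box) :
    InBand (vacChr k - P {0, 1} * chr (wlayer k) s) 1 0 1 := by
  have h := (inBand_P {0, 1}).mul (inBand_chr k s)
  exact (inBand_vacChr k).sub (h.mono' le_rfl zero_le_one)

theorem chr_wlayer_zero (s : Finset Box) : chr wx s = chr (wlayer 0) s := by simp [wlayer]

theorem vacChr_zero : vacChr 0 = mono wx - mono (wK + wx) := by simp [vacChr, wlayer]

theorem leg_eq (j : ℕ) (s : Finset Box) : vacChr j - P {0, 1} * chr (wlayer j) s =
    mono (j • wq 3) * (vacChr 0 - P {0, 1} * chr (wlayer 0) s) := by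
  rw [vacChr_eq, chr_wlayer, vacChr_zero, ← chr_wlayer_zero]
  ring

end Leg

variable {q : Fin 4 → ℂ} {K x : ℂ} {π ρ : Finset Box}

theorem reproduces_leg_three (hq : Generic q K x) (h : IsSolidWithBoundary {2} π ρ) :
    Reproduces q (fun k => d6Coeff q K x wK (layer k π) (layer k ρ))
      (fun k => d6Coeff q K x wK (layer k π) ∅)
      (fun k => d6Op q K x wK (wlayer k) (layer k π) (layer k ρ))
      (fun k => d6Op q K x wK (wlayer k) (layer k π) ∅)
      ((-1 : ℂ) ^ signLeg3 π ρ * d8Coeff q K x {2} π ρ) (d8Op q K x {2} π ρ) := by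
  obtain ⟨n₀, hπ, hρ⟩ := exists_lt_of_boxes π ρ
  have hI : ∀ k, HasIdeal (vacChr k - P {0, 1} * chr (wlayer k) (layer k π)) k
      (OutsideBoundary {2} π k) := fun k => by
    refine hasIdeal_leg (fun b hb => (mem_layer.1 hb).1)
      (fun b hb => h.boundary_flat _ (mem_layer.1 hb).2 2 (by simp)) fun a b c => ?_
    rw [mem_layer]
    simp only [Matrix.cons_val, true_and]
    apply iff_of_eq
    congr 1
    funext i
    fin_cases i <;> simp [flat, toLayer]
  -- As `π` is finite, far layers carry no leg, so the geometric tail is that of `vacChr 0`.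
  refine h.reproduces_of_leg hq (n₀ := n₀) (u := fun _ => wK) (y := wlayer)
    (N := fun k => vacChr k - P {0, 1} * chr (wlayer k) (layer k π)) (fun _ => rfl) (fun _ => rfl)
    hI (fun k => inBand_leg k _) hρ (b' := vacChr 0) (inBand_vacChr 0) (fun n hn => ?_)
    fun i j hij => ?_
  · rw [Finset.sum_sub_distrib, ← Finset.mul_sum, mul_sub, P_three_mul_sum_vacChr, ← mul_assoc,
      ← P_zero_one_three, ← chr_eq_sum_layer fun b hb => (hπ b hb).trans (Nat.lt_succ_of_le hn),
      vacChr_zero, show ({2}ᶜ : Finset (Fin 4)) = {0, 1, 3} by decide]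
    ring
  · rw [constTerm_add, layerChr, layerChr, layerChr, dual_eq, h.constTerm_leg hij (hI j), zero_add]

theorem reproduces_face_three_four (hq : Generic q K x) (h : IsSolidWithBoundary {2, 3} π ρ) :
    Reproduces q (fun k => d6Coeff q K x wK π (layer k ρ)) (fun _ => d6Coeff q K x wK π ∅)
      (fun k => d6Op q K x wK (wlayer k) π (layer k ρ)) (fun k => d6Op q K x wK (wlayer k) π ∅)
      ((-1 : ℂ) ^ signFace34 π ρ * d8Coeff q K x {2, 3} π ρ) (d8Op q K x {2, 3} π ρ) := by
  obtain ⟨n₀, hπ, hρ⟩ := exists_lt_of_boxes π ρ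
  have hI : ∀ k, HasIdeal (vacChr k - P {0, 1} * chr (wlayer k) π) k
      (OutsideBoundary {2, 3} π k) := fun k => by
    refine hasIdeal_leg (fun b hb => h.boundary_flat _ hb 3 (by simp))
      (fun b hb => h.boundary_flat _ hb 2 (by simp)) fun a b c => ?_
    apply iff_of_eq
    congr 1
    funext i
    fin_cases i <;> simp [flat]
  -- All vacuum layers are translates of the zeroth one by powers of `q₄`, so the tail `b'` is its
  -- full numerator, leg included.
  refine h.reproduces_of_leg hq (n₀ := n₀) (u := fun _ => wK) (y := wlayer) (ν := fun _ => π)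
    (N := fun k => vacChr k - P {0, 1} * chr (wlayer k) π) (fun _ => rfl) (fun _ => rfl)
    hI (fun k => inBand_leg k _) hρ (inBand_leg 0 π) (fun n hn => ?_)
    fun i j hij => ?_
  · rw [Finset.sum_congr rfl fun j _ => leg_eq j π, ← Finset.sum_mul, ← mul_assoc,
      P_three_mul_geom, vacChr_zero,
      ← chr_wlayer_zero, show ({2, 3}ᶜ : Finset (Fin 4)) = {0, 1} by decide]
    ring
  · rw [constTerm_add, layerChr, layerChr, dual_eq, h.constTerm_leg hij (hI j), zero_add]

/-! ### The surface along the directions `1, 2` -/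

/-- The bound `h ≤ b 2` prevents truncation in the natural subtraction, so moving the boxes down and
the origin up cancel. -/
theorem chr_lower3 {s : Finset Box} {h : ℕ} (hs : ∀ b ∈ s, h ≤ b 2) (w : Weight) :
    chr (w + h • wq 2) (lower3 h s) = chr w s := by
  rw [chr, lower3, Finset.sum_image]
  · refine Finset.sum_congr rfl fun b hb => ?_
    congr 1
    simp only [wbox_eq, wq_eq_pt.2.2.1, nsmul_pt, add_assoc, pt_add]
    have := hs b hb
    congr 2 <;> simp
    push_cast [this]
    ring
  · intro b hb b' hb' heq
    funext i
    have h1 := congrFun heq i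
    by_cases hi : i = 2
    · subst hi
      simp only [if_true] at h1
      have := hs b hb
      have := hs b' hb'
      omega
    · simpa [hi] using h1

theorem eq_range_of_isLowerSet {s : Finset ℕ} (hs : IsLowerSet (s : Set ℕ)) : s = range s.card := by
  have h : ∀ n, n ∈ s → n < s.card := fun n hn => by
    have : range (n + 1) ⊆ s := fun m hm => hs (Nat.lt_succ_iff.1 (mem_range.1 hm)) hn
    simpa using Finset.card_le_card this
  exact Finset.eq_of_subset_of_card_le (fun n hn => mem_range.2 (h n hn)) (by simp)

/-- The rows of a Young diagram are initial segments, so their number of boxes determines them. -/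
theorem IsSolidWithBoundary.mem_iff_lt_height (h : IsSolidWithBoundary {0, 1} π ρ) (k c : ℕ) :
    ![0, 0, c, k] ∈ π ↔ c < height k π := by
  have hv : ∀ v ∈ π, v = ![0, 0, v 2, v 3] := fun v hv => by
    funext i
    fin_cases i
    · exact h.boundary_flat v hv 0 (by simp)
    · exact h.boundary_flat v hv 1 (by simp)
    · rfl
    · rfl
  set s := (π.filter fun b => b 3 = k).image fun b => b 2 with hs
  have hmem : ∀ n, n ∈ s ↔ ![0, 0, n, k] ∈ π := fun n => by
    simp only [hs, Finset.mem_image, Finset.mem_filter]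
    constructor
    · rintro ⟨v, ⟨hvπ, rfl⟩, rfl⟩
      rwa [← hv v hvπ]
    · exact fun hn => ⟨_, ⟨hn, rfl⟩, rfl⟩
  have hcard : s.card = height k π := by
    rw [hs, height, Finset.card_image_of_injOn]
    intro v hv1 w hw1 heq
    obtain ⟨hv1, hv3⟩ := Finset.mem_filter.1 hv1
    obtain ⟨hw1, hw3⟩ := Finset.mem_filter.1 hw1
    simp only at heq
    rw [hv v hv1, hv w hw1, heq, hv3, hw3]
  have hlow : IsLowerSet (s : Set ℕ) := fun n m hmn hn => by
    rw [Finset.mem_coe, hmem] at hn ⊢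
    refine h.boundary_lower ?_ hn
    intro i
    fin_cases i <;> simp [hmn]
  rw [← hmem, eq_range_of_isLowerSet hlow, mem_range, hcard]

theorem IsSolidWithBoundary.outsideBoundary_iff (h : IsSolidWithBoundary {0, 1} π ρ) (k : ℕ)
    (a b c : ℤ) : OutsideBoundary {0, 1} π k a b c ↔ 0 ≤ a ∧ 0 ≤ b ∧ (height k π : ℤ) ≤ c := by
  have hflat : flat {0, 1} ![a.toNat, b.toNat, c.toNat, k] = ![0, 0, c.toNat, k] := by
    funext i
    fin_cases i <;> simp [flat]
  rw [OutsideBoundary, hflat, h.mem_iff_lt_height]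
  omega

/-- A geometric sum along the row. It identifies moving the origin past the row with subtracting
`P₃` times the row from the vacuum numerator. -/
theorem IsSolidWithBoundary.P_two_mul_chr_layer (h : IsSolidWithBoundary {0, 1} π ρ) (k : ℕ) :
    P {2} * chr (wlayer k) (layer k π) =
      mono (wlayer k) - mono (wlayer k + height k π • wq 2) := by
  have hl : layer k π = (range (height k π)).image fun c => ![0, 0, c, 0] := by
    ext v
    have hto : ∀ c, toLayer k ![0, 0, c, 0] = ![0, 0, c, k] := fun c => by
      funext i
      fin_cases i <;> simp [toLayer]
    simp only [mem_layer, Finset.mem_image, mem_range]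
    constructor
    · rintro ⟨h3, hv⟩
      have h0 : v 0 = 0 := h.boundary_flat _ hv 0 (by simp)
      have h1 : v 1 = 0 := h.boundary_flat _ hv 1 (by simp)
      have hveq : v = ![0, 0, v 2, 0] := by
        funext i
        fin_cases i <;> simp [h0, h1, h3]
      refine ⟨v 2, ?_, hveq.symm⟩
      rw [← h.mem_iff_lt_height, ← hto, ← hveq]
      exact hv
    · rintro ⟨c, hc, rfl⟩
      refine ⟨rfl, ?_⟩
      rwa [hto, h.mem_iff_lt_height]
  have hw : ∀ c : ℕ, wbox (wlayer k) ![0, 0, c, 0] = wlayer k + c • wq 2 := fun c => by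
    simp [wbox, Fin.sum_univ_four]
  have hP : P {2} = 1 - mono (wq 2) := by simp [P]
  rw [hl, chr, Finset.sum_image fun c _ c' _ hcc => by simpa using congrFun hcc 2]
  simp only [hw, mono_add, mono_nsmul, ← Finset.mul_sum]
  rw [hP, mul_left_comm, mul_neg_geom_sum, mul_sub, mul_one]

theorem reproduces_face_one_two (hq : Generic q K x) (h : IsSolidWithBoundary {0, 1} π ρ) :
    Reproduces q
      (fun k => d6Coeff q K x (wK - height k π • wq 2) ∅ (lower3 (height k π) (layer k ρ)))
      (fun k => d6Coeff q K x (wK - height k π • wq 2) ∅ ∅)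
      (fun k => d6Op q K x (wK - height k π • wq 2) (wlayer k + height k π • wq 2) ∅
        (lower3 (height k π) (layer k ρ)))
      (fun k => d6Op q K x (wK - height k π • wq 2) (wlayer k + height k π • wq 2) ∅ ∅)
      ((-1 : ℂ) ^ signFace12 π ρ * d8Coeff q K x {0, 1} π ρ) (d8Op q K x {0, 1} π ρ) := by
  obtain ⟨n₀, hπ, hρ⟩ := exists_lt_of_boxes π ρ
  have hI : ∀ k, HasIdeal (mono (wlayer k + height k π • wq 2)) k
      (OutsideBoundary {0, 1} π k) := fun k => by
    have := hasIdeal_mono k (height k π)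
    rwa [show OutsideBoundary {0, 1} π k = fun a b c => 0 ≤ a ∧ 0 ≤ b ∧ (height k π : ℤ) ≤ c by
      funext a b c; exact propext (h.outsideBoundary_iff k a b c)]
  have hN : ∀ k, mono (wlayer k + height k π • wq 2) - mono (wK + wlayer k) =
      vacChr k - P {2} * chr (wlayer k) (layer k π) := fun k => by
    rw [h.P_two_mul_chr_layer, vacChr]
    ring
  -- Since `u_k y_k = K x_k`, only the first monomial of the vacuum numerator is moved by the
  -- height. The heights are eventually zero, so the tail is `vacChr 0`.
  refine h.reproduces_of_leg hq (n₀ := n₀) (ν := fun _ => ∅)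
    (N := fun k => mono (wlayer k + height k π • wq 2) - mono (wK + wlayer k)) (fun k => ?_)
    (fun k => chr_lower3 (fun b hb => ?_) _)
    (fun k => (hI k).sub_mono_K (wK_add_wlayer_apply k)) (fun k => ?_) hρ (inBand_vacChr 0)
    (fun n hn => ?_) fun i j hij => ?_
  · rw [chr_empty, mul_zero, sub_zero]
    congr 2
    abel
  · exact_mod_cast ((h.outsideBoundary_iff k _ _ _).1
      (h.outsideBoundary le_rfl hb le_rfl le_rfl le_rfl)).2.2
  · have h1 := inBand_mono_add_pt k 0 0 (height k π)
    have h2 : height k π • wq 2 = pt 0 0 (height k π) := by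
      rw [wq_eq_pt.2.2.1, nsmul_pt]
      simp
    rw [h2]
    exact (h1.mono' le_rfl zero_le_one).sub (inBand_mono_wK k)
  · have hP : P ({0, 1}ᶜ) = P {3} * P {2} := by
      rw [show ({0, 1}ᶜ : Finset (Fin 4)) = {3, 2} by decide, P, P, P,
        Finset.prod_insert (by decide), Finset.prod_singleton, Finset.prod_singleton]
    simp only [hN]
    rw [Finset.sum_sub_distrib, ← Finset.mul_sum, mul_sub, P_three_mul_sum_vacChr, ← mul_assoc,
      ← hP, ← chr_eq_sum_layer fun b hb => (hπ b hb).trans (Nat.lt_succ_of_le hn), vacChr_zero]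
    ring
  · rw [constTerm_add, constTerm_neg, layerChr, layerChr, dual_eq,
      h.constTerm_mul_dualHom hij (hI j) fun _ _ _ => id, neg_zero, zero_add]

/-! ### The leg along the direction `4` -/

/-- The factor `q₄⁻¹` moves the point read from `v` to `v + (1, 1, 1)`, whose unit cube lies above
`v`. -/
theorem constTerm_mono_mul_dualHom_mul_chr {X : Chr} {k : ℕ} {I : ℤ → ℤ → ℤ → Prop}
    {s : Finset Box} (hX : HasIdeal X k I) (hs : ∀ b ∈ s, b 3 = 0)
    (hI : ∀ v ∈ s, ∀ a b c : ℤ, (v 0 : ℤ) ≤ a → (v 1 : ℤ) ≤ b → (v 2 : ℤ) ≤ c → I a b c) :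
    constTerm (mono (-wq 3) * (dualHom X * chr (wlayer k) s)) = 0 := by
  rw [constTerm, coeff_mono_mul, coeff_dualHom_mul_chr]
  refine Finset.sum_eq_zero fun v hv => ?_
  rw [wbox_wlayer (hs v hv), wq_eq_pt.2.2.2, zero_sub, neg_neg, add_sub_assoc, pt_sub,
    coeff_eq_layerCoeff _ k, hX, diff_ind_eq_zero_of_forall]
  intro a b c ha hb hc
  exact hI v hv a b c (by omega) (by omega) (by omega)

/-- The cross terms `P₁₂₃₄^∨ b^∨ B` of the new vacuum and `P₁₂₃^∨ (b^∨ B + B^∨ b)` of the vertex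
differ by the inversion of one character, since `P₁₂₃₄` is `P₁₂₃` plus its dual. -/
theorem vertexChr_add_sub (V b B : Chr) :
    vertexChr V (b + B) - vertexChr V b = vertexChr (V - P {0, 1, 2} * b) B +
      (dualHom (P {0, 1, 2} * dualHom b * B) - P {0, 1, 2} * dualHom b * B) := by
  have h := congrArg dualHom P_three_mul_P
  rw [map_mul, map_add, dualHom_dualHom] at h
  simp only [vertexChr, map_sub, map_mul, map_add, dualHom_dualHom]
  linear_combination -dualHom b * B * h

theorem flat_three_eq (k : ℕ) (a b c : ℤ) :
    flat {3} ![a.toNat, b.toNat, c.toNat, k] = ![a.toNat, b.toNat, c.toNat, 0] := by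
  funext i
  fin_cases i <;> simp [flat]

theorem IsSolidWithBoundary.hasIdeal_leg_four (h : IsSolidWithBoundary {3} π ρ) (k : ℕ) :
    HasIdeal (vacChr k - P {0, 1, 2} * chr (wlayer k) π) k (OutsideBoundary {3} π k) := by
  have hπ : ∀ b ∈ π, b 3 = 0 := fun b hb => h.boundary_flat b hb 3 (by simp)
  refine (hasIdeal_vacChr k).sub_boxes hπ (fun a b c => ?_) fun a b c => ?_
  all_goals
    rw [OutsideBoundary, flat_three_eq, memBoxes_iff hπ]
    tauto

theorem IsSolidWithBoundary.not_outsideBoundary_leg_four (h : IsSolidWithBoundary {3} π ρ) {k : ℕ}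
    {v : Box} (hv : v ∈ π) {a b c : ℤ} (ha : a ≤ (v 0 : ℤ)) (hb : b ≤ (v 1 : ℤ))
    (hc : c ≤ (v 2 : ℤ)) : ¬ OutsideBoundary {3} π k a b c := by
  rintro ⟨_, _, _, hnot⟩
  rw [flat_three_eq] at hnot
  refine hnot (h.boundary_lower ?_ hv)
  intro i
  fin_cases i <;> simp <;> omega

theorem IsSolidWithBoundary.chr_union (h : IsSolidWithBoundary {3} π ρ) (k : ℕ) :
    chr (wlayer k) (π ∪ layer k ρ) = chr (wlayer k) π + chr (wlayer k) (layer k ρ) := by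
  refine Finset.sum_union (Finset.disjoint_left.2 fun v hv hv' => ?_)
  exact h.not_outsideBoundary_leg_four hv le_rfl le_rfl le_rfl
    (h.outsideBoundary (le_refl k) hv' le_rfl le_rfl le_rfl)

theorem reproduces_leg_four (hq : Generic q K x) (h : IsSolidWithBoundary {3} π ρ) :
    Reproduces q (fun k => d6Coeff q K x wK ∅ (π ∪ layer k ρ)) (fun _ => d6Coeff q K x wK ∅ π)
      (fun k => d6Op q K x wK (wlayer k) ∅ (π ∪ layer k ρ))
      (fun k => d6Op q K x wK (wlayer k) ∅ π)
      ((-1 : ℂ) ^ signLeg4 π ρ * d8Coeff q K x {3} π ρ) (d8Op q K x {3} π ρ) := by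
  obtain ⟨n₀, -, hρ⟩ := exists_lt_of_boxes π ρ
  have hπ : ∀ b ∈ π, b 3 = 0 := fun b hb => h.boundary_flat b hb 3 (by simp)
  have hcoef : ∀ k s, d6Coeff q K x wK ∅ s =
      index q K x (vertexChr (vacChr k) (chr (wlayer k) s)) := fun k s => by
    rw [d6Coeff_eq q K x wK (wlayer k), chr_empty, mul_zero, sub_zero, vacChr]
  have hop : ∀ k s n, n ≠ 0 → d6Op q K x wK (wlayer k) ∅ s n =
      hq.evHom (-n) (vacChr k - P {0, 1, 2} * chr (wlayer k) s) / adams q {0, 1, 2} (-n) :=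
    fun k s n hn => by rw [d6Op_eq hq _ _ _ _ hn, chr_empty, mul_zero, sub_zero, vacChr]
  have hNeq : ∀ k, vacChr k - P {0, 1, 2} * chr (wlayer k) π =
      mono (k • wq 3) * (vacChr 0 - P {0, 1, 2} * chr (wlayer 0) π) := fun k => by
    rw [vacChr_eq, chr_wlayer, vacChr_zero, ← chr_wlayer_zero]
    ring
  have hband : ∀ k, InBand (vacChr k - P {0, 1, 2} * chr (wlayer k) π) 1 0 1 := fun k => by
    have h1 := (inBand_P {0, 1, 2}).mul (inBand_chr k π)
    exact (inBand_vacChr k).sub (h1.mono' le_rfl zero_le_one)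
  have hpos : ∀ s : Finset Box, ∀ v ∈ s, ∀ a b c : ℤ, (v 0 : ℤ) ≤ a → (v 1 : ℤ) ≤ b →
      (v 2 : ℤ) ≤ c → 0 ≤ a ∧ 0 ≤ b ∧ 0 ≤ c := fun s v _ a b c ha hb hc => by omega
  have hl3 : ∀ k, ∀ b ∈ layer k ρ, b 3 = 0 := fun k b hb => (mem_layer.1 hb).1
  have h1 : (fun k => d6Coeff q K x wK ∅ (π ∪ layer k ρ)) = fun k =>
      index q K x (vertexChr (vacChr k) (chr (wlayer k) (π ∪ layer k ρ))) :=
    funext fun k => hcoef k _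
  have h2 : (fun _ : ℕ => d6Coeff q K x wK ∅ π) = fun k =>
      index q K x (vertexChr (vacChr k) (chr (wlayer k) π)) := funext fun k => hcoef k _
  rw [h1, h2]
  -- The boxes of `π` are absorbed into the vacuum numerators, all translates of one another. The
  -- inverted cross term `Q` between `π` and the boxes of `ρ` in the same layer is what this costs.
  refine h.reproduces hq (n₀ := n₀) (N := fun k => vacChr k - P {0, 1, 2} * chr (wlayer k) π)
    (Q := fun k => P {0, 1, 2} * dualHom (chr (wlayer k) π) * chr (wlayer k) (layer k ρ))
    h.hasIdeal_leg_four hband (fun k => ?_) hρ (hband 0) (fun n _ => ?_) (fun k n hn => ?_)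
    (fun k n hn => hop k π n hn)
    (fun k => ⟨inBand_vertexChr (inBand_vacChr k) (inBand_chr _ _), ?_⟩)
    (fun k => ⟨inBand_vertexChr (inBand_vacChr k) (inBand_chr _ _), ?_⟩) (fun k => ?_) (fun k => ?_)
    (fun k => ?_) (fun k => ?_) fun i j hij => ?_
  · rw [map_sub, map_mul, vacChr, map_sub, rank_mono, rank_mono, rank_P ⟨0, by simp⟩]
    simp
  · rw [Finset.sum_congr rfl fun j _ => hNeq j, ← Finset.sum_mul, ← mul_assoc,
      P_three_mul_geom, vacChr_zero,
      ← chr_wlayer_zero, show ({3}ᶜ : Finset (Fin 4)) = {0, 1, 2} by decide]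
    ring
  · rw [hop k _ n hn, h.chr_union, mul_add, sub_sub]
  · refine constTerm_vertex_eq_zero (I' := Outside {3} π ρ k) (hasIdeal_vacChr k) ?_
      (fun b hb => ?_) (hpos _) fun v hv a b c ha hb hc => ?_
    · rw [h.chr_union, mul_add, ← sub_sub]
      exact h.hasIdeal_outside (h.hasIdeal_leg_four k)
    · exact (mem_union.1 hb).elim (hπ b) (hl3 k b)
    · rcases mem_union.1 hv with hv | hv
      · exact fun ho => h.not_outsideBoundary_leg_four hv ha hb hc ho.1
      · exact h.not_outside le_rfl hv ha hb hc
  · exact constTerm_vertex_eq_zero (hasIdeal_vacChr k) (h.hasIdeal_leg_four k) hπ (hpos _)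
      fun v hv _ _ _ => h.not_outsideBoundary_leg_four hv
  · rw [h.chr_union, vertexChr_add_sub]
  · rw [mul_right_comm]
    exact inBand_mul_dualHom ((inBand_chr _ _).mono' le_rfl zero_le_one)
      ((inBand_chr _ _).mono' le_rfl zero_le_one) (inBand_P _)
  · rw [P_zero_one_two, mul_assoc, mul_assoc, mul_assoc]
    refine signedDet_eq_one hq ?_
    simp [rank_mono]
  -- By `P₁₂₃^∨ = -q₄ P₁₂₃`, the cross term is the difference of `q₄⁻¹ N^∨ 𝚷` with and without `π`;
  -- both constant terms vanish, so `Q` brings no sign.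
  · have h3 : P {0, 1, 2} * dualHom (chr (wlayer k) π) * chr (wlayer k) (layer k ρ) =
        mono (-wq 3) * (dualHom (vacChr k - P {0, 1, 2} * chr (wlayer k) π) *
          chr (wlayer k) (layer k ρ)) -
        mono (-wq 3) * (dualHom (vacChr k) * chr (wlayer k) (layer k ρ)) := by
      rw [map_sub, map_mul, dualHom_P_zero_one_two]
      linear_combination -(P {0, 1, 2} * dualHom (chr (wlayer k) π) *
        chr (wlayer k) (layer k ρ)) * mono_ne_zero_mul_neg (wq 3)
    rw [h3, constTerm_sub, constTerm_mono_mul_dualHom_mul_chr (h.hasIdeal_leg_four k) (hl3 k)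
        fun v hv _ _ _ => h.outsideBoundary le_rfl hv,
      constTerm_mono_mul_dualHom_mul_chr (hasIdeal_vacChr k) (hl3 k) (hpos _), sub_zero]
  · have h3 := h.constTerm_mul_dualHom hij (hasIdeal_vacChr j)
      fun a b c hI => ⟨hI.1, hI.2.1, hI.2.2.1⟩
    have h4 := h.constTerm_mul_dualHom hij (h.hasIdeal_leg_four j) fun _ _ _ => id
    have h5 : P univ * chr (wlayer j) π * dualHom (chr (wlayer i) (layer i ρ)) =
        P {3} * vacChr j * dualHom (chr (wlayer i) (layer i ρ)) -
          P {3} * (vacChr j - P {0, 1, 2} * chr (wlayer j) π) *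
            dualHom (chr (wlayer i) (layer i ρ)) := by
      rw [P_univ]
      ring
    rw [constTerm_add, layerChr, layerChr, dual_eq, h5, constTerm_sub, h3, h4, sub_zero, zero_add]

end DTqq

end

theorem mainTheorem9 (q : Fin 4 → ℂ) (K x : ℂ) (hq : q 0 * q 1 * q 2 * q 3 = 1)
    (hgen : ∀ a b c : ℤ, q 0 ^ a * q 1 ^ b * q 2 ^ c = 1 → a = 0 ∧ b = 0 ∧ c = 0)
    (hK : K ≠ 0) (hKgen : ∀ a b c : ℤ, K ≠ q 0 ^ a * q 1 ^ b * q 2 ^ c) (hx : x ≠ 0)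
    (π ρ : Finset DTqq.Box) :
    -- one leg `π` along direction `3`, whose `k`-th layer is the Young diagram `layer k π`
    (DTqq.IsSolidWithBoundary {2} π ρ →
      DTqq.Reproduces q
        (fun k => DTqq.d6Coeff q K x DTqq.wK (DTqq.layer k π) (DTqq.layer k ρ))
        (fun k => DTqq.d6Coeff q K x DTqq.wK (DTqq.layer k π) ∅)
        (fun k => DTqq.d6Op q K x DTqq.wK (DTqq.wlayer k) (DTqq.layer k π) (DTqq.layer k ρ))
        (fun k => DTqq.d6Op q K x DTqq.wK (DTqq.wlayer k) (DTqq.layer k π) ∅)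
        ((-1 : ℂ) ^ DTqq.signLeg3 π ρ * DTqq.d8Coeff q K x {2} π ρ)
        (DTqq.d8Op q K x {2} π ρ)) ∧
    -- one leg `π` along direction `4`; the layers are finite plane partitions which contain `π`
    (DTqq.IsSolidWithBoundary {3} π ρ →
      DTqq.Reproduces q
        (fun k => DTqq.d6Coeff q K x DTqq.wK ∅ (π ∪ DTqq.layer k ρ))
        (fun _ => DTqq.d6Coeff q K x DTqq.wK ∅ π)
        (fun k => DTqq.d6Op q K x DTqq.wK (DTqq.wlayer k) ∅ (π ∪ DTqq.layer k ρ))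
        (fun k => DTqq.d6Op q K x DTqq.wK (DTqq.wlayer k) ∅ π)
        ((-1 : ℂ) ^ DTqq.signLeg4 π ρ * DTqq.d8Coeff q K x {3} π ρ)
        (DTqq.d8Op q K x {3} π ρ)) ∧
    -- one surface along `34`; every layer has the leg `π` along direction `3`
    (DTqq.IsSolidWithBoundary {2, 3} π ρ →
      DTqq.Reproduces q
        (fun k => DTqq.d6Coeff q K x DTqq.wK π (DTqq.layer k ρ))
        (fun _ => DTqq.d6Coeff q K x DTqq.wK π ∅)
        (fun k => DTqq.d6Op q K x DTqq.wK (DTqq.wlayer k) π (DTqq.layer k ρ))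
        (fun k => DTqq.d6Op q K x DTqq.wK (DTqq.wlayer k) π ∅)
        ((-1 : ℂ) ^ DTqq.signFace34 π ρ * DTqq.d8Coeff q K x {2, 3} π ρ)
        (DTqq.d8Op q K x {2, 3} π ρ)) ∧
    -- one surface along `12`; the origin of the `k`-th layer is moved by `height k π` along `3`
    (DTqq.IsSolidWithBoundary {0, 1} π ρ →
      DTqq.Reproduces q
        (fun k => DTqq.d6Coeff q K x (DTqq.wK - DTqq.height k π • DTqq.wq 2) ∅
          (DTqq.lower3 (DTqq.height k π) (DTqq.layer k ρ)))
        (fun k => DTqq.d6Coeff q K x (DTqq.wK - DTqq.height k π • DTqq.wq 2) ∅ ∅)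
        (fun k => DTqq.d6Op q K x (DTqq.wK - DTqq.height k π • DTqq.wq 2)
          (DTqq.wlayer k + DTqq.height k π • DTqq.wq 2) ∅
          (DTqq.lower3 (DTqq.height k π) (DTqq.layer k ρ)))
        (fun k => DTqq.d6Op q K x (DTqq.wK - DTqq.height k π • DTqq.wq 2)
          (DTqq.wlayer k + DTqq.height k π • DTqq.wq 2) ∅ ∅)
        ((-1 : ℂ) ^ DTqq.signFace12 π ρ * DTqq.d8Coeff q K x {0, 1} π ρ)
        (DTqq.d8Op q K x {0, 1} π ρ)) := by
  have h : DTqq.Generic q K x := ⟨hq, hgen, hK, hKgen, hx⟩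
  exact ⟨DTqq.reproduces_leg_three h, DTqq.reproduces_leg_four h,
    DTqq.reproduces_face_three_four h, DTqq.reproduces_face_one_two h⟩
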